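/- \textbf{Theorem (relative Deligne cohomology classifies relative gerbes with connection).} Let $M,N$ be finite-dimensional smooth manifolds (Hausdorff, second countable, without boundary) and $\Phi\in C^\infty(M,N)$. \emph{Relative Deligne cohomology.} Consider pairs of open covers $\mathcal U=\{U_i\}_{i\in I}$ of $M$ and $\mathcal V=\{V_j\}_{j\in J}$ of $N$ with a map $r:I\to J$ such that $\Phi(U_i)\subseteq V_{r(i)}$. Let $T_{\mathcal V}^\bullet$ be the total complex (differential $\delta+(-1)^p d$ on \v{C}ech degree $p$) of the \v{C}ech double complex of $\mathcal V$ with coefficients in $\underline{U(1)}\xrightarrow{d\log}\underline\Omega^1\xrightarrow{d}\underline\Omega^2$, and $T_{\mathcal U}^\bullet$ that of $\mathcal U$ with coefficients in $\underline{U(1)}\xrightarrow{d\log}\underline\Omega^1$, where $d\log f=\frac1{2\pi\sqrt{-1}}f^{-1}df$. Let $\Phi^*:T_{\mathcal V}^\bullet\to T_{\mathcal U}^\bullet$ be the pullback (zero on $\underline\Omega^2$) and let $\operatorname{Cone}^n=T_{\mathcal U}^{n-1}\oplus T_{\mathcal V}^n$ be its mapping cone, with differential $(x,y)\mapsto(\Phi^*y-dx,\,dy)$.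 Define $H_D^2(\Phi)=\varinjlim H^2(\operatorname{Cone}^\bullet)$, the direct limit over refinements of $(\mathcal U,\mathcal V,r)$. \emph{Relative gerbes with connection.} A relative gerbe with connection $(\mathcal L,\mathcal G)$ for $\Phi$ consists of $(\mathcal U,\mathcal V,r)$ as above and of: (a) a gerbe with connection $\mathcal G$ on $\mathcal V$: Hermitian line bundles with Hermitian connection $(L_{jj'},\nabla_{jj'})$ on $V_{jj'}=V_j\cap V_{j'}$, parallel unitary sections $\theta_{jj'j''}$ of $(\delta L)_{jj'j''}=L_{j'j''}\otimes L_{jj''}^{-1}\otimes L_{jj'}$ with $\delta\theta=1$, and $2$-forms $\varpi_j\in\Omega^2(V_j)$ such that $\varpi_{j'}-\varpi_j$ is the curvature of $\nabla_{jj'}$ on $V_{jj'}$ (curvature being $dA$ if $\nabla\sigma=2\pi\sqrt{-1}A\sigma$ for a unitary section $\sigma$); (b) a quasi-line bundle with connection $\mathcal L$ for $\Phi^*\mathcal G$: Hermitian line bundles with Hermitian connection $(E_i,\nabla^E_i)$ on $U_i$, and parallel unitary sections $\psi_{ii'}$ of $E_i\otimes E_{i'}^{-1}\otimes\Phi^*L_{r(i)r(i')}$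 on $U_{ii'}$ with $\delta\psi=\Phi^*\theta$. \emph{Isomorphism.} $(\mathcal L,\mathcal G)$ and $(\mathcal L',\mathcal G')$ are isomorphic if, after restriction to a common refinement of their covers, the gerbe $\mathcal G'\otimes\mathcal G^{-1}$ admits a quasi-line bundle with connection $\mathcal F$ with vanishing error $2$-form (i.e. with curvatures $\varpi'_j-\varpi_j$), such that the line bundle with connection on $M$ that is the difference of the quasi-line bundles $\mathcal L'\otimes\mathcal L^{-1}$ and $\Phi^*\mathcal F$ admits a parallel unitary section. \emph{Claim.} There is exactly one bijection from the set of isomorphism classes of relative gerbes with connection for $\Phi$ (the quotient by the equivalence relation generated by the isomorphism relation) to $H_D^2(\Phi)$ with the following property. If the bundles $L_{jj'}$ and $E_i$ of $(\mathcal L,\mathcal G)$ have unitary sections $\sigma_{jj'}$ over $V_{jj'}$ and $\lambda_i$ over $U_i$, with connection forms $A_{jj'}$ and $l_i$, and if $t$ and $h$ are the $U(1)$-valued cochains with $\theta=t\,\delta\sigma$ and $\psi_{ii'}=h_{ii'}\,\lambda_i\otimes\lambda_{i'}^{-1}\otimes\Phi^*\sigma_{r(i)r(i')}$, then $((h,l),(t,A,\varpi))$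 is a cocycle in $\operatorname{Cone}^2$ and the class of $(\mathcal L,\mathcal G)$ is sent to the class of this cocycle. -/

import Mathlib

open Set TopologicalSpace
open scoped Manifold ContDiff TensorProduct

universe u

/-! ### Differential forms on a smooth manifold without boundary

`X` is a manifold modelled on the normed space `E`. A form is a field defined at every point of `X`;
it is only ever used on an open set on which it is smooth. -/

section Forms

/-- Fields of alternating `k`-forms on the tangent spaces of `X`. -/
abbrev FormField (E : Type*) [NormedAddCommGroup E] [NormedSpace ℝ E]
    (X : Type*) [TopologicalSpace X] [ChartedSpace E X] (k : ℕ) : Type _ :=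
  ∀ x : X, (TangentSpace 𝓘(ℝ, E) x) [⋀^Fin k]→L[ℝ] ℝ

variable {E : Type*} [NormedAddCommGroup E] [NormedSpace ℝ E]
  {X : Type*} [TopologicalSpace X] [ChartedSpace E X] {k : ℕ}

/-- The field of forms `α` written in the preferred chart at `x₀` (its pullback along the inverse
of the chart). -/
noncomputable def formInChart (α : FormField E X k) (x₀ : X) : E → E [⋀^Fin k]→L[ℝ] ℝ :=
  fun y => (α ((extChartAt 𝓘(ℝ, E) x₀).symm y)).compContinuousLinearMap
    (mfderiv 𝓘(ℝ, E) 𝓘(ℝ, E) (extChartAt 𝓘(ℝ, E) x₀).symm y)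

/-- `α` is a smooth `k`-form on the open set `O`: its expression in every preferred chart
is smooth. -/
def SmoothFormOn (α : FormField E X k) (O : Opens X) : Prop :=
  ∀ x₀ : X, ContDiffOn ℝ ∞ (formInChart α x₀)
    ((extChartAt 𝓘(ℝ, E) x₀).target ∩ (extChartAt 𝓘(ℝ, E) x₀).symm ⁻¹' (O : Set X))

/-- The exterior derivative, computed at `x` in the preferred chart at `x`. -/
noncomputable def extD (α : FormField E X k) : FormField E X (k + 1) :=
  fun x => (extDeriv (formInChart α x) (extChartAt 𝓘(ℝ, E) x x)).compContinuousLinearMap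
    (mfderiv 𝓘(ℝ, E) 𝓘(ℝ, E) (extChartAt 𝓘(ℝ, E) x) x)

/-- A field of cotangent vectors, seen as a field of `1`-forms. -/
noncomputable def formOfCovector (α : ∀ x : X, TangentSpace 𝓘(ℝ, E) x →L[ℝ] ℝ) :
    FormField E X 1 :=
  fun x => ContinuousAlternatingMap.ofSubsingleton ℝ (TangentSpace 𝓘(ℝ, E) x) ℝ 0 (α x)

/-- The real number `(2πi)⁻¹ z` for `z` purely imaginary, as an `ℝ`-linear map on `ℂ`. -/
noncomputable def divTwoPiI : ℂ →L[ℝ] ℝ := (2 * Real.pi)⁻¹ • Complex.imCLM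

/-- `dlog f = (2πi)⁻¹ f⁻¹ df` for a function `f` with values in `U(1)`. The group `U(1)` is written
additively, so that all the coefficient groups of the Deligne complex are additive. -/
noncomputable def dlog (f : X → Additive Circle) : FormField E X 1 :=
  formOfCovector fun x => divTwoPiI.comp
    ((((f x).toMul⁻¹ : Circle) : ℂ) •
      mvfderiv 𝓘(ℝ, E) (fun y => ((f y).toMul : ℂ)) x)

variable (E) in
/-- Smoothness on the open set `O` of a `U(1)`-valued function. -/
def CircleSmoothOn (f : X → Additive Circle) (O : Opens X) : Prop :=
  ContMDiffOn 𝓘(ℝ, E) 𝓘(ℝ, ℂ) ∞ (fun y => ((f y).toMul : ℂ)) (O : Set X)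

/-- Pullback of forms along `Φ`. -/
noncomputable def formPullback {E' : Type*} [NormedAddCommGroup E'] [NormedSpace ℝ E']
    {Y : Type*} [TopologicalSpace Y] [ChartedSpace E' Y] (Φ : X → Y) (α : FormField E' Y k) :
    FormField E X k :=
  fun x => (α (Φ x)).compContinuousLinearMap (mfderiv 𝓘(ℝ, E) 𝓘(ℝ, E') Φ x)

end Forms

/-! ### Complex lines with a Hermitian metric

Elements of tensor products of lines `A`, `B`, … and of their duals are described by their coordinates
in the bases given by unit vectors `a`, `b`, …. -/

section Coordinates

variable {A B C D : Type*} [NormedAddCommGroup A] [InnerProductSpace ℂ A]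
  [NormedAddCommGroup B] [InnerProductSpace ℂ B] [NormedAddCommGroup C] [InnerProductSpace ℂ C]
  [NormedAddCommGroup D] [InnerProductSpace ℂ D]

/-- The element `⟨a, ·⟩` of the dual of `A`; for a unit vector `a` of a line it is the dual basis. -/
noncomputable def dualVec (a : A) : Module.Dual ℂ A := (innerSL ℂ a).toLinearMap

/-- `a`, `b`, `c` are unit vectors, and `t = z • (a ⊗ b⁻¹ ⊗ c)`. -/
def HasCoord (t : A ⊗[ℂ] (Module.Dual ℂ B ⊗[ℂ] C)) (a : A) (b : B) (c : C) (z : ℂ) : Prop :=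
  ‖a‖ = 1 ∧ ‖b‖ = 1 ∧ ‖c‖ = 1 ∧ t = z • (a ⊗ₜ[ℂ] (dualVec b ⊗ₜ[ℂ] c))

/-- `a`, `b`, `c` are unit vectors, and `t = z • (a ⊗ b⁻¹ ⊗ c⁻¹)`. -/
def HasCoord' (t : A ⊗[ℂ] (Module.Dual ℂ B ⊗[ℂ] Module.Dual ℂ C)) (a : A) (b : B) (c : C) (z : ℂ) :
    Prop :=
  ‖a‖ = 1 ∧ ‖b‖ = 1 ∧ ‖c‖ = 1 ∧ t = z • (a ⊗ₜ[ℂ] (dualVec b ⊗ₜ[ℂ] dualVec c))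

/-- `a`, `b`, `c`, `d` are unit vectors, and `t = z • (a ⊗ b⁻¹ ⊗ c ⊗ d⁻¹)`. -/
def HasCoord₄ (t : A ⊗[ℂ] (Module.Dual ℂ B ⊗[ℂ] (C ⊗[ℂ] Module.Dual ℂ D)))
    (a : A) (b : B) (c : C) (d : D) (z : ℂ) : Prop :=
  ‖a‖ = 1 ∧ ‖b‖ = 1 ∧ ‖c‖ = 1 ∧ ‖d‖ = 1 ∧
    t = z • (a ⊗ₜ[ℂ] (dualVec b ⊗ₜ[ℂ] (c ⊗ₜ[ℂ] dualVec d)))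

end Coordinates

/-! ### Hermitian line bundles with connection -/

section LineBundles

/-- A smooth Hermitian line bundle on the open subset `W` of `X`: one-dimensional Hermitian fibres
together with an atlas of local unitary frames whose transition functions are smooth. The fibres
are indexed by all points of `X`; those outside `W` play no role. -/
structure HermLineBundle (E : Type*) [NormedAddCommGroup E] [NormedSpace ℝ E]
    {X : Type u} [TopologicalSpace X] [ChartedSpace E X] (W : Opens X) where
  fiber : X → Type u
  [normedAddCommGroup : ∀ x, NormedAddCommGroup (fiber x)]
  [innerProductSpace : ∀ x, InnerProductSpace ℂ (fiber x)]
  finrank_eq_one : ∀ x ∈ W, Module.finrank ℂ (fiber x) = 1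
  ι : Type u
  dom : ι → Opens X
  frame : ι → ∀ x, fiber x
  dom_le : ∀ a, dom a ≤ W
  exists_mem_dom : ∀ x ∈ W, ∃ a, x ∈ dom a
  norm_frame : ∀ a, ∀ x ∈ dom a, ‖frame a x‖ = 1
  smooth_transition : ∀ a b, ContMDiffOn 𝓘(ℝ, E) 𝓘(ℝ, ℂ) ∞
    (fun x => inner ℂ (frame a x) (frame b x)) (dom a ∩ dom b : Set X)

attribute [instance] HermLineBundle.normedAddCommGroup HermLineBundle.innerProductSpace

variable {E : Type*} [NormedAddCommGroup E] [NormedSpace ℝ E]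
  {X : Type u} [TopologicalSpace X] [ChartedSpace E X] {W : Opens X}

/-- `s` is a smooth section over the open set `O`: its coordinates in the frames of the atlas
are smooth. -/
def HermLineBundle.SmoothSection (L : HermLineBundle E W) (O : Opens X)
    (s : ∀ x, L.fiber x) : Prop :=
  O ≤ W ∧ ∀ a, ContMDiffOn 𝓘(ℝ, E) 𝓘(ℝ, ℂ) ∞ (fun x => inner ℂ (L.frame a x) (s x))
    (O ∩ L.dom a : Set X)

/-- `s` is a (smooth) unitary section over the open set `O`. -/
def HermLineBundle.UnitarySection (L : HermLineBundle E W) (O : Opens X)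
    (s : ∀ x, L.fiber x) : Prop :=
  L.SmoothSection O s ∧ ∀ x ∈ O, ‖s x‖ = 1

/-- The connection `1`-form `A` of a unitary section `s` for the differential operator `nabla`,
given by `∇ s = 2πi A s`, that is, `A = (2πi)⁻¹ ⟨s, ∇ s⟩`. -/
noncomputable def HermLineBundle.connectionForm (L : HermLineBundle E W)
    (nabla : (∀ x, L.fiber x) → ∀ x, TangentSpace 𝓘(ℝ, E) x →L[ℝ] L.fiber x)
    (s : ∀ x, L.fiber x) : FormField E X 1 :=
  formOfCovector fun x =>
    divTwoPiI.comp (((innerSL ℂ (s x)).restrictScalars ℝ).comp (nabla s x))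

/-- A Hermitian connection `∇` on `L`: `nabla s x v` is the covariant derivative of `s` at `x` in
the direction `v`; its value is meaningful if `s` is smooth in a neighbourhood of `x`. -/
structure HermConnection (L : HermLineBundle E W) where
  nabla : (∀ x, L.fiber x) → ∀ x, TangentSpace 𝓘(ℝ, E) x →L[ℝ] L.fiber x
  add : ∀ (O : Opens X) (s t : ∀ x, L.fiber x), L.SmoothSection O s → L.SmoothSection O t →
    ∀ x ∈ O, nabla (fun y => s y + t y) x = nabla s x + nabla t x
  leibniz : ∀ (O : Opens X) (f : X → ℂ) (s : ∀ x, L.fiber x),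
    ContMDiffOn 𝓘(ℝ, E) 𝓘(ℝ, ℂ) ∞ f (O : Set X) → L.SmoothSection O s →
    ∀ x ∈ O, ∀ v : TangentSpace 𝓘(ℝ, E) x,
      nabla (fun y => f y • s y) x v =
        mvfderiv 𝓘(ℝ, E) f x v • s x + f x • nabla s x v
  metric : ∀ (O : Opens X) (s t : ∀ x, L.fiber x), L.SmoothSection O s → L.SmoothSection O t →
    ∀ x ∈ O, ∀ v : TangentSpace 𝓘(ℝ, E) x,
      mvfderiv 𝓘(ℝ, E) (fun y => (inner ℂ (s y) (t y) : ℂ)) x v =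
        inner ℂ (nabla s x v) (t x) + inner ℂ (s x) (nabla t x v)
  smooth : ∀ (O : Opens X) (s : ∀ x, L.fiber x), L.UnitarySection O s →
    SmoothFormOn (L.connectionForm nabla s) O

/-- The connection `1`-form of a unitary section: `∇ s = 2πi A s`. -/
noncomputable def HermConnection.form {L : HermLineBundle E W} (D : HermConnection L)
    (s : ∀ x, L.fiber x) : FormField E X 1 :=
  L.connectionForm D.nabla s

/-- The restriction to `W` of the `2`-form `F` is the curvature of the connection: `F = dA` for the
connection form `A` of every local unitary section. -/
def HermConnection.HasCurvature {L : HermLineBundle E W} (D : HermConnection L)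
    (F : FormField E X 2) : Prop :=
  ∀ (O : Opens X) (s : ∀ x, L.fiber x), L.UnitarySection O s → ∀ x ∈ O, F x = extD (D.form s) x

end LineBundles

/-! ### Tensor products, duals and pullbacks of Hermitian line bundles with connection

They are handled through their local unitary frames and the connection forms of these frames. -/

section Tensor

/-- A family of complex lines over `X` presented by local frames: `IsFrame O e A` means that `e` is
one of the distinguished local unitary frames on the open set `O` and that it has connection form
`A` there, i.e. `∇ e = 2πi A e`. -/
structure FramedLine (E : Type*) [NormedAddCommGroup E] [NormedSpace ℝ E]
    (X : Type u) [TopologicalSpace X] [ChartedSpace E X] where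
  fiber : X → Type u
  [addCommGroup : ∀ x, AddCommGroup (fiber x)]
  [module : ∀ x, Module ℂ (fiber x)]
  IsFrame : Opens X → (∀ x, fiber x) → FormField E X 1 → Prop

attribute [instance] FramedLine.addCommGroup FramedLine.module

variable {E : Type*} [NormedAddCommGroup E] [NormedSpace ℝ E]
  {X : Type u} [TopologicalSpace X] [ChartedSpace E X] {W : Opens X}

/-- A Hermitian line bundle with connection: all its local unitary sections are frames. -/
abbrev HermConnection.framed {L : HermLineBundle E W} (D : HermConnection L) : FramedLine E X where
  fiber := L.fiber
  IsFrame O e A := L.UnitarySection O e ∧ A = D.form e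

/-- The dual bundle with the dual connection. -/
abbrev FramedLine.dual (T : FramedLine E X) : FramedLine E X where
  fiber x := Module.Dual ℂ (T.fiber x)
  IsFrame O φ A := ∃ e B, T.IsFrame O e B ∧ (∀ x ∈ O, φ x (e x) = 1) ∧ A = -B

/-- The tensor product bundle with the tensor product connection. -/
abbrev FramedLine.tensor (S T : FramedLine E X) : FramedLine E X where
  fiber x := S.fiber x ⊗[ℂ] T.fiber x
  IsFrame O g C := ∃ e A f B, S.IsFrame O e A ∧ T.IsFrame O f B ∧
    (∀ x, g x = e x ⊗ₜ[ℂ] f x) ∧ C = A + B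

/-- The pullback bundle along `Φ` with the pullback connection. -/
abbrev FramedLine.pullback {E' : Type*} [NormedAddCommGroup E'] [NormedSpace ℝ E']
    {Y : Type u} [TopologicalSpace Y] [ChartedSpace E' Y] (Φ : X → Y) (T : FramedLine E' Y) :
    FramedLine E X where
  fiber x := T.fiber (Φ x)
  IsFrame O e A := ∃ (O' : Opens Y) (e' : ∀ y, T.fiber y) (A' : FormField E' Y 1),
    T.IsFrame O' e' A' ∧ (∀ x ∈ O, Φ x ∈ O') ∧ (∀ x, e x = e' (Φ x)) ∧ A = formPullback Φ A'

/-- `s` is a parallel unitary section over the open set `O`: locally `s = f e` with `e` a unitary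
frame with connection form `A` and `f` a smooth `U(1)`-valued function such that
`∇ s = 2πi (dlog f + A) s` vanishes. -/
def FramedLine.IsParallelUnitary (T : FramedLine E X) (O : Opens X)
    (s : ∀ x, T.fiber x) : Prop :=
  ∀ x ∈ O, ∃ (O' : Opens X) (e : ∀ x, T.fiber x) (A : FormField E X 1) (f : X → Additive Circle),
    x ∈ O' ∧ T.IsFrame O' e A ∧ CircleSmoothOn E f O' ∧
      ∀ y ∈ O', s y = ((f y).toMul : ℂ) • e y ∧ dlog f y + A y = 0

end Tensor

/-! ### Relative gerbes with connection -/

section Gerbes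

/-- Open covers `U` of `M` and `V` of `N` together with a map `r` of the index sets such that
`Φ (U i) ⊆ V (r i)`. -/
structure CoverPair {M N : Type u} [TopologicalSpace M] [TopologicalSpace N] (Φ : M → N) where
  I : Type u
  J : Type u
  U : I → Opens M
  V : J → Opens N
  r : I → J
  exists_mem_U : ∀ x, ∃ i, x ∈ U i
  exists_mem_V : ∀ y, ∃ j, y ∈ V j
  mapsTo : ∀ i, ∀ x ∈ U i, Φ x ∈ V (r i)

/-- A gerbe with connection on the open cover `V` of `N`:
* Hermitian line bundles `L j k` with connection `D j k` on `V j ∩ V k`;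
* parallel unitary sections `θ j k l` of `δL = L k l ⊗ (L j l)⁻¹ ⊗ L j k` on `V j ∩ V k ∩ V l`
  with `δθ = 1`;
* `2`-forms `curving j` on `V j` whose difference on `V j ∩ V k` is the curvature of `D j k`. -/
structure GerbeWithConnection (E : Type*) [NormedAddCommGroup E] [NormedSpace ℝ E]
    {N : Type u} [TopologicalSpace N] [ChartedSpace E N] {J : Type u} (V : J → Opens N) where
  L : ∀ j k, HermLineBundle E (V j ⊓ V k)
  D : ∀ j k, HermConnection (L j k)
  θ : ∀ (j k l : J) (y : N),
    (L k l).fiber y ⊗[ℂ] (Module.Dual ℂ ((L j l).fiber y) ⊗[ℂ] (L j k).fiber y)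
  curving : J → FormField E N 2
  parallel_θ : ∀ j k l,
    ((D k l).framed.tensor ((D j l).framed.dual.tensor (D j k).framed)).IsParallelUnitary
      (V j ⊓ V k ⊓ V l) (θ j k l)
  /-- `δθ = 1`, where `(δθ) j k l m = θ k l m ⊗ (θ j l m)⁻¹ ⊗ θ j k m ⊗ (θ j k l)⁻¹` is evaluated by
  means of unit vectors in the six lines (the result does not depend on them). -/
  δ_θ : ∀ j k l m, ∀ y ∈ V j ⊓ V k ⊓ V l ⊓ V m,
    ∀ (sjk : (L j k).fiber y) (sjl : (L j l).fiber y) (sjm : (L j m).fiber y)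
      (skl : (L k l).fiber y) (skm : (L k m).fiber y) (slm : (L l m).fiber y)
      (zklm zjlm zjkm zjkl : ℂ),
      HasCoord (θ k l m y) slm skm skl zklm → HasCoord (θ j l m y) slm sjm sjl zjlm →
      HasCoord (θ j k m y) skm sjm sjk zjkm → HasCoord (θ j k l y) skl sjl sjk zjkl →
      zklm * zjlm⁻¹ * zjkm * zjkl⁻¹ = 1
  smooth_curving : ∀ j, SmoothFormOn (curving j) (V j)
  δ_curving : ∀ j k, (D j k).HasCurvature (curving k - curving j)

variable (EM EN : Type*) [NormedAddCommGroup EM] [NormedSpace ℝ EM]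
  [NormedAddCommGroup EN] [NormedSpace ℝ EN]
  {M N : Type u} [TopologicalSpace M] [ChartedSpace EM M] [TopologicalSpace N] [ChartedSpace EN N]

/-- A relative gerbe with connection for `Φ : M → N`: a gerbe with connection on `N`, and a
quasi-line bundle with connection for its pullback along `Φ`, consisting of
* Hermitian line bundles `Q i` with connection `DQ i` on `U i`;
* parallel unitary sections `ψ i k` of `Q i ⊗ (Q k)⁻¹ ⊗ Φ^* L (r i) (r k)` on `U i ∩ U k`
  with `δψ = Φ^* θ`. -/
structure RelativeGerbe (Φ : M → N) where
  cover : CoverPair Φ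
  gerbe : GerbeWithConnection EN cover.V
  Q : ∀ i, HermLineBundle EM (cover.U i)
  DQ : ∀ i, HermConnection (Q i)
  ψ : ∀ (i k : cover.I) (x : M),
    (Q i).fiber x ⊗[ℂ] (Module.Dual ℂ ((Q k).fiber x) ⊗[ℂ]
      (gerbe.L (cover.r i) (cover.r k)).fiber (Φ x))
  parallel_ψ : ∀ i k,
    ((DQ i).framed.tensor ((DQ k).framed.dual.tensor
      ((gerbe.D (cover.r i) (cover.r k)).framed.pullback Φ))).IsParallelUnitary
      (cover.U i ⊓ cover.U k) (ψ i k)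
  /-- `δψ = Φ^* θ`, where `(δψ) i k l = ψ k l ⊗ (ψ i l)⁻¹ ⊗ ψ i k` is evaluated by means of unit
  vectors in the six lines (the condition does not depend on them). -/
  δ_ψ : ∀ i k l, ∀ x ∈ cover.U i ⊓ cover.U k ⊓ cover.U l,
    ∀ (qi : (Q i).fiber x) (qk : (Q k).fiber x) (ql : (Q l).fiber x)
      (sik : (gerbe.L (cover.r i) (cover.r k)).fiber (Φ x))
      (sil : (gerbe.L (cover.r i) (cover.r l)).fiber (Φ x))
      (skl : (gerbe.L (cover.r k) (cover.r l)).fiber (Φ x))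
      (wkl wil wik z : ℂ),
      HasCoord (ψ k l x) qk ql skl wkl → HasCoord (ψ i l x) qi ql sil wil →
      HasCoord (ψ i k x) qi qk sik wik →
      HasCoord (gerbe.θ (cover.r i) (cover.r k) (cover.r l) (Φ x)) skl sil sik z →
      wkl * wil⁻¹ * wik = z

/-- A common refinement of two cover pairs `c` and `c'`: covers of `N` by sets `W` and of `M` by
sets `O`, with refinement maps to the covers of `c` and `c'` and a map from the index set of the
`O` to that of the `W` which is compatible with all of these. The index sets are written as the
disjoint unions of the fibres of the refinement maps to `c.J × c'.J` and to `c.I × c'.I`. -/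
structure CommonRefinement {M N : Type u} [TopologicalSpace M] [TopologicalSpace N] {Φ : M → N}
    (c c' : CoverPair Φ) where
  K : c.J → c'.J → Type u
  H : c.I → c'.I → Type u
  m : ∀ i i', H i i' → K (c.r i) (c'.r i')
  W : (Σ p : c.J × c'.J, K p.1 p.2) → Opens N
  O : (Σ q : c.I × c'.I, H q.1 q.2) → Opens M
  W_le : ∀ k, W k ≤ c.V k.1.1 ⊓ c'.V k.1.2
  O_le : ∀ h, O h ≤ c.U h.1.1 ⊓ c'.U h.1.2
  exists_mem_W : ∀ y, ∃ k, y ∈ W k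
  exists_mem_O : ∀ x, ∃ h, x ∈ O h
  mapsTo : ∀ h, ∀ x ∈ O h, Φ x ∈ W ⟨(c.r h.1.1, c'.r h.1.2), m h.1.1 h.1.2 h.2⟩

section

variable {M N : Type u} [TopologicalSpace M] [TopologicalSpace N] {Φ : M → N} {c c' : CoverPair Φ}

/-- The index set of the refined cover of `N`. -/
abbrev CommonRefinement.J (R : CommonRefinement c c') : Type u := Σ p : c.J × c'.J, R.K p.1 p.2

/-- The index set of the refined cover of `M`. -/
abbrev CommonRefinement.I (R : CommonRefinement c c') : Type u := Σ q : c.I × c'.I, R.H q.1 q.2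

/-- The map between the index sets of the refined covers. -/
abbrev CommonRefinement.r (R : CommonRefinement c c') (h : R.I) : R.J :=
  ⟨(c.r h.1.1, c'.r h.1.2), R.m h.1.1 h.1.2 h.2⟩

/-- The common refinement as a cover pair. -/
abbrev CommonRefinement.toCoverPair (R : CommonRefinement c c') : CoverPair Φ where
  I := R.I
  J := R.J
  U := R.O
  V := R.W
  r := R.r
  exists_mem_U := R.exists_mem_O
  exists_mem_V := R.exists_mem_W
  mapsTo := R.mapsTo

end

variable {EM EN}

/-- An isomorphism of relative gerbes with connection, after passing to a common refinement `R`. It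
is a trivialization, preserving connections, of the difference of `𝒢'` and `𝒢`:
* a quasi-line bundle with connection `(F, χ)` for the difference of the gerbes on `N`, i.e.
  Hermitian line bundles `F k` with connection on `W k` and parallel unitary sections `χ k l` of
  `L' ⊗ L⁻¹ ⊗ F k ⊗ (F l)⁻¹` with `δχ = θ' ⊗ θ⁻¹`, with vanishing error `2`-form, i.e. the
  curvature of `F k` is the difference of the curvings;
* parallel unitary sections `η h` of `Q' ⊗ Q⁻¹ ⊗ Φ^* F⁻¹` on `O h`, through which the sections `ψ'`,
  `ψ` and `χ` correspond to each other, so that they are the restrictions of a global section. -/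
structure RelativeGerbe.Isomorphism {Φ : M → N} (𝒢 𝒢' : RelativeGerbe EM EN Φ) where
  R : CommonRefinement 𝒢.cover 𝒢'.cover
  F : ∀ k : R.J, HermLineBundle EN (R.W k)
  DF : ∀ k, HermConnection (F k)
  χ : ∀ (k l : R.J) (y : N),
    (𝒢'.gerbe.L k.1.2 l.1.2).fiber y ⊗[ℂ] (Module.Dual ℂ ((𝒢.gerbe.L k.1.1 l.1.1).fiber y) ⊗[ℂ]
      ((F k).fiber y ⊗[ℂ] Module.Dual ℂ ((F l).fiber y)))
  parallel_χ : ∀ k l,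
    ((𝒢'.gerbe.D k.1.2 l.1.2).framed.tensor ((𝒢.gerbe.D k.1.1 l.1.1).framed.dual.tensor
      ((DF k).framed.tensor (DF l).framed.dual))).IsParallelUnitary (R.W k ⊓ R.W l) (χ k l)
  δ_χ : ∀ k l m : R.J, ∀ y ∈ R.W k ⊓ R.W l ⊓ R.W m,
    ∀ (s'kl : (𝒢'.gerbe.L k.1.2 l.1.2).fiber y) (s'km : (𝒢'.gerbe.L k.1.2 m.1.2).fiber y)
      (s'lm : (𝒢'.gerbe.L l.1.2 m.1.2).fiber y)
      (skl : (𝒢.gerbe.L k.1.1 l.1.1).fiber y) (skm : (𝒢.gerbe.L k.1.1 m.1.1).fiber y)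
      (slm : (𝒢.gerbe.L l.1.1 m.1.1).fiber y)
      (fk : (F k).fiber y) (fl : (F l).fiber y) (fm : (F m).fiber y) (clm ckm ckl z' z : ℂ),
      HasCoord₄ (χ l m y) s'lm slm fl fm clm → HasCoord₄ (χ k m y) s'km skm fk fm ckm →
      HasCoord₄ (χ k l y) s'kl skl fk fl ckl →
      HasCoord (𝒢'.gerbe.θ k.1.2 l.1.2 m.1.2 y) s'lm s'km s'kl z' →
      HasCoord (𝒢.gerbe.θ k.1.1 l.1.1 m.1.1 y) slm skm skl z →
      clm * ckm⁻¹ * ckl = z' * z⁻¹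
  curvature_F : ∀ k, (DF k).HasCurvature (𝒢'.gerbe.curving k.1.2 - 𝒢.gerbe.curving k.1.1)
  η : ∀ (h : R.I) (x : M),
    (𝒢'.Q h.1.2).fiber x ⊗[ℂ] (Module.Dual ℂ ((𝒢.Q h.1.1).fiber x) ⊗[ℂ]
      Module.Dual ℂ ((F (R.r h)).fiber (Φ x)))
  parallel_η : ∀ h,
    ((𝒢'.DQ h.1.2).framed.tensor ((𝒢.DQ h.1.1).framed.dual.tensor
      ((DF (R.r h)).framed.pullback Φ).dual)).IsParallelUnitary (R.O h) (η h)
  /-- `ψ' ⊗ ψ⁻¹ = Φ^* χ ⊗ η g ⊗ (η h)⁻¹`, evaluated by means of unit vectors in the eight lines. -/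
  δ_η : ∀ g h : R.I, ∀ x ∈ R.O g ⊓ R.O h,
    ∀ (q'g : (𝒢'.Q g.1.2).fiber x) (q'h : (𝒢'.Q h.1.2).fiber x)
      (qg : (𝒢.Q g.1.1).fiber x) (qh : (𝒢.Q h.1.1).fiber x)
      (s' : (𝒢'.gerbe.L (𝒢'.cover.r g.1.2) (𝒢'.cover.r h.1.2)).fiber (Φ x))
      (s : (𝒢.gerbe.L (𝒢.cover.r g.1.1) (𝒢.cover.r h.1.1)).fiber (Φ x))
      (fg : (F (R.r g)).fiber (Φ x)) (fh : (F (R.r h)).fiber (Φ x)) (w' w c ag ah : ℂ),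
      HasCoord (𝒢'.ψ g.1.2 h.1.2 x) q'g q'h s' w' → HasCoord (𝒢.ψ g.1.1 h.1.1 x) qg qh s w →
      HasCoord₄ (χ (R.r g) (R.r h) (Φ x)) s' s fg fh c →
      HasCoord' (η g x) q'g qg fg ag → HasCoord' (η h x) q'h qh fh ah →
      w' * w⁻¹ = c * ag * ah⁻¹

variable (EM EN) in
/-- The isomorphism classes of relative gerbes with connection for `Φ`. -/
def RelativeGerbeClass (Φ : M → N) : Type _ :=
  Quot fun 𝒢 𝒢' : RelativeGerbe EM EN Φ => Nonempty (𝒢.Isomorphism 𝒢')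

end Gerbes

/-! ### Relative Deligne cohomology in degree two -/

section Deligne

/-- Čech `p`-cochains for an open cover with index set `J`. A cochain has a value on each
intersection of `p + 1` members of the cover; it is represented by fields `A` on the whole space, of
which only the restriction to that intersection matters. -/
abbrev Cech (J : Type*) (p : ℕ) (A : Type*) : Type _ := (Fin (p + 1) → J) → A

/-- The Čech differential. -/
def Cech.δ {J A : Type*} [AddCommGroup A] {p : ℕ} (f : Cech J p A) : Cech J (p + 1) A :=
  fun s => ∑ k : Fin (p + 2), (-1 : ℤ) ^ (k : ℕ) • f (s ∘ k.succAbove)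

/-- The intersection of the members `V (s 0), …, V (s p)` of a cover. -/
def interOpens {X J : Type*} [TopologicalSpace X] (V : J → Opens X) {p : ℕ}
    (s : Fin (p + 1) → J) : Opens X :=
  Finset.univ.inf fun k => V (s k)

/-- The cochain `f` is zero: it vanishes at all points of the intersections of the cover. -/
def Cech.IsZero {X J : Type*} [TopologicalSpace X] {A : X → Type*} [∀ x, Zero (A x)] {p : ℕ}
    (V : J → Opens X) (f : Cech J p (∀ x, A x)) : Prop :=
  ∀ s, ∀ x ∈ interOpens V s, f s x = 0

/-- `U(1)`-valued functions, written additively. -/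
abbrev CircleField (X : Type*) : Type _ := X → Additive Circle

section Total

variable (E : Type*) [NormedAddCommGroup E] [NormedSpace ℝ E]
  (X : Type*) [TopologicalSpace X] [ChartedSpace E X] (J : Type*)

/-- Degree `1` of the total complex of the Čech double complex with coefficients in
`U(1) → Ω¹` or in `U(1) → Ω¹ → Ω²`. -/
abbrev Total1 : Type _ := Cech J 1 (CircleField X) × Cech J 0 (FormField E X 1)

/-- Degree `2` of the total complex with coefficients in `U(1) → Ω¹`. -/
abbrev TruncTotal2 : Type _ := Cech J 2 (CircleField X) × Cech J 1 (FormField E X 1)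

/-- Degree `2` of the total complex with coefficients in `U(1) → Ω¹ → Ω²`. -/
abbrev Total2 : Type _ :=
  Cech J 2 (CircleField X) × Cech J 1 (FormField E X 1) × Cech J 0 (FormField E X 2)

/-- Degree `3` of the total complex with coefficients in `U(1) → Ω¹ → Ω²`. -/
abbrev Total3 : Type _ :=
  Cech J 3 (CircleField X) × Cech J 2 (FormField E X 1) × Cech J 1 (FormField E X 2)

variable {X J}

/-- The total differential `δ + (-1)ᵖ d` in degree `0`. -/
noncomputable def totalD0 (a : Cech J 0 (CircleField X)) : Total1 E X J :=
  (a.δ, fun s => dlog (a s))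

variable {E}

/-- The total differential `δ + (-1)ᵖ d` in degree `1`, coefficients `U(1) → Ω¹`. -/
noncomputable def truncTotalD1 (b : Total1 E X J) : TruncTotal2 E X J :=
  (b.1.δ, b.2.δ - fun s => dlog (b.1 s))

/-- The total differential `δ + (-1)ᵖ d` in degree `1`, coefficients `U(1) → Ω¹ → Ω²`. -/
noncomputable def totalD1 (b : Total1 E X J) : Total2 E X J :=
  (b.1.δ, b.2.δ - fun s => dlog (b.1 s), fun s => extD (b.2 s))

/-- The total differential `δ + (-1)ᵖ d` in degree `2`, coefficients `U(1) → Ω¹ → Ω²`. -/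
noncomputable def totalD2 (c : Total2 E X J) : Total3 E X J :=
  (c.1.δ, c.2.1.δ + fun s => dlog (c.1 s), c.2.2.δ - fun s => extD (c.2.1 s))

end Total

variable {EM EN : Type*} [NormedAddCommGroup EM] [NormedSpace ℝ EM]
  [NormedAddCommGroup EN] [NormedSpace ℝ EN]
  {M N : Type u} [TopologicalSpace M] [ChartedSpace EM M] [TopologicalSpace N] [ChartedSpace EN N]
  {Φ : M → N}

/-- Pullback of cochains with coefficients in `U(1)`. -/
def CoverPair.pullCircle (c : CoverPair Φ) {p : ℕ} (f : Cech c.J p (CircleField N)) :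
    Cech c.I p (CircleField M) :=
  fun s x => f (c.r ∘ s) (Φ x)

/-- Pullback of cochains with coefficients in differential forms. -/
noncomputable def CoverPair.pullForm (c : CoverPair Φ) {p k : ℕ}
    (f : Cech c.J p (FormField EN N k)) : Cech c.I p (FormField EM M k) :=
  fun s => formPullback Φ (f (c.r ∘ s))

namespace CoverPair

variable (EM EN) (c : CoverPair Φ)

/-- Degree `1` of the mapping cone of the pullback `T_N → T_M`, where `T_N` is the total complex of
`U(1) → Ω¹ → Ω²` on `N` and `T_M` that of `U(1) → Ω¹` on `M`. -/
abbrev Cone1 : Type _ := Cech c.I 0 (CircleField M) × Total1 EN N c.J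

/-- Degree `2` of the mapping cone. -/
abbrev Cone2 : Type _ := Total1 EM M c.I × Total2 EN N c.J

/-- Degree `3` of the mapping cone; the pullback of `Ω²` is zero. -/
abbrev Cone3 : Type _ := TruncTotal2 EM M c.I × Total3 EN N c.J

variable {EN}

/-- The differential `(x, y) ↦ (Φ^* y - d x, d y)` of the mapping cone in degree `1`. -/
noncomputable def coneD1 (b : c.Cone1 EN) : c.Cone2 EM EN :=
  ((c.pullCircle b.2.1, c.pullForm b.2.2) - totalD0 EM b.1, totalD1 b.2)

variable {EM}

/-- The differential `(x, y) ↦ (Φ^* y - d x, d y)` of the mapping cone in degree `2`. -/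
noncomputable def coneD2 (z : c.Cone2 EM EN) : c.Cone3 EM EN :=
  ((c.pullCircle z.2.1, c.pullForm z.2.2.1) - truncTotalD1 z.1, totalD2 z.2)

/-- Smooth cochains of degree `1` of the cone. -/
def Smooth1 (EM : Type*) [NormedAddCommGroup EM] [NormedSpace ℝ EM] [ChartedSpace EM M]
    (b : c.Cone1 EN) : Prop :=
  (∀ s, CircleSmoothOn EM (b.1 s) (interOpens c.U s)) ∧
  (∀ s, CircleSmoothOn EN (b.2.1 s) (interOpens c.V s)) ∧
  (∀ s, SmoothFormOn (b.2.2 s) (interOpens c.V s))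

/-- Smooth cochains of degree `2` of the cone. -/
def Smooth2 (z : c.Cone2 EM EN) : Prop :=
  (∀ s, CircleSmoothOn EM (z.1.1 s) (interOpens c.U s)) ∧
  (∀ s, SmoothFormOn (z.1.2 s) (interOpens c.U s)) ∧
  (∀ s, CircleSmoothOn EN (z.2.1 s) (interOpens c.V s)) ∧
  (∀ s, SmoothFormOn (z.2.2.1 s) (interOpens c.V s)) ∧
  (∀ s, SmoothFormOn (z.2.2.2 s) (interOpens c.V s))

/-- The cochain `z` of degree `2` of the cone is zero, as a cochain for the covers of `c`. -/
def IsZero2 (z : c.Cone2 EM EN) : Prop :=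
  Cech.IsZero c.U z.1.1 ∧ Cech.IsZero c.U z.1.2 ∧
  Cech.IsZero c.V z.2.1 ∧ Cech.IsZero c.V z.2.2.1 ∧ Cech.IsZero c.V z.2.2.2

/-- The cochain `z` of degree `3` of the cone is zero, as a cochain for the covers of `c`. -/
def IsZero3 (z : c.Cone3 EM EN) : Prop :=
  Cech.IsZero c.U z.1.1 ∧ Cech.IsZero c.U z.1.2 ∧
  Cech.IsZero c.V z.2.1 ∧ Cech.IsZero c.V z.2.2.1 ∧ Cech.IsZero c.V z.2.2.2

variable (EM EN)

/-- The cocycles of degree `2` of the mapping cone. -/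
structure Cocycle where
  val : c.Cone2 EM EN
  smooth : c.Smooth2 val
  closed : c.IsZero3 (c.coneD2 val)

end CoverPair

/-- Restriction of degree `2` cochains of the cone along maps of index sets (refinement maps). -/
def coneRestrict {I J I' J' : Type*} (ρ : I' → I) (σ : J' → J)
    (z : Total1 EM M I × Total2 EN N J) : Total1 EM M I' × Total2 EN N J' :=
  ((fun s => z.1.1 (ρ ∘ s), fun s => z.1.2 (ρ ∘ s)),
    fun s => z.2.1 (σ ∘ s), fun s => z.2.2.1 (σ ∘ s), fun s => z.2.2.2 (σ ∘ s))

variable (EM EN) in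
/-- Two cocycles, for possibly different covers, have the same class in the direct limit: on some
common refinement their difference is the coboundary of a smooth cochain. -/
def SameDeligneClass (Φ : M → N) (a b : Σ c : CoverPair Φ, c.Cocycle EM EN) : Prop :=
  ∃ (R : CommonRefinement a.1 b.1) (β : R.toCoverPair.Cone1 EN),
    R.toCoverPair.Smooth1 EM β ∧
    R.toCoverPair.IsZero2
      (coneRestrict (fun h : R.I => h.1.2) (fun k : R.J => k.1.2) b.2.val
        - coneRestrict (fun h : R.I => h.1.1) (fun k : R.J => k.1.1)
            a.2.val
        - R.toCoverPair.coneD1 EM β)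

variable (EM EN) in
/-- The second relative Deligne cohomology of `Φ`: the direct limit, over all pairs of covers, of
the cohomology in degree `2` of the mapping cone. -/
def RelativeDeligneH2 (Φ : M → N) : Type _ :=
  Quot (SameDeligneClass EM EN Φ)

/-- The cochain `z = ((h, l), (t, A, ϖ))` of the cone is read off from the relative gerbe with
connection `𝒢` by means of unitary sections `s j k` of `L j k` and `q i` of `Q i`:
`θ = t · δs` and `ψ = h · (δq⁻¹ ⊗ Φ^* s)`, `A` and `l` are the connection forms of `s` and `q`,
and `ϖ` is the curving. -/
structure RelativeGerbe.IsReadOff (𝒢 : RelativeGerbe EM EN Φ)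
    (s : ∀ j k y, (𝒢.gerbe.L j k).fiber y) (q : ∀ i x, (𝒢.Q i).fiber x)
    (z : 𝒢.cover.Cone2 EM EN) : Prop where
  eq_h : ∀ i : Fin 2 → 𝒢.cover.I, ∀ x ∈ interOpens 𝒢.cover.U i,
    HasCoord (𝒢.ψ (i 0) (i 1) x) (q (i 0) x) (q (i 1) x)
      (s (𝒢.cover.r (i 0)) (𝒢.cover.r (i 1)) (Φ x)) ((z.1.1 i x).toMul : ℂ)
  eq_l : ∀ i : Fin 1 → 𝒢.cover.I, ∀ x ∈ interOpens 𝒢.cover.U i,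
    z.1.2 i x = (𝒢.DQ (i 0)).form (q (i 0)) x
  eq_t : ∀ j : Fin 3 → 𝒢.cover.J, ∀ y ∈ interOpens 𝒢.cover.V j,
    HasCoord (𝒢.gerbe.θ (j 0) (j 1) (j 2) y) (s (j 1) (j 2) y) (s (j 0) (j 2) y) (s (j 0) (j 1) y)
      ((z.2.1 j y).toMul : ℂ)
  eq_A : ∀ j : Fin 2 → 𝒢.cover.J, ∀ y ∈ interOpens 𝒢.cover.V j,
    z.2.2.1 j y = (𝒢.gerbe.D (j 0) (j 1)).form (s (j 0) (j 1)) y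
  eq_ϖ : ∀ j : Fin 1 → 𝒢.cover.J, ∀ y ∈ interOpens 𝒢.cover.V j,
    z.2.2.2 j y = 𝒢.gerbe.curving (j 0) y

end Deligne

/-! Suppose the bundles of a relative gerbe have unitary sections over the sets of its covers. In
these sections it becomes a cochain ((h, l), (t, A, ϖ)), and its axioms are the five components of
the cocycle equation of the cone: δθ = 1 gives δt = 0, parallelism of θ gives δA + dlog t = 0, the
curvature condition gives δϖ = dA, δψ = Φ^*θ gives δh = Φ^*t, and parallelism of ψ gives Φ^*A = δl -
dlog h. Likewise an isomorphism whose bundles F have unitary sections is a cochain β of degree 1,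
made of the coordinates of η and χ and the connection forms of F, and its axioms say that β cobounds
the difference of the two cocycles (`sameDeligneClass`). Conversely, trivial bundles with connection
d + 2πiA realise every cocycle (`toGerbe`) and every coboundary (`nonempty_isomorphism`).

It remains to find unitary sections after refinement. Bundles on single sets are trivial on small
pieces, but L_{jj'} lives on a double intersection and need not be trivial on those of a given
refinement. Paracompactness of N yields a refinement indexed by points whose double intersections
are small enough (`exists_pointwise_refinement`), and θ carries the sections over to all pairs of
original indices (`exists_sectionData`). No good cover is needed.

Independence of the choices is formal: a gerbe is isomorphic to itself, and `sameDeligneClass` may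
be applied to this isomorphism with two different systems of sections. The analytic input is small:
a change of section adds dlog g to the connection form (`form_smul`), d dlog = 0 (`extD_dlog`), and
dlog commutes with pullback (`dlog_comp`). The pullback of 2-forms is zero in the cone, so pullback
is never compared with d of a 1-form.

Uniqueness: every class contains some `toGerbe` of a cocycle, whose bundles have unitary sections
over its own covers, and there the required property prescribes the value. -/

section
-- Calculus of smooth `U(1)`-valued functions and of dlog.
variable {E : Type*} [NormedAddCommGroup E] [NormedSpace ℝ E]
  {X : Type*} [TopologicalSpace X] [ChartedSpace E X] {k : ℕ}

theorem mvfderiv_complex_mul {f g : X → ℂ} {x : X} (hf : MDifferentiableAt 𝓘(ℝ, E) 𝓘(ℝ, ℂ) f x)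
    (hg : MDifferentiableAt 𝓘(ℝ, E) 𝓘(ℝ, ℂ) g x) (v : TangentSpace 𝓘(ℝ, E) x) :
    mvfderiv 𝓘(ℝ, E) (fun y => f y * g y) x v
      = f x * mvfderiv 𝓘(ℝ, E) g x v + mvfderiv 𝓘(ℝ, E) f x v * g x := by
  have h := (hf.hasMFDerivAt.mul' hg.hasMFDerivAt).mfderiv
  have h2 : mvfderiv 𝓘(ℝ, E) (fun y => f y * g y) x v
     = mfderiv 𝓘(ℝ, E) 𝓘(ℝ, ℂ) (f * g) x v := rfl
  rw [h2, h]
  rfl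

theorem divTwoPiI_apply (z : ℂ) : divTwoPiI z = (2 * Real.pi)⁻¹ * z.im := rfl

theorem dlog_apply (f : X → Additive Circle) (x : X) (v : Fin 1 → TangentSpace 𝓘(ℝ, E) x) :
    dlog f x v = divTwoPiI (((f x).toMul⁻¹ : Circle) *
      mvfderiv 𝓘(ℝ, E) (fun y => ((f y).toMul : ℂ)) x (v 0)) := rfl

theorem mvfderiv_congr {f g : X → ℂ} {x : X} (h : f =ᶠ[nhds x] g) :
    mvfderiv 𝓘(ℝ, E) f x = mvfderiv 𝓘(ℝ, E) g x := by
  ext v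
  have := h.mfderiv_eq (I := 𝓘(ℝ, E)) (I' := 𝓘(ℝ, ℂ))
  exact congrArg (fun (l : TangentSpace 𝓘(ℝ, E) x →L[ℝ] ℂ) => l v) this

theorem dlog_congr {f g : X → Additive Circle} {x : X} (h : f =ᶠ[nhds x] g) :
    dlog (E := E) f x = dlog g x := by
  ext v
  rw [dlog_apply, dlog_apply, h.eq_of_nhds,
    mvfderiv_congr (f := fun y => ((f y).toMul : ℂ)) (g := fun y => ((g y).toMul : ℂ))
      (h.fun_comp fun z => (z.toMul : ℂ))]

theorem CircleSmoothOn.mdifferentiableAt {f : X → Additive Circle} {O : Opens X}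
    (hf : CircleSmoothOn E f O) {x : X} (hx : x ∈ O) :
    MDifferentiableAt 𝓘(ℝ, E) 𝓘(ℝ, ℂ) (fun y => ((f y).toMul : ℂ)) x :=
  (hf.contMDiffAt (O.isOpen.mem_nhds hx)).mdifferentiableAt (by simp)

theorem dlog_add {f g : X → Additive Circle} {O : Opens X} (hf : CircleSmoothOn E f O)
    (hg : CircleSmoothOn E g O) {x : X} (hx : x ∈ O) :
    dlog (E := E) (f + g) x = dlog f x + dlog g x := by
  ext v
  rw [ContinuousAlternatingMap.add_apply, dlog_apply, dlog_apply, dlog_apply, ← map_add]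
  congr 1
  have h := mvfderiv_complex_mul (hf.mdifferentiableAt hx) (hg.mdifferentiableAt hx) (v 0)
  have h1 : (fun y => (((f + g) y).toMul : ℂ)) =
    fun y => ((f y).toMul : ℂ) * ((g y).toMul : ℂ) := by ext y; simp
  rw [h1, h]
  simp only [Pi.add_apply, toMul_add, mul_inv, Circle.coe_mul, Circle.coe_inv]
  have hf0 := Circle.coe_ne_zero (f x).toMul
  have hg0 := Circle.coe_ne_zero (g x).toMul
  field_simp
  ring

theorem dlog_const (c : Additive Circle) (x : X) : dlog (E := E) (fun _ => c) x = 0 := by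
  ext v
  rw [dlog_apply]
  have : mvfderiv 𝓘(ℝ, E) (fun _ : X => (c.toMul : ℂ)) x = 0 := mvfderiv_const _
  rw [this]
  simp

theorem dlog_zero (x : X) : dlog (E := E) (0 : X → Additive Circle) x = 0 := dlog_const 0 x

theorem contMDiffOn_complex_mul {f g : X → ℂ} {s : Set X}
    (hf : ContMDiffOn 𝓘(ℝ, E) 𝓘(ℝ, ℂ) ∞ f s) (hg : ContMDiffOn 𝓘(ℝ, E) 𝓘(ℝ, ℂ) ∞ g s) :
    ContMDiffOn 𝓘(ℝ, E) 𝓘(ℝ, ℂ) ∞ (fun x => f x * g x) s :=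
  ContMDiff.comp_contMDiffOn (g := fun p : ℂ × ℂ => p.1 * p.2)
    (contDiff_mul (𝕜 := ℝ)).contMDiff (hf.prodMk_space hg)

theorem contMDiffOn_complex_conj {f : X → ℂ} {s : Set X}
    (hf : ContMDiffOn 𝓘(ℝ, E) 𝓘(ℝ, ℂ) ∞ f s) :
    ContMDiffOn 𝓘(ℝ, E) 𝓘(ℝ, ℂ) ∞ (fun x => (starRingEnd ℂ) (f x)) s :=
  Complex.conjCLE.contDiff.contMDiff.comp_contMDiffOn hf

theorem CircleSmoothOn.add {f g : X → Additive Circle} {O : Opens X} (hf : CircleSmoothOn E f O)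
    (hg : CircleSmoothOn E g O) : CircleSmoothOn E (f + g) O := by
  unfold CircleSmoothOn at *
  exact contMDiffOn_complex_mul hf hg

theorem CircleSmoothOn.neg {f : X → Additive Circle} {O : Opens X} (hf : CircleSmoothOn E f O) :
    CircleSmoothOn E (-f) O := by
  unfold CircleSmoothOn at *
  refine (contMDiffOn_complex_conj hf).congr fun x _ => ?_
  exact Circle.coe_inv_eq_conj _

theorem circleSmoothOn_const (c : Additive Circle) (O : Opens X) :
    CircleSmoothOn E (fun _ : X => c) O := contMDiffOn_const

theorem CircleSmoothOn.mono {f : X → Additive Circle} {O O' : Opens X}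
    (hf : CircleSmoothOn E f O) (h : O' ≤ O) : CircleSmoothOn E f O' := ContMDiffOn.mono hf h

theorem CircleSmoothOn.congr {f g : X → Additive Circle} {O : Opens X}
    (hf : CircleSmoothOn E f O) (h : ∀ x ∈ O, g x = f x) : CircleSmoothOn E g O :=
  ContMDiffOn.congr hf fun x hx => by rw [h x hx]

theorem circleSmoothOn_of_local {f : X → Additive Circle} {O : Opens X}
    (h : ∀ x ∈ O, ∃ O' : Opens X, x ∈ O' ∧ CircleSmoothOn E f (O ⊓ O')) : CircleSmoothOn E f O :=
  contMDiffOn_of_locally_contMDiffOn fun x hx => by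
    obtain ⟨O', hx', h'⟩ := h x hx
    exact ⟨O', O'.isOpen, hx', h'⟩

theorem dlog_neg {f : X → Additive Circle} {O : Opens X} (hf : CircleSmoothOn E f O)
    {x : X} (hx : x ∈ O) : dlog (E := E) (-f) x = -dlog f x := by
  rw [eq_neg_iff_add_eq_zero, ← dlog_add hf.neg hf hx, neg_add_cancel, dlog_zero]

section Pullback
variable {E' : Type*} [NormedAddCommGroup E'] [NormedSpace ℝ E']
    {Y : Type*} [TopologicalSpace Y] [ChartedSpace E' Y]

theorem dlog_comp {Φ : X → Y} {f : Y → Additive Circle} {O : Opens Y} (hf : CircleSmoothOn E' f O)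
    {x : X} (hΦ : MDifferentiableAt 𝓘(ℝ, E) 𝓘(ℝ, E') Φ x) (hx : Φ x ∈ O) :
    dlog (E := E) (fun x => f (Φ x)) x = (formPullback Φ (dlog (E := E') f) : FormField E X 1) x := by
  ext v
  have h := mfderiv_comp x (hf.mdifferentiableAt hx) hΦ
  show divTwoPiI (_ * _) = divTwoPiI (_ * _)
  congr 2
  exact congrArg (fun (l : TangentSpace 𝓘(ℝ, E) x →L[ℝ] ℂ) => l (v 0)) h

theorem formPullback_congr {Φ : X → Y} {α β : FormField E' Y k} {x : X} (h : α (Φ x) = β (Φ x)) :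
    (formPullback Φ α : FormField E X k) x = formPullback Φ β x := by
  unfold formPullback; rw [h]

theorem CircleSmoothOn.comp {Φ : X → Y} {f : Y → Additive Circle} {O : Opens Y} {O' : Opens X}
    (hf : CircleSmoothOn E' f O) (hΦ : ContMDiff 𝓘(ℝ, E) 𝓘(ℝ, E') ∞ Φ)
    (h : ∀ x ∈ O', Φ x ∈ O) : CircleSmoothOn E (fun x => f (Φ x)) O' :=
  ContMDiffOn.comp (g := fun y => ((f y).toMul : ℂ)) hf hΦ.contMDiffOn h

end Pullback
end

/-! ### Forms in charts, the exterior derivative, and d dlog = 0. -/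

section
variable {E : Type*} [NormedAddCommGroup E] [NormedSpace ℝ E]
  {X : Type*} [TopologicalSpace X] [ChartedSpace E X] {k : ℕ}

theorem formInChart_add (α β : FormField E X k) (x₀ : X) :
    formInChart (α + β) x₀ = formInChart α x₀ + formInChart β x₀ := rfl

theorem formInChart_congr {α β : FormField E X k} {x₀ : X} {y : E}
    (h : α ((extChartAt 𝓘(ℝ, E) x₀).symm y) = β ((extChartAt 𝓘(ℝ, E) x₀).symm y)) :
    formInChart α x₀ y = formInChart β x₀ y := by
  unfold formInChart; rw [h]

/-- The part of the image of the preferred chart at `x₀` which corresponds to `O`. -/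
def chartImage (E : Type*) [NormedAddCommGroup E] [NormedSpace ℝ E] [ChartedSpace E X] (x₀ : X)
    (O : Opens X) : Set E :=
  (extChartAt 𝓘(ℝ, E) x₀).target ∩ (extChartAt 𝓘(ℝ, E) x₀).symm ⁻¹' (O : Set X)

theorem isOpen_chartImage (x₀ : X) (O : Opens X) : IsOpen (chartImage E x₀ O) :=
  (continuousOn_extChartAt_symm x₀).isOpen_inter_preimage (isOpen_extChartAt_target x₀) O.isOpen

theorem mem_chartImage {x : X} {O : Opens X} (hx : x ∈ O) :
    extChartAt 𝓘(ℝ, E) x x ∈ chartImage E x O :=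
  ⟨mem_extChartAt_target x, by simpa using hx⟩

theorem SmoothFormOn.congr {α β : FormField E X k} {O : Opens X} (h : SmoothFormOn α O)
    (hab : ∀ x ∈ O, β x = α x) : SmoothFormOn β O := fun x₀ =>
  (h x₀).congr fun _ hy => formInChart_congr (hab _ hy.2)

theorem SmoothFormOn.mono {α : FormField E X k} {O O' : Opens X} (h : SmoothFormOn α O)
    (hO : O' ≤ O) : SmoothFormOn α O' := fun x₀ =>
  (h x₀).mono fun _ hy => ⟨hy.1, hO hy.2⟩

theorem SmoothFormOn.add {α β : FormField E X k} {O : Opens X} (hα : SmoothFormOn α O)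
    (hβ : SmoothFormOn β O) : SmoothFormOn (α + β) O := fun x₀ => (hα x₀).add (hβ x₀)

theorem smoothFormOn_zero (O : Opens X) : SmoothFormOn (0 : FormField E X k) O := fun x₀ =>
  (contDiffOn_const (c := (0 : E [⋀^Fin k]→L[ℝ] ℝ))).congr fun _ _ => by ext; rfl

theorem extD_congr {α β : FormField E X k} {O : Opens X} (h : ∀ x ∈ O, α x = β x) {x : X}
    (hx : x ∈ O) : extD α x = extD β x := by
  unfold extD
  congr 1
  apply Filter.EventuallyEq.extDeriv_eq
  filter_upwards [(isOpen_chartImage x O).mem_nhds (mem_chartImage hx)] with y hy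
  exact formInChart_congr (h _ hy.2)

theorem SmoothFormOn.differentiableAt {α : FormField E X k} {O : Opens X} (hα : SmoothFormOn α O)
    {x : X} (hx : x ∈ O) : DifferentiableAt ℝ (formInChart α x) (extChartAt 𝓘(ℝ, E) x x) :=
  ((hα x).contDiffAt ((isOpen_chartImage x O).mem_nhds (mem_chartImage hx))).differentiableAt
    (by simp)

theorem extD_add {α β : FormField E X k} {O : Opens X} (hα : SmoothFormOn α O)
    (hβ : SmoothFormOn β O) {x : X} (hx : x ∈ O) : extD (α + β) x = extD α x + extD β x := by
  unfold extD
  rw [formInChart_add, extDeriv_add (hα.differentiableAt hx) (hβ.differentiableAt hx)]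
  rfl

theorem extD_zero (x : X) : extD (0 : FormField E X k) x = 0 := by
  unfold extD
  have : formInChart (0 : FormField E X k) x = 0 := by ext; rfl
  rw [this]
  have h2 : extDeriv (0 : E → E [⋀^Fin k]→L[ℝ] ℝ) (extChartAt 𝓘(ℝ, E) x x) = 0 := by
    have := extDeriv_smul (0 : ℝ) (0 : E → E [⋀^Fin k]→L[ℝ] ℝ) (x := extChartAt 𝓘(ℝ, E) x x)
    simpa using this
  rw [h2]
  rfl

/-- A `U(1)`-valued function in the preferred chart at `x₀`. -/
noncomputable def circleInChart (E : Type*) [NormedAddCommGroup E] [NormedSpace ℝ E]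
    [ChartedSpace E X] (f : X → Additive Circle) (x₀ : X) : E → ℂ :=
  fun y => ((f ((extChartAt 𝓘(ℝ, E) x₀).symm y)).toMul : ℂ)

theorem circleInChart_ne_zero (f : X → Additive Circle) (x₀ : X) (y : E) :
    circleInChart E f x₀ y ≠ 0 := Circle.coe_ne_zero _

variable [IsManifold 𝓘(ℝ, E) ∞ X]

theorem contDiffOn_circleInChart {f : X → Additive Circle} {O : Opens X}
    (hf : CircleSmoothOn E f O) (x₀ : X) :
    ContDiffOn ℝ ∞ (circleInChart E f x₀) (chartImage E x₀ O) := by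
  have h := ContMDiffOn.comp (g := fun y => ((f y).toMul : ℂ)) hf
    ((contMDiffOn_extChartAt_symm (n := ∞) (I := 𝓘(ℝ, E)) x₀).mono
      (inter_subset_left (t := (extChartAt 𝓘(ℝ, E) x₀).symm ⁻¹' (O : Set X)))) fun y hy => hy.2
  exact h.contDiffOn

/-- The chain rule along the inverse chart; it reduces dlog to ordinary derivatives on `E`. -/
theorem formInChart_dlog {f : X → Additive Circle} {O : Opens X} (hf : CircleSmoothOn E f O)
    (x₀ : X) {y : E} (hy : y ∈ chartImage E x₀ O) :
    formInChart (dlog f) x₀ y = ContinuousAlternatingMap.ofSubsingleton ℝ E ℝ 0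
      (divTwoPiI.comp ((circleInChart E f x₀ y)⁻¹ • fderiv ℝ (circleInChart E f x₀) y)) := by
  ext v
  have h1 : MDifferentiableAt 𝓘(ℝ, E) 𝓘(ℝ, E) (extChartAt 𝓘(ℝ, E) x₀).symm y :=
    ((contMDiffOn_extChartAt_symm (n := ∞) (I := 𝓘(ℝ, E)) x₀).contMDiffAt
      ((isOpen_extChartAt_target x₀).mem_nhds hy.1)).mdifferentiableAt (by simp)
  have h := mfderiv_comp y (hf.mdifferentiableAt hy.2) h1
  have h2 : mfderiv 𝓘(ℝ, E) 𝓘(ℝ, ℂ) (circleInChart E f x₀) y = fderiv ℝ (circleInChart E f x₀) y :=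
    mfderiv_eq_fderiv
  have h3 : fderiv ℝ (circleInChart E f x₀) y (v 0) = _ :=
    congrArg (fun (l : E →L[ℝ] ℂ) => l (v 0)) (h2.symm.trans h)
  exact congrArg divTwoPiI (congrArg₂ (· * ·) (Circle.coe_inv _) h3.symm)

theorem SmoothFormOn.dlog {f : X → Additive Circle} {O : Opens X} (hf : CircleSmoothOn E f O) :
    SmoothFormOn (_root_.dlog (E := E) f) O := fun x₀ => by
  have hg := contDiffOn_circleInChart hf x₀
  have hd := hg.fderiv_of_isOpen (isOpen_chartImage x₀ O) (m := ∞) (by simp)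
  have h1 := (hg.inv fun y _ => circleInChart_ne_zero f x₀ y).smul hd
  have h2 := ((ContinuousAlternatingMap.ofSubsingletonLIE (𝕜 := ℝ) (E := E) (F := ℝ) (0 : Fin 1)).contDiff.comp_contDiffOn
    ((ContinuousLinearMap.compL ℝ E ℂ ℝ divTwoPiI).contDiff.comp_contDiffOn h1))
  exact h2.congr fun y hy => formInChart_dlog hf x₀ hy

/-- Near a point f has a smooth logarithm, so that in the chart dlog f is the differential of a real
function u, and d² = 0. As `extD` at x is computed in the chart at x, no change of charts enters. -/
theorem extD_dlog {f : X → Additive Circle} {O : Opens X} (hf : CircleSmoothOn E f O) {x : X}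
    (hx : x ∈ O) : extD (dlog f) x = (0 : TangentSpace 𝓘(ℝ, E) x [⋀^Fin 2]→L[ℝ] ℝ) := by
  set y₀ := extChartAt 𝓘(ℝ, E) x x with hy₀
  have hS : chartImage E x O ∈ nhds y₀ := (isOpen_chartImage x O).mem_nhds (mem_chartImage hx)
  set g := circleInChart E f x with hg
  have hne : ∀ y, g y ≠ 0 := circleInChart_ne_zero f x
  have hgs : ContDiffOn ℝ ∞ g (chartImage E x O) := contDiffOn_circleInChart hf x
  have hga : ContDiffAt ℝ ∞ g y₀ := hgs.contDiffAt hS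
  -- Dividing by the value at `y₀` moves the argument of the logarithm to 1 there, away from the cut
  -- of the principal branch.
  set u : E → ℝ := fun y => divTwoPiI (Complex.log (g y / g y₀)) with hu
  have hslit : ∀ᶠ y in nhds y₀, g y / g y₀ ∈ Complex.slitPlane := by
    have hc : ContinuousAt (fun y => g y / g y₀) y₀ := hga.continuousAt.div_const _
    refine hc.preimage_mem_nhds (Complex.isOpen_slitPlane.mem_nhds ?_)
    rw [div_self (hne _)]
    exact Complex.one_mem_slitPlane
  have hder : ∀ᶠ y in nhds y₀, fderiv ℝ u y = divTwoPiI.comp ((g y)⁻¹ • fderiv ℝ g y) := by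
    filter_upwards [hslit, hS] with y h1 h2
    have hgy : HasFDerivAt g (fderiv ℝ g y) y := ((hgs.contDiffAt
      ((isOpen_chartImage x O).mem_nhds h2)).differentiableAt (by simp)).hasFDerivAt
    have h3 : HasFDerivAt (fun y => g y / g y₀) ((g y₀)⁻¹ • fderiv ℝ g y) y := by
      simp_rw [div_eq_mul_inv, mul_comm _ (g y₀)⁻¹]
      exact hgy.const_mul _
    have h4 := (divTwoPiI.hasFDerivAt.comp y
      ((Complex.hasStrictFDerivAt_log_real h1).hasFDerivAt.comp y h3)).fderiv
    rw [show u = divTwoPiI ∘ (Complex.log ∘ fun y => g y / g y₀) from rfl, h4]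
    congr 1
    ext v
    have := hne y
    have := hne y₀
    simp
    field_simp
  have hus : ContDiffAt ℝ ∞ u y₀ := by
    refine divTwoPiI.contDiff.contDiffAt.comp y₀ ?_
    have h1 : ContDiffAt ℝ ∞ Complex.log (g y₀ / g y₀) := by
      refine (Complex.contDiffAt_log ?_).restrict_scalars ℝ
      rw [div_self (hne _)]
      exact Complex.one_mem_slitPlane
    exact h1.comp y₀ (hga.div_const _)
  have hform : formInChart (dlog f) x =ᶠ[nhds y₀]
      extDeriv fun y => ContinuousAlternatingMap.constOfIsEmpty ℝ E (Fin 0) (u y) := by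
    filter_upwards [hder, hS] with y h1 h2
    rw [formInChart_dlog hf x h2, extDeriv_constOfIsEmpty, h1]
  unfold extD
  rw [hform.extDeriv_eq]
  have h0 : ContDiffAt ℝ ∞
      (fun y => ContinuousAlternatingMap.constOfIsEmpty ℝ E (Fin 0) (u y)) y₀ :=
    (ContinuousAlternatingMap.constOfIsEmptyLIE ℝ E ℝ (Fin 0)).contDiff.contDiffAt.comp y₀ hus
  have h5 := extDeriv_extDeriv_apply h0 (by
    rw [minSmoothness_of_isRCLikeNormedField]
    exact WithTop.coe_le_coe.2 le_top)
  rw [h5]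
  rfl

end

/-! ### Unit vectors in a Hermitian line. -/

section
variable {V : Type*} [NormedAddCommGroup V] [InnerProductSpace ℂ V]

theorem eq_inner_smul_of_finrank_eq_one (h : Module.finrank ℂ V = 1) {e : V} (he : ‖e‖ = 1)
    (v : V) : v = inner ℂ e v • e := by
  have he0 : e ≠ 0 := by
    rintro rfl
    simp at he
  obtain ⟨c, rfl⟩ := (finrank_eq_one_iff_of_nonzero' e he0).1 h v
  rw [inner_smul_right, inner_self_eq_norm_sq_to_K, he]
  simp

theorem inner_self_of_norm_eq_one {e : V} (he : ‖e‖ = 1) : inner ℂ e e = 1 := by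
  rw [inner_self_eq_norm_sq_to_K, he]
  simp

theorem exists_circle_smul_of_finrank_eq_one (h : Module.finrank ℂ V = 1) {e v : V} (he : ‖e‖ = 1)
    (hv : ‖v‖ = 1) : ∃ z : Circle, v = (z : ℂ) • e := by
  have h1 := eq_inner_smul_of_finrank_eq_one h he v
  refine ⟨⟨inner ℂ e v, mem_sphere_zero_iff_norm.2 ?_⟩, h1⟩
  have h2 := congrArg norm h1
  rw [norm_smul, he, hv, mul_one] at h2
  exact h2.symm

end

/-! ### Unitary sections and their connection forms. -/

section
variable {E : Type*} [NormedAddCommGroup E] [NormedSpace ℝ E]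
  {X : Type u} [TopologicalSpace X] [ChartedSpace E X] {W : Opens X}

theorem exists_circleSmoothOn {f : X → ℂ} {O : Opens X}
    (hf : ContMDiffOn 𝓘(ℝ, E) 𝓘(ℝ, ℂ) ∞ f (O : Set X)) (h : ∀ x ∈ O, ‖f x‖ = 1) :
    ∃ g : X → Additive Circle, CircleSmoothOn E g O ∧ ∀ x ∈ O, ((g x).toMul : ℂ) = f x := by
  classical
  have key : ∀ x, ∃ g : Additive Circle, x ∈ O → (g.toMul : ℂ) = f x := fun x => by
    by_cases hx : x ∈ O
    · exact ⟨Additive.ofMul ⟨f x, mem_sphere_zero_iff_norm.2 (h x hx)⟩, fun _ => rfl⟩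
    · exact ⟨0, fun h => absurd h hx⟩
  choose g hg using key
  exact ⟨g, hf.congr fun x hx => hg x hx, hg⟩

namespace HermLineBundle

variable {L : HermLineBundle E W} {O O' : Opens X} {s t : ∀ x, L.fiber x}

theorem SmoothSection.mono (hs : L.SmoothSection O s) (h : O' ≤ O) : L.SmoothSection O' s :=
  ⟨h.trans hs.1, fun a => (hs.2 a).mono fun _ hx => ⟨h hx.1, hx.2⟩⟩

theorem SmoothSection.congr (hs : L.SmoothSection O s) (h : ∀ x ∈ O, t x = s x) :
    L.SmoothSection O t :=
  ⟨hs.1, fun a => (hs.2 a).congr fun x hx => by rw [h x hx.1]⟩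

theorem SmoothSection.smul {f : X → ℂ} (hf : ContMDiffOn 𝓘(ℝ, E) 𝓘(ℝ, ℂ) ∞ f (O : Set X))
    (hs : L.SmoothSection O s) : L.SmoothSection O fun x => f x • s x :=
  ⟨hs.1, fun a => (contMDiffOn_complex_mul (hf.mono inter_subset_left) (hs.2 a)).congr
    fun _ _ => inner_smul_right _ _ _⟩

/-- In a local unitary frame e, ⟨s, t⟩ is the product of the conjugate of ⟨e, s⟩ with ⟨e, t⟩. -/
theorem SmoothSection.inner (hs : L.SmoothSection O s) (ht : L.SmoothSection O t) :
    ContMDiffOn 𝓘(ℝ, E) 𝓘(ℝ, ℂ) ∞ (fun x => inner ℂ (s x) (t x)) (O : Set X) := by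
  refine contMDiffOn_of_locally_contMDiffOn fun x hx => ?_
  obtain ⟨a, ha⟩ := L.exists_mem_dom x (hs.1 hx)
  refine ⟨L.dom a, (L.dom a).isOpen, ha, ?_⟩
  refine (contMDiffOn_complex_mul (contMDiffOn_complex_conj (hs.2 a)) (ht.2 a)).congr ?_
  intro y hy
  have h1 := L.finrank_eq_one y (hs.1 hy.1)
  have h2 := L.norm_frame a y hy.2
  conv_lhs => rw [eq_inner_smul_of_finrank_eq_one h1 h2 (s y),
    eq_inner_smul_of_finrank_eq_one h1 h2 (t y)]
  rw [inner_smul_left, inner_smul_right, inner_self_of_norm_eq_one h2, mul_one]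

theorem smoothSection_of_local (hO : O ≤ W)
    (h : ∀ x ∈ O, ∃ O', x ∈ O' ∧ L.SmoothSection (O ⊓ O') s) : L.SmoothSection O s := by
  refine ⟨hO, fun a => contMDiffOn_of_locally_contMDiffOn fun x hx => ?_⟩
  obtain ⟨O', hx', h'⟩ := h x hx.1
  exact ⟨O', O'.isOpen, hx', (h'.2 a).mono fun y hy => ⟨⟨hy.1.1, hy.2⟩, hy.1.2⟩⟩

theorem UnitarySection.mono (hs : L.UnitarySection O s) (h : O' ≤ O) : L.UnitarySection O' s :=
  ⟨hs.1.mono h, fun x hx => hs.2 x (h hx)⟩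

theorem UnitarySection.smul {g : X → Additive Circle} (hg : CircleSmoothOn E g O)
    (hs : L.UnitarySection O s) : L.UnitarySection O fun x => ((g x).toMul : ℂ) • s x :=
  ⟨hs.1.smul hg, fun x hx => by rw [norm_smul, hs.2 x hx, Circle.norm_coe, one_mul]⟩

theorem unitarySection_frame (a : L.ι) : L.UnitarySection (L.dom a) (L.frame a) :=
  ⟨⟨L.dom_le a, fun b => (L.smooth_transition b a).mono fun _ hx => ⟨hx.2, hx.1⟩⟩,
    L.norm_frame a⟩

theorem unitarySection_bot : L.UnitarySection ⊥ s :=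
  ⟨⟨bot_le, fun _ _ hx => hx.1.elim⟩, fun _ hx => hx.elim⟩

/-- The factor is ⟨s, t⟩, of modulus 1 because both sections are unitary in a line. -/
theorem UnitarySection.exists_smul (hs : L.UnitarySection O s) (ht : L.UnitarySection O' t) :
    ∃ g : X → Additive Circle, CircleSmoothOn E g (O ⊓ O') ∧
      ∀ x ∈ O ⊓ O', t x = ((g x).toMul : ℂ) • s x := by
  have hs' := hs.mono (inf_le_left : O ⊓ O' ≤ O)
  have ht' := ht.mono (inf_le_right : O ⊓ O' ≤ O')
  have key : ∀ x ∈ O ⊓ O', t x = inner ℂ (s x) (t x) • s x := fun x hx =>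
    eq_inner_smul_of_finrank_eq_one (L.finrank_eq_one x (hs'.1.1 hx)) (hs'.2 x hx) (t x)
  obtain ⟨g, hg, hg'⟩ := exists_circleSmoothOn (hs'.1.inner ht'.1) fun x hx => by
    have h2 := congrArg norm (key x hx)
    rw [norm_smul, hs'.2 x hx, ht'.2 x hx, mul_one] at h2
    exact h2.symm
  exact ⟨g, hg, fun x hx => by rw [hg' x hx]; exact key x hx⟩

end HermLineBundle

namespace HermConnection

variable {L : HermLineBundle E W} (D : HermConnection L) {O O' : Opens X} {s t : ∀ x, L.fiber x}

/-- Locality of ∇ follows from the Leibniz rule. The indicator function f of `O` is smooth on `O`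
with zero derivative there, which is all that the rule asks for, and f t = f s holds everywhere; no
bump function is needed. -/
theorem nabla_congr (hs : L.SmoothSection O s) (h : ∀ x ∈ O, t x = s x) {x : X} (hx : x ∈ O) :
    D.nabla t x = D.nabla s x := by
  classical
  set f : X → ℂ := (O : Set X).indicator 1 with hf
  have hf1 : ∀ y ∈ O, f y = 1 := fun y hy => indicator_of_mem (show y ∈ (O : Set X) from hy) 1
  have hfs : ContMDiffOn 𝓘(ℝ, E) 𝓘(ℝ, ℂ) ∞ f (O : Set X) :=
    (contMDiffOn_const (c := (1 : ℂ))).congr hf1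
  have hd : mvfderiv 𝓘(ℝ, E) f x = 0 := by
    rw [mvfderiv_congr (g := fun _ => 1), mvfderiv_const]
    filter_upwards [O.isOpen.mem_nhds hx] with y hy using hf1 y hy
  have h1 : (fun y => f y • t y) = fun y => f y • s y := by
    funext y
    by_cases hy : y ∈ O
    · rw [h y hy]
    · have : f y = 0 := indicator_of_notMem (show y ∉ (O : Set X) from hy) 1
      rw [this, zero_smul, zero_smul]
  ext v
  have h2 := D.leibniz O f t hfs (hs.congr h) x hx v
  have h3 := D.leibniz O f s hfs hs x hx v
  rw [h1] at h2
  rw [hd, hf1 x hx] at h2 h3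
  simpa using h2.symm.trans h3

theorem form_congr (hs : L.SmoothSection O s) (h : ∀ x ∈ O, t x = s x) {x : X} (hx : x ∈ O) :
    D.form t x = D.form s x := by
  unfold form HermLineBundle.connectionForm formOfCovector
  dsimp only
  rw [D.nabla_congr hs h hx, h x hx]

/-- The gauge transformation law: ∇(g s) = dg s + g ∇s, paired with g s. -/
theorem form_smul (hs : L.UnitarySection O s) {g : X → Additive Circle}
    (hg : CircleSmoothOn E g O) (h : ∀ x ∈ O, t x = ((g x).toMul : ℂ) • s x) {x : X}
    (hx : x ∈ O) : D.form t x = D.form s x + dlog g x := by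
  rw [D.form_congr (hs.1.smul hg) h hx]
  ext v
  have h1 := D.leibniz O _ s hg hs.1 x hx (v 0)
  have h2 : inner ℂ (((g x).toMul : ℂ) • s x)
      (D.nabla (fun y => ((g y).toMul : ℂ) • s y) x (v 0)) =
      inner ℂ (s x) (D.nabla s x (v 0)) + (((g x).toMul⁻¹ : Circle) : ℂ) *
        mvfderiv 𝓘(ℝ, E) (fun y => ((g y).toMul : ℂ)) x (v 0) := by
    rw [h1, inner_add_right, inner_smul_right, inner_smul_right, inner_smul_left, inner_smul_left,
      inner_self_of_norm_eq_one (hs.2 x hx), ← Circle.coe_inv_eq_conj, Circle.coe_inv]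
    have := Circle.coe_ne_zero (g x).toMul
    field_simp
    ring
  exact (congrArg divTwoPiI h2).trans (map_add divTwoPiI _ _)

theorem smooth_form (hs : L.UnitarySection O s) : SmoothFormOn (D.form s) O := D.smooth O s hs

end HermConnection
end

/-! ### Coordinates of parallel sections in arbitrary frames. -/

section
variable {E : Type*} [NormedAddCommGroup E] [NormedSpace ℝ E]
  {X : Type u} [TopologicalSpace X] [ChartedSpace E X] {W : Opens X}

/-- The frames of `T` span its fibres, and two of them differ by a smooth `U(1)`-valued function
whose logarithmic derivative is the difference of the connection forms. -/
structure FramedLine.Lawful (T : FramedLine E X) : Prop where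
  coord : ∀ O e A, T.IsFrame O e A → ∀ x ∈ O, ∃ φ : T.fiber x →ₗ[ℂ] ℂ, φ (e x) = 1 ∧
    ∀ v, v = φ v • e x
  change : ∀ O e A O' e' A', T.IsFrame O e A → T.IsFrame O' e' A' →
    ∃ g : X → Additive Circle, CircleSmoothOn E g (O ⊓ O') ∧
      ∀ x ∈ O ⊓ O', e' x = ((g x).toMul : ℂ) • e x ∧ A' x = A x + dlog g x

theorem HermConnection.lawful_framed {L : HermLineBundle E W} (D : HermConnection L) :
    D.framed.Lawful where
  coord := by
    rintro O e A ⟨he, rfl⟩ x hx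
    refine ⟨(innerSL ℂ (e x)).toLinearMap, inner_self_of_norm_eq_one (he.2 x hx), fun v => ?_⟩
    exact eq_inner_smul_of_finrank_eq_one (L.finrank_eq_one x (he.1.1 hx)) (he.2 x hx) v
  change := by
    rintro O e A O' e' A' ⟨he, rfl⟩ ⟨he', rfl⟩
    obtain ⟨g, hg, h⟩ := he.exists_smul he'
    exact ⟨g, hg, fun x hx => ⟨h x hx, D.form_smul (he.mono inf_le_left) hg h hx⟩⟩

namespace FramedLine

variable {S T : FramedLine E X}

/-- If two frames differ by g, the dual frames differ by its inverse, and dlog changes sign with the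
connection forms. -/
theorem Lawful.dual (hT : T.Lawful) : T.dual.Lawful where
  coord := by
    rintro O φ A ⟨e, B, he, hφ, rfl⟩ x hx
    obtain ⟨c, hc, hc'⟩ := hT.coord O e B he x hx
    refine ⟨Module.Dual.eval ℂ (T.fiber x) (e x), hφ x hx, fun v => LinearMap.ext fun w => ?_⟩
    have h := hφ x hx
    conv_lhs => rw [hc' w]
    conv_rhs => rw [hc' w]
    simp [h, mul_comm]
  change := by
    rintro O φ A O' φ' A' ⟨e, B, he, hφ, rfl⟩ ⟨e', B', he', hφ', rfl⟩
    obtain ⟨g, hg, h⟩ := hT.change O e B O' e' B' he he'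
    refine ⟨-g, hg.neg, fun x hx => ⟨LinearMap.ext fun w => ?_, ?_⟩⟩
    · obtain ⟨c, hc, hc'⟩ := hT.coord O e B he x hx.1
      have h1 := hφ x hx.1
      have h2 := hφ' x hx.2
      rw [(h x hx).1, map_smul, smul_eq_mul] at h2
      conv_lhs => rw [hc' w]
      conv_rhs => rw [hc' w]
      have h0 := Circle.coe_ne_zero (g x).toMul
      simp only [map_smul, smul_eq_mul, LinearMap.smul_apply, h1, Pi.neg_apply, toMul_neg,
        Circle.coe_inv, eq_inv_of_mul_eq_one_right h2]
      ring
    · rw [Pi.neg_apply, Pi.neg_apply, (h x hx).2, dlog_neg hg hx, neg_add]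

theorem Lawful.tensor (hS : S.Lawful) (hT : T.Lawful) : (S.tensor T).Lawful where
  coord := by
    rintro O g C ⟨e, A, f, B, he, hf, hg, rfl⟩ x hx
    obtain ⟨c, hc, hc'⟩ := hS.coord O e A he x hx
    obtain ⟨d, hd, hd'⟩ := hT.coord O f B hf x hx
    refine ⟨LinearMap.mul' ℂ ℂ ∘ₗ TensorProduct.map c d, ?_, fun v => ?_⟩
    · rw [hg x]; simp [hc, hd]
    · induction v using TensorProduct.induction_on with
      | zero => simp
      | add v w hv hw => rw [map_add, add_smul, ← hv, ← hw]
      | tmul v w =>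
        conv_lhs => rw [hc' v, hd' w]
        rw [hg x, TensorProduct.smul_tmul_smul]
        simp
  change := by
    rintro O g C O' g' C' ⟨e, A, f, B, he, hf, hg, rfl⟩ ⟨e', A', f', B', he', hf', hg', rfl⟩
    obtain ⟨a, ha, h⟩ := hS.change O e A O' e' A' he he'
    obtain ⟨b, hb, h'⟩ := hT.change O f B O' f' B' hf hf'
    refine ⟨a + b, ha.add hb, fun x hx => ⟨?_, ?_⟩⟩
    · rw [hg x, hg' x, (h x hx).1, (h' x hx).1, TensorProduct.smul_tmul_smul]
      simp
    · rw [Pi.add_apply, Pi.add_apply, (h x hx).2, (h' x hx).2, dlog_add ha hb hx]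
      abel

/-- The change of frame is pulled back along Φ; its logarithmic derivative is the pulled back one by
`dlog_comp`. -/
theorem Lawful.pullback {E' : Type*} [NormedAddCommGroup E'] [NormedSpace ℝ E']
    {Y : Type u} [TopologicalSpace Y] [ChartedSpace E' Y] {Φ : X → Y}
    (hΦ : ContMDiff 𝓘(ℝ, E) 𝓘(ℝ, E') ∞ Φ) {T : FramedLine E' Y} (hT : T.Lawful) :
    (T.pullback Φ : FramedLine E X).Lawful where
  coord := by
    rintro O e A ⟨P, f, B, hf, hO, he, rfl⟩ x hx
    rw [he x]
    exact hT.coord P f B hf (Φ x) (hO x hx)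
  change := by
    rintro O e A O' e' A' ⟨P, f, B, hf, hO, he, rfl⟩ ⟨P', f', B', hf', hO', he', rfl⟩
    obtain ⟨a, ha, h⟩ := hT.change P f B P' f' B' hf hf'
    have hm : ∀ x ∈ O ⊓ O', Φ x ∈ P ⊓ P' := fun x hx => ⟨hO x hx.1, hO' x hx.2⟩
    refine ⟨fun x => a (Φ x), ha.comp hΦ hm, fun x hx => ⟨?_, ?_⟩⟩
    · rw [he x, he' x]
      exact (h (Φ x) (hm x hx)).1
    · rw [dlog_comp (E := E) ha (hΦ.mdifferentiableAt (by simp)) (hm x hx)]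
      exact formPullback_congr (E := E) (β := B + dlog a) (h (Φ x) (hm x hx)).2

/-- Parallelism is only stated locally, in frames that vary with the point. Lawfulness converts
these into the prescribed frame, where the coordinate is unique, so that the local coordinates glue
to one function on all of `O`. -/
theorem IsParallelUnitary.exists_coord (hT : T.Lawful) {O : Opens X} {s : ∀ x, T.fiber x}
    (hs : T.IsParallelUnitary O s) {e : ∀ x, T.fiber x} {A : FormField E X 1}
    (he : T.IsFrame O e A) :
    ∃ f : X → Additive Circle, CircleSmoothOn E f O ∧
      ∀ x ∈ O, s x = ((f x).toMul : ℂ) • e x ∧ dlog f x + A x = 0 := by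
  have key : ∀ x ∈ O, ∃ (O' : Opens X) (f : X → Additive Circle), x ∈ O' ∧
      CircleSmoothOn E f (O ⊓ O') ∧
      ∀ y ∈ O ⊓ O', s y = ((f y).toMul : ℂ) • e y ∧ dlog f y + A y = 0 := by
    intro x hx
    obtain ⟨O', e', A', f, hx', he', hf, h⟩ := hs x hx
    obtain ⟨g, hg, h'⟩ := hT.change O e A O' e' A' he he'
    -- With e' = g e and A' = A + dlog g, the coordinate in e is the product f g, and dlog (f g) + A
    -- = dlog f + A' = 0.
    refine ⟨O', f + g, hx', (hf.mono inf_le_right).add hg, fun y hy => ⟨?_, ?_⟩⟩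
    · rw [(h y hy.2).1, (h' y hy).1, smul_smul]
      simp
    · rw [dlog_add (hf.mono inf_le_right) hg hy, ← (h y hy.2).2, (h' y hy).2]
      abel
  have key2 : ∀ x, ∃ z : Additive Circle, x ∈ O → s x = (z.toMul : ℂ) • e x := by
    intro x
    by_cases hx : x ∈ O
    · obtain ⟨O', f, hx', hf, h⟩ := key x hx
      exact ⟨f x, fun _ => (h x ⟨hx, hx'⟩).1⟩
    · exact ⟨0, fun h => absurd h hx⟩
  choose f hf using key2
  have huniq : ∀ (O' : Opens X) (f' : X → Additive Circle),
      (∀ y ∈ O ⊓ O', s y = ((f' y).toMul : ℂ) • e y ∧ dlog f' y + A y = 0) →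
      ∀ y ∈ O ⊓ O', f y = f' y := by
    intro O' f' h' y hy
    obtain ⟨φ, hφ, -⟩ := hT.coord O e A he y hy.1
    have h1 := congrArg φ ((hf y hy.1).symm.trans (h' y hy).1)
    rw [map_smul, map_smul, hφ, smul_eq_mul, smul_eq_mul, mul_one, mul_one] at h1
    exact Additive.toMul.injective (Circle.coe_injective h1)
  refine ⟨f, circleSmoothOn_of_local fun x hx => ?_, fun x hx => ⟨hf x hx, ?_⟩⟩
  · obtain ⟨O', f', hx', hf', h'⟩ := key x hx
    exact ⟨O', hx', hf'.congr (huniq O' f' h')⟩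
  · obtain ⟨O', f', hx', hf', h'⟩ := key x hx
    rw [← (h' x ⟨hx, hx'⟩).2, dlog_congr (g := f')]
    filter_upwards [(O ⊓ O').isOpen.mem_nhds ⟨hx, hx'⟩] with y hy using huniq O' f' h' y hy

end FramedLine
end

/-! ### Behaviour of coordinates under a change of unit vectors. -/

section
variable {A B C D : Type*} [NormedAddCommGroup A] [InnerProductSpace ℂ A]
  [NormedAddCommGroup B] [InnerProductSpace ℂ B] [NormedAddCommGroup C] [InnerProductSpace ℂ C]
  [NormedAddCommGroup D] [InnerProductSpace ℂ D]

theorem norm_circle_smul (α : Circle) {a : A} (h : ‖a‖ = 1) : ‖(α : ℂ) • a‖ = 1 := by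
  rw [norm_smul, h, Circle.norm_coe, one_mul]

theorem dualVec_apply (a b : A) : dualVec a b = inner ℂ a b := rfl

theorem dualVec_circle_smul (α : Circle) (a : A) :
    dualVec ((α : ℂ) • a) = ((α⁻¹ : Circle) : ℂ) • dualVec a := by
  ext v
  rw [dualVec_apply, inner_smul_left, LinearMap.smul_apply, dualVec_apply, Circle.coe_inv_eq_conj,
    smul_eq_mul]

section
variable {t : A ⊗[ℂ] (Module.Dual ℂ B ⊗[ℂ] C)} {a : A} {b : B} {c : C} {z z' : ℂ}

/-- A dual vector is conjugate linear in its vector, hence β enters with the exponent opposite to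
that of α and γ. -/
theorem HasCoord.smul (h : HasCoord t a b c z) (α β γ : Circle) :
    HasCoord t ((α : ℂ) • a) ((β : ℂ) • b) ((γ : ℂ) • c) (z * (α⁻¹ * β * γ⁻¹ : Circle)) := by
  obtain ⟨ha, hb, hc, rfl⟩ := h
  refine ⟨norm_circle_smul _ ha, norm_circle_smul _ hb, norm_circle_smul _ hc, ?_⟩
  rw [dualVec_circle_smul, TensorProduct.smul_tmul_smul, TensorProduct.smul_tmul_smul, smul_smul]
  congr 1
  have := Circle.coe_ne_zero α
  have := Circle.coe_ne_zero β
  have := Circle.coe_ne_zero γ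
  simp only [Circle.coe_mul, Circle.coe_inv]
  field_simp

/-- The functional ⟨a, ·⟩ ⊗ ev_b ⊗ ⟨c, ·⟩ takes the value 1 on the basis vector and reads off the
coordinate. -/
theorem HasCoord.unique (h : HasCoord t a b c z) (h' : HasCoord t a b c z') : z = z' := by
  obtain ⟨ha, hb, hc, rfl⟩ := h
  have h1 := congrArg (LinearMap.mul' ℂ ℂ ∘ₗ TensorProduct.map (dualVec a)
    (LinearMap.mul' ℂ ℂ ∘ₗ TensorProduct.map (Module.Dual.eval ℂ B b) (dualVec c))) h'.2.2.2
  simpa [dualVec_apply, inner_self_of_norm_eq_one, ha, hb, hc] using h1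

end

section
variable {t : A ⊗[ℂ] (Module.Dual ℂ B ⊗[ℂ] Module.Dual ℂ C)} {a : A} {b : B} {c : C} {z z' : ℂ}

theorem HasCoord'.smul (h : HasCoord' t a b c z) (α β γ : Circle) :
    HasCoord' t ((α : ℂ) • a) ((β : ℂ) • b) ((γ : ℂ) • c) (z * (α⁻¹ * β * γ : Circle)) := by
  obtain ⟨ha, hb, hc, rfl⟩ := h
  refine ⟨norm_circle_smul _ ha, norm_circle_smul _ hb, norm_circle_smul _ hc, ?_⟩
  rw [dualVec_circle_smul, dualVec_circle_smul, TensorProduct.smul_tmul_smul,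
    TensorProduct.smul_tmul_smul, smul_smul]
  congr 1
  have := Circle.coe_ne_zero α
  have := Circle.coe_ne_zero β
  have := Circle.coe_ne_zero γ
  simp only [Circle.coe_mul, Circle.coe_inv]
  field_simp

theorem HasCoord'.unique (h : HasCoord' t a b c z) (h' : HasCoord' t a b c z') : z = z' := by
  obtain ⟨ha, hb, hc, rfl⟩ := h
  have h1 := congrArg (LinearMap.mul' ℂ ℂ ∘ₗ TensorProduct.map (dualVec a)
    (LinearMap.mul' ℂ ℂ ∘ₗ TensorProduct.map (Module.Dual.eval ℂ B b)
      (Module.Dual.eval ℂ C c))) h'.2.2.2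
  simpa [dualVec_apply, inner_self_of_norm_eq_one, ha, hb, hc] using h1

end

section
variable {t : A ⊗[ℂ] (Module.Dual ℂ B ⊗[ℂ] (C ⊗[ℂ] Module.Dual ℂ D))}
  {a : A} {b : B} {c : C} {d : D} {z z' : ℂ}

theorem HasCoord₄.smul (h : HasCoord₄ t a b c d z) (α β γ δ : Circle) :
    HasCoord₄ t ((α : ℂ) • a) ((β : ℂ) • b) ((γ : ℂ) • c) ((δ : ℂ) • d)
      (z * (α⁻¹ * β * γ⁻¹ * δ : Circle)) := by
  obtain ⟨ha, hb, hc, hd, rfl⟩ := h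
  refine ⟨norm_circle_smul _ ha, norm_circle_smul _ hb, norm_circle_smul _ hc,
    norm_circle_smul _ hd, ?_⟩
  rw [dualVec_circle_smul, dualVec_circle_smul, TensorProduct.smul_tmul_smul,
    TensorProduct.smul_tmul_smul, TensorProduct.smul_tmul_smul, smul_smul]
  congr 1
  have := Circle.coe_ne_zero α
  have := Circle.coe_ne_zero β
  have := Circle.coe_ne_zero γ
  have := Circle.coe_ne_zero δ
  simp only [Circle.coe_mul, Circle.coe_inv]
  field_simp

theorem HasCoord₄.unique (h : HasCoord₄ t a b c d z) (h' : HasCoord₄ t a b c d z') : z = z' := by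
  obtain ⟨ha, hb, hc, hd, rfl⟩ := h
  have h1 := congrArg (LinearMap.mul' ℂ ℂ ∘ₗ TensorProduct.map (dualVec a)
    (LinearMap.mul' ℂ ℂ ∘ₗ TensorProduct.map (Module.Dual.eval ℂ B b)
      (LinearMap.mul' ℂ ℂ ∘ₗ TensorProduct.map (dualVec c) (Module.Dual.eval ℂ D d)))) h'.2.2.2.2
  simpa [dualVec_apply, inner_self_of_norm_eq_one, ha, hb, hc, hd] using h1

end
end

/-! ### Coordinates of parallel sections of the tensor products occurring in gerbes. -/

section
variable {E : Type*} [NormedAddCommGroup E] [NormedSpace ℝ E]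
  {X : Type u} [TopologicalSpace X] [ChartedSpace E X] {W₁ W₂ W₃ W₄ : Opens X}

theorem FramedLine.IsParallelUnitary.mono {T : FramedLine E X} {O O' : Opens X}
    {s : ∀ x, T.fiber x} (h : T.IsParallelUnitary O s) (hO : O' ≤ O) : T.IsParallelUnitary O' s :=
  fun x hx => h x (hO hx)

theorem FramedLine.isParallelUnitary_of_frame {T : FramedLine E X} {O : Opens X}
    {s e : ∀ x, T.fiber x} {A : FormField E X 1} (he : T.IsFrame O e A)
    {f : X → Additive Circle} (hf : CircleSmoothOn E f O)
    (h : ∀ x ∈ O, s x = ((f x).toMul : ℂ) • e x ∧ dlog f x + A x = 0) :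
    T.IsParallelUnitary O s := fun _ hx => ⟨O, e, A, f, hx, he, hf, h⟩

variable {L₁ : HermLineBundle E W₁} {L₂ : HermLineBundle E W₂} {L₃ : HermLineBundle E W₃}
  {L₄ : HermLineBundle E W₄} {D₁ : HermConnection L₁} {D₂ : HermConnection L₂}
  {D₃ : HermConnection L₃} {D₄ : HermConnection L₄} {O : Opens X}
  {s₁ : ∀ x, L₁.fiber x} {s₂ : ∀ x, L₂.fiber x} {s₃ : ∀ x, L₃.fiber x} {s₄ : ∀ x, L₄.fiber x}

theorem HermConnection.isFrame_dual (D₁ : HermConnection L₁) (h₁ : L₁.UnitarySection O s₁) :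
    D₁.framed.dual.IsFrame O (fun x => dualVec (s₁ x)) (-D₁.form s₁) :=
  ⟨s₁, _, ⟨h₁, rfl⟩, fun x hx => inner_self_of_norm_eq_one (h₁.2 x hx), rfl⟩

section
variable {θ : ∀ x, L₁.fiber x ⊗[ℂ] (Module.Dual ℂ (L₂.fiber x) ⊗[ℂ] L₃.fiber x)}

theorem isFrame_tensor₃ (D₁ : HermConnection L₁) (D₂ : HermConnection L₂) (D₃ : HermConnection L₃)
    (h₁ : L₁.UnitarySection O s₁) (h₂ : L₂.UnitarySection O s₂) (h₃ : L₃.UnitarySection O s₃) :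
    (D₁.framed.tensor (D₂.framed.dual.tensor D₃.framed)).IsFrame O
      (fun x => s₁ x ⊗ₜ[ℂ] (dualVec (s₂ x) ⊗ₜ[ℂ] s₃ x))
      (D₁.form s₁ + (-D₂.form s₂ + D₃.form s₃)) :=
  ⟨_, _, _, _, ⟨h₁, rfl⟩, ⟨_, _, _, _, D₂.isFrame_dual h₂, ⟨h₃, rfl⟩, fun _ => rfl, rfl⟩,
    fun _ => rfl, rfl⟩

/-- Here parallelism becomes an equation between 1-forms; applied to θ it is the equation δA + dlog
t = 0. The variants below serve χ, ψ and η in the same way. -/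
theorem exists_hasCoord
    (hθ : (D₁.framed.tensor (D₂.framed.dual.tensor D₃.framed)).IsParallelUnitary O θ)
    (h₁ : L₁.UnitarySection O s₁) (h₂ : L₂.UnitarySection O s₂) (h₃ : L₃.UnitarySection O s₃) :
    ∃ f : X → Additive Circle, CircleSmoothOn E f O ∧ ∀ x ∈ O,
      HasCoord (θ x) (s₁ x) (s₂ x) (s₃ x) (f x).toMul ∧
      dlog f x + (D₁.form s₁ x + (-D₂.form s₂ x + D₃.form s₃ x)) = 0 := by
  obtain ⟨f, hf, h⟩ := hθ.exists_coord
    (D₁.lawful_framed.tensor (D₂.lawful_framed.dual.tensor D₃.lawful_framed))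
    (isFrame_tensor₃ D₁ D₂ D₃ h₁ h₂ h₃)
  exact ⟨f, hf, fun x hx => ⟨⟨h₁.2 x hx, h₂.2 x hx, h₃.2 x hx, (h x hx).1⟩, (h x hx).2⟩⟩

/-- A section θ of the triple product trivialises it, so sections of two of the factors determine
one of the third by the normalisation that θ has coordinate 1. It exists locally and is unique,
hence it glues. -/
theorem exists_unitarySection_of_hasCoord_mid
    (hθ : (D₁.framed.tensor (D₂.framed.dual.tensor D₃.framed)).IsParallelUnitary O θ)
    (hO : O ≤ W₂) (h₁ : L₁.UnitarySection O s₁) (h₃ : L₃.UnitarySection O s₃) :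
    ∃ s₂ : ∀ x, L₂.fiber x, L₂.UnitarySection O s₂ := by
  have key : ∀ x ∈ O, ∃ (O' : Opens X) (v : ∀ x, L₂.fiber x), x ∈ O' ∧
      L₂.UnitarySection (O ⊓ O') v ∧
      ∀ y ∈ O ⊓ O', HasCoord (θ y) (s₁ y) (v y) (s₃ y) 1 := by
    intro x hx
    obtain ⟨a, ha⟩ := L₂.exists_mem_dom x (hO hx)
    have hle : O ⊓ L₂.dom a ≤ O := inf_le_left
    have h₂ := (L₂.unitarySection_frame a).mono (inf_le_right : O ⊓ L₂.dom a ≤ _)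
    obtain ⟨f, hf, h⟩ := exists_hasCoord (hθ.mono hle) (h₁.mono hle) h₂ (h₃.mono hle)
    refine ⟨L₂.dom a, _, ha, h₂.smul hf.neg, fun y hy => ?_⟩
    -- The middle factor is dual, so scaling it by the inverse of f multiplies the coordinate f by
    -- that inverse.
    have := (h y hy).1.smul 1 (-f y).toMul 1
    simpa using this
  have huniq : ∀ x ∈ O, ∀ v w : L₂.fiber x, HasCoord (θ x) (s₁ x) v (s₃ x) 1 →
      HasCoord (θ x) (s₁ x) w (s₃ x) 1 → v = w := by
    intro x hx v w hv hw
    obtain ⟨z, rfl⟩ := exists_circle_smul_of_finrank_eq_one (L₂.finrank_eq_one x (hO hx))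
      hv.2.1 hw.2.1
    have h := hv.smul 1 z 1
    simp only [Circle.coe_one, one_smul, inv_one, one_mul, mul_one] at h
    rw [h.unique hw, one_smul]
  have key2 : ∀ x, ∃ v : L₂.fiber x, x ∈ O → HasCoord (θ x) (s₁ x) v (s₃ x) 1 := by
    intro x
    by_cases hx : x ∈ O
    · obtain ⟨O', v, hx', -, h⟩ := key x hx
      exact ⟨v x, fun _ => h x ⟨hx, hx'⟩⟩
    · exact ⟨0, fun h => absurd h hx⟩
  choose s hs using key2
  refine ⟨s, L₂.smoothSection_of_local hO fun x hx => ?_, fun x hx => (hs x hx).2.1⟩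
  obtain ⟨O', v, hx', hv, h⟩ := key x hx
  exact ⟨O', hx', hv.1.congr fun y hy => huniq y hy.1 _ _ (hs y hy.1) (h y hy)⟩

theorem exists_unitarySection_of_hasCoord_left
    (hθ : (D₁.framed.tensor (D₂.framed.dual.tensor D₃.framed)).IsParallelUnitary O θ)
    (hO : O ≤ W₁) (h₂ : L₂.UnitarySection O s₂) (h₃ : L₃.UnitarySection O s₃) :
    ∃ s₁ : ∀ x, L₁.fiber x, L₁.UnitarySection O s₁ := by
  have key : ∀ x ∈ O, ∃ (O' : Opens X) (v : ∀ x, L₁.fiber x), x ∈ O' ∧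
      L₁.UnitarySection (O ⊓ O') v ∧
      ∀ y ∈ O ⊓ O', HasCoord (θ y) (v y) (s₂ y) (s₃ y) 1 := by
    intro x hx
    obtain ⟨a, ha⟩ := L₁.exists_mem_dom x (hO hx)
    have hle : O ⊓ L₁.dom a ≤ O := inf_le_left
    have h₁ := (L₁.unitarySection_frame a).mono (inf_le_right : O ⊓ L₁.dom a ≤ _)
    obtain ⟨f, hf, h⟩ := exists_hasCoord (hθ.mono hle) h₁ (h₂.mono hle) (h₃.mono hle)
    refine ⟨L₁.dom a, _, ha, h₁.smul hf, fun y hy => ?_⟩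
    have := (h y hy).1.smul (f y).toMul 1 1
    simpa using this
  have huniq : ∀ x ∈ O, ∀ v w : L₁.fiber x, HasCoord (θ x) v (s₂ x) (s₃ x) 1 →
      HasCoord (θ x) w (s₂ x) (s₃ x) 1 → v = w := by
    intro x hx v w hv hw
    obtain ⟨z, rfl⟩ := exists_circle_smul_of_finrank_eq_one (L₁.finrank_eq_one x (hO hx))
      hv.1 hw.1
    have h := hv.smul z 1 1
    simp only [Circle.coe_one, one_smul, inv_one, one_mul, mul_one] at h
    have h1 := h.unique hw
    rw [Circle.coe_eq_one, inv_eq_one] at h1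
    rw [h1, Circle.coe_one, one_smul]
  have key2 : ∀ x, ∃ v : L₁.fiber x, x ∈ O → HasCoord (θ x) v (s₂ x) (s₃ x) 1 := by
    intro x
    by_cases hx : x ∈ O
    · obtain ⟨O', v, hx', -, h⟩ := key x hx
      exact ⟨v x, fun _ => h x ⟨hx, hx'⟩⟩
    · exact ⟨0, fun h => absurd h hx⟩
  choose s hs using key2
  refine ⟨s, L₁.smoothSection_of_local hO fun x hx => ?_, fun x hx => (hs x hx).1⟩
  obtain ⟨O', v, hx', hv, h⟩ := key x hx
  exact ⟨O', hx', hv.1.congr fun y hy => huniq y hy.1 _ _ (hs y hy.1) (h y hy)⟩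

end

section
variable {χ : ∀ x, L₁.fiber x ⊗[ℂ] (Module.Dual ℂ (L₂.fiber x) ⊗[ℂ]
  (L₃.fiber x ⊗[ℂ] Module.Dual ℂ (L₄.fiber x)))}

theorem isFrame_tensor₄ (D₁ : HermConnection L₁) (D₂ : HermConnection L₂) (D₃ : HermConnection L₃)
    (D₄ : HermConnection L₄) (h₁ : L₁.UnitarySection O s₁) (h₂ : L₂.UnitarySection O s₂)
    (h₃ : L₃.UnitarySection O s₃) (h₄ : L₄.UnitarySection O s₄) :
    (D₁.framed.tensor (D₂.framed.dual.tensor (D₃.framed.tensor D₄.framed.dual))).IsFrame O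
      (fun x => s₁ x ⊗ₜ[ℂ] (dualVec (s₂ x) ⊗ₜ[ℂ] (s₃ x ⊗ₜ[ℂ] dualVec (s₄ x))))
      (D₁.form s₁ + (-D₂.form s₂ + (D₃.form s₃ + -D₄.form s₄))) :=
  ⟨_, _, _, _, ⟨h₁, rfl⟩, ⟨_, _, _, _, D₂.isFrame_dual h₂,
    ⟨_, _, _, _, ⟨h₃, rfl⟩, D₄.isFrame_dual h₄, fun _ => rfl, rfl⟩, fun _ => rfl, rfl⟩,
    fun _ => rfl, rfl⟩

theorem exists_hasCoord₄
    (hχ : (D₁.framed.tensor (D₂.framed.dual.tensor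
      (D₃.framed.tensor D₄.framed.dual))).IsParallelUnitary O χ)
    (h₁ : L₁.UnitarySection O s₁) (h₂ : L₂.UnitarySection O s₂)
    (h₃ : L₃.UnitarySection O s₃) (h₄ : L₄.UnitarySection O s₄) :
    ∃ f : X → Additive Circle, CircleSmoothOn E f O ∧ ∀ x ∈ O,
      HasCoord₄ (χ x) (s₁ x) (s₂ x) (s₃ x) (s₄ x) (f x).toMul ∧
      dlog f x + (D₁.form s₁ x + (-D₂.form s₂ x + (D₃.form s₃ x + -D₄.form s₄ x))) = 0 := by
  obtain ⟨f, hf, h⟩ := hχ.exists_coord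
    (D₁.lawful_framed.tensor (D₂.lawful_framed.dual.tensor
      (D₃.lawful_framed.tensor D₄.lawful_framed.dual)))
    (isFrame_tensor₄ D₁ D₂ D₃ D₄ h₁ h₂ h₃ h₄)
  exact ⟨f, hf, fun x hx =>
    ⟨⟨h₁.2 x hx, h₂.2 x hx, h₃.2 x hx, h₄.2 x hx, (h x hx).1⟩, (h x hx).2⟩⟩

end

section
variable {E' : Type*} [NormedAddCommGroup E'] [NormedSpace ℝ E']
    {Y : Type u} [TopologicalSpace Y] [ChartedSpace E' Y] {Φ : X → Y}
    {W₅ O' : Opens Y} {L₅ : HermLineBundle E' W₅} {D₅ : HermConnection L₅}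
    {s₅ : ∀ y, L₅.fiber y}

theorem isFrame_pullback (D₅ : HermConnection L₅) (h₅ : L₅.UnitarySection O' s₅)
    (hO : ∀ x ∈ O, Φ x ∈ O') : (D₅.framed.pullback Φ : FramedLine E X).IsFrame O
      (fun x => s₅ (Φ x)) (formPullback Φ (D₅.form s₅)) :=
  ⟨O', s₅, _, ⟨h₅, rfl⟩, hO, fun _ => rfl, rfl⟩

theorem isFrame_tensor_pullback (D₁ : HermConnection L₁) (D₂ : HermConnection L₂)
    (D₅ : HermConnection L₅)
    (h₁ : L₁.UnitarySection O s₁) (h₂ : L₂.UnitarySection O s₂) (h₅ : L₅.UnitarySection O' s₅)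
    (hO : ∀ x ∈ O, Φ x ∈ O') :
    (D₁.framed.tensor (D₂.framed.dual.tensor (D₅.framed.pullback Φ))).IsFrame O
      (fun x => s₁ x ⊗ₜ[ℂ] (dualVec (s₂ x) ⊗ₜ[ℂ] s₅ (Φ x)))
      (D₁.form s₁ + (-D₂.form s₂ + formPullback Φ (D₅.form s₅))) :=
  ⟨_, _, _, _, ⟨h₁, rfl⟩, ⟨_, _, _, _, D₂.isFrame_dual h₂, isFrame_pullback D₅ h₅ hO,
    fun _ => rfl, rfl⟩, fun _ => rfl, rfl⟩

theorem exists_hasCoord_pullback (hΦ : ContMDiff 𝓘(ℝ, E) 𝓘(ℝ, E') ∞ Φ)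
    {ψ : ∀ x, L₁.fiber x ⊗[ℂ] (Module.Dual ℂ (L₂.fiber x) ⊗[ℂ] L₅.fiber (Φ x))}
    (hψ : (D₁.framed.tensor (D₂.framed.dual.tensor (D₅.framed.pullback Φ))).IsParallelUnitary O ψ)
    (h₁ : L₁.UnitarySection O s₁) (h₂ : L₂.UnitarySection O s₂) (h₅ : L₅.UnitarySection O' s₅)
    (hO : ∀ x ∈ O, Φ x ∈ O') :
    ∃ f : X → Additive Circle, CircleSmoothOn E f O ∧ ∀ x ∈ O,
      HasCoord (ψ x) (s₁ x) (s₂ x) (s₅ (Φ x)) (f x).toMul ∧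
      dlog f x + (D₁.form s₁ x + (-D₂.form s₂ x + formPullback Φ (D₅.form s₅) x)) = 0 := by
  obtain ⟨f, hf, h⟩ := hψ.exists_coord
    (D₁.lawful_framed.tensor (D₂.lawful_framed.dual.tensor (D₅.lawful_framed.pullback hΦ)))
    (isFrame_tensor_pullback D₁ D₂ D₅ h₁ h₂ h₅ hO)
  exact ⟨f, hf, fun x hx =>
    ⟨⟨h₁.2 x hx, h₂.2 x hx, h₅.2 _ (hO x hx), (h x hx).1⟩, (h x hx).2⟩⟩

theorem isFrame_tensor_dual_pullback (D₁ : HermConnection L₁) (D₂ : HermConnection L₂)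
    (D₅ : HermConnection L₅)
    (h₁ : L₁.UnitarySection O s₁) (h₂ : L₂.UnitarySection O s₂) (h₅ : L₅.UnitarySection O' s₅)
    (hO : ∀ x ∈ O, Φ x ∈ O') :
    (D₁.framed.tensor (D₂.framed.dual.tensor (D₅.framed.pullback Φ).dual)).IsFrame O
      (fun x => s₁ x ⊗ₜ[ℂ] (dualVec (s₂ x) ⊗ₜ[ℂ] dualVec (s₅ (Φ x))))
      (D₁.form s₁ + (-D₂.form s₂ + -formPullback Φ (D₅.form s₅))) :=
  ⟨_, _, _, _, ⟨h₁, rfl⟩, ⟨_, _, _, _, D₂.isFrame_dual h₂,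
    ⟨_, _, isFrame_pullback D₅ h₅ hO, fun x hx => inner_self_of_norm_eq_one (h₅.2 _ (hO x hx)),
      rfl⟩, fun _ => rfl, rfl⟩, fun _ => rfl, rfl⟩

theorem exists_hasCoord'_pullback (hΦ : ContMDiff 𝓘(ℝ, E) 𝓘(ℝ, E') ∞ Φ)
    {η : ∀ x, L₁.fiber x ⊗[ℂ] (Module.Dual ℂ (L₂.fiber x) ⊗[ℂ] Module.Dual ℂ (L₅.fiber (Φ x)))}
    (hη : (D₁.framed.tensor (D₂.framed.dual.tensor
      (D₅.framed.pullback Φ).dual)).IsParallelUnitary O η)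
    (h₁ : L₁.UnitarySection O s₁) (h₂ : L₂.UnitarySection O s₂) (h₅ : L₅.UnitarySection O' s₅)
    (hO : ∀ x ∈ O, Φ x ∈ O') :
    ∃ f : X → Additive Circle, CircleSmoothOn E f O ∧ ∀ x ∈ O,
      HasCoord' (η x) (s₁ x) (s₂ x) (s₅ (Φ x)) (f x).toMul ∧
      dlog f x + (D₁.form s₁ x + (-D₂.form s₂ x + -formPullback Φ (D₅.form s₅) x)) = 0 := by
  obtain ⟨f, hf, h⟩ := hη.exists_coord
    (D₁.lawful_framed.tensor (D₂.lawful_framed.dual.tensor (D₅.lawful_framed.pullback hΦ).dual))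
    (isFrame_tensor_dual_pullback D₁ D₂ D₅ h₁ h₂ h₅ hO)
  exact ⟨f, hf, fun x hx =>
    ⟨⟨h₁.2 x hx, h₂.2 x hx, h₅.2 _ (hO x hx), (h x hx).1⟩, (h x hx).2⟩⟩

end
end

/-! ### The trivial line bundle with connection d + 2πiA. -/

section
variable {E : Type*} [NormedAddCommGroup E] [NormedSpace ℝ E]
  {X : Type u} [TopologicalSpace X] [ChartedSpace E X]

/-- The unit vector of the standard complex line. -/
noncomputable def lineUnit : EuclideanSpace ℂ PUnit.{u + 1} := EuclideanSpace.single PUnit.unit 1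

theorem norm_lineUnit : ‖lineUnit.{u}‖ = 1 := by simp [lineUnit]

variable (E) in
/-- The trivial Hermitian line bundle on `W`. -/
noncomputable def trivialLine (W : Opens X) : HermLineBundle E W where
  fiber _ := EuclideanSpace ℂ PUnit.{u + 1}
  finrank_eq_one _ _ := by simp
  ι := PUnit
  dom _ := W
  frame _ _ := lineUnit
  dom_le _ := le_rfl
  exists_mem_dom _ hx := ⟨PUnit.unit, hx⟩
  norm_frame _ _ _ := norm_lineUnit
  smooth_transition _ _ := contMDiffOn_const

namespace trivialLine

variable {W : Opens X}

variable (E) in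
/-- The standard unitary section of the trivial line bundle. -/
noncomputable def unit (W : Opens X) : ∀ x, (trivialLine E W).fiber x := fun _ => lineUnit

theorem unitarySection_unit : (trivialLine E W).UnitarySection W (unit E W) :=
  (trivialLine E W).unitarySection_frame PUnit.unit

theorem norm_unit (x : X) : ‖unit E W x‖ = 1 := norm_lineUnit

/-- The coordinate of a section of the trivial line bundle. -/
noncomputable def coord (s : ∀ x, (trivialLine E W).fiber x) (x : X) : ℂ :=
  inner ℂ (unit E W x) (s x)

theorem eq_coord_smul (s : ∀ x, (trivialLine E W).fiber x) (x : X) :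
    s x = coord s x • unit E W x :=
  eq_inner_smul_of_finrank_eq_one (V := EuclideanSpace ℂ PUnit.{u + 1}) (by simp) norm_lineUnit _

theorem contMDiffOn_coord {O : Opens X} {s : ∀ x, (trivialLine E W).fiber x}
    (hs : (trivialLine E W).SmoothSection O s) :
    ContMDiffOn 𝓘(ℝ, E) 𝓘(ℝ, ℂ) ∞ (coord s) (O : Set X) :=
  (hs.2 PUnit.unit).mono fun _ hx => ⟨hx, hs.1 hx⟩

theorem mdifferentiableAt_coord {O : Opens X} {s : ∀ x, (trivialLine E W).fiber x}
    (hs : (trivialLine E W).SmoothSection O s) {x : X} (hx : x ∈ O) :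
    MDifferentiableAt 𝓘(ℝ, E) 𝓘(ℝ, ℂ) (coord s) x :=
  ((contMDiffOn_coord hs).contMDiffAt (O.isOpen.mem_nhds hx)).mdifferentiableAt (by simp)

variable (W) in
/-- The covariant derivative `d + 2πi A` of the trivial line bundle. -/
noncomputable def nabla (A : FormField E X 1) (s : ∀ x, (trivialLine E W).fiber x) (x : X) :
    TangentSpace 𝓘(ℝ, E) x →L[ℝ] (trivialLine E W).fiber x :=
  (mvfderiv 𝓘(ℝ, E) (coord s) x + (2 * Real.pi * Complex.I * coord s x) •
    Complex.ofRealCLM.comp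
      ((ContinuousAlternatingMap.ofSubsingleton ℝ (TangentSpace 𝓘(ℝ, E) x) ℝ 0).symm
        (A x))).smulRight (unit E W x)

theorem nabla_apply (A : FormField E X 1) (s : ∀ x, (trivialLine E W).fiber x) (x : X)
    (v : TangentSpace 𝓘(ℝ, E) x) : nabla W A s x v =
      (mvfderiv 𝓘(ℝ, E) (coord s) x v + 2 * Real.pi * Complex.I * coord s x *
        (A x fun _ => v : ℝ)) • unit E W x := rfl

theorem inner_unit_smul (a b : ℂ) (x : X) :
    inner ℂ (a • unit E W x) (b • unit E W x) = (starRingEnd ℂ) a * b := by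
  rw [inner_smul_left, inner_smul_right, inner_self_of_norm_eq_one (norm_unit x), mul_one]

theorem mvfderiv_conj {f : X → ℂ} {x : X} (hf : MDifferentiableAt 𝓘(ℝ, E) 𝓘(ℝ, ℂ) f x)
    (v : TangentSpace 𝓘(ℝ, E) x) :
    mvfderiv 𝓘(ℝ, E) (fun y => (starRingEnd ℂ) (f y)) x v =
      (starRingEnd ℂ) (mvfderiv 𝓘(ℝ, E) f x v) := by
  have h1 := Complex.conjCLE.toContinuousLinearMap.hasMFDerivAt (x := f x)
  have h := (h1.comp x hf.hasMFDerivAt).mfderiv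
  exact congrArg (fun (l : TangentSpace 𝓘(ℝ, E) x →L[ℝ] ℂ) => l v) h

/-- For s = g e with e the standard section, ⟨s, ∇s⟩ is g⁻¹ dg + 2πiA; division by 2πi turns this
into dlog g + A. -/
theorem connectionForm_eq (A : FormField E X 1) {O : Opens X}
    {s : ∀ x, (trivialLine E W).fiber x} {g : X → Additive Circle}
    (hg : ∀ x ∈ O, ((g x).toMul : ℂ) = coord s x) {x : X} (hx : x ∈ O) :
    (trivialLine E W).connectionForm (nabla W A) s x = A x + dlog g x := by
  ext v
  have h1 : mvfderiv 𝓘(ℝ, E) (coord s) x =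
      mvfderiv 𝓘(ℝ, E) (fun y => ((g y).toMul : ℂ)) x :=
    mvfderiv_congr (by
      filter_upwards [O.isOpen.mem_nhds hx] with y hy using (hg y hy).symm)
  have hv : (fun _ : Fin 1 => v 0) = v := by
    funext i; rw [Subsingleton.elim i 0]
  have h2 : inner ℂ (s x) (nabla W A s x (v 0)) = (((g x).toMul⁻¹ : Circle) : ℂ) *
        mvfderiv 𝓘(ℝ, E) (fun y => ((g y).toMul : ℂ)) x (v 0) +
        2 * Real.pi * Complex.I * (A x v : ℝ) := by
    rw [nabla_apply, hv, h1]
    conv_lhs => rw [eq_coord_smul s x]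
    rw [inner_unit_smul, ← hg x hx, ← Circle.coe_inv_eq_conj, Circle.coe_inv]
    have := Circle.coe_ne_zero (g x).toMul
    field_simp
  have h3 : divTwoPiI (2 * Real.pi * Complex.I * (A x v : ℝ)) = A x v := by
    rw [divTwoPiI_apply]
    have := Real.pi_ne_zero
    simp
    field_simp
  refine (congrArg divTwoPiI h2).trans ?_
  rw [map_add, h3, add_comm]
  rfl

/-- The connection `d + 2πi A` of the trivial line bundle. -/
noncomputable def connection [IsManifold 𝓘(ℝ, E) ∞ X] {A : FormField E X 1}
    (hA : SmoothFormOn A W) :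
    HermConnection (trivialLine E W) where
  nabla := nabla W A
  add O s t hs ht x hx := by
    ext1 v
    have h1 : coord (fun y => s y + t y) = coord s + coord t := by
      funext y; exact inner_add_right _ _ _
    rw [add_apply, nabla_apply, nabla_apply, nabla_apply, h1,
      mvfderiv_add (mdifferentiableAt_coord hs hx) (mdifferentiableAt_coord ht hx), ← add_smul]
    congr 1
    rw [add_apply, Pi.add_apply]
    ring
  leibniz O f s hf hs x hx v := by
    have h1 : coord (fun y => f y • s y) = fun y => f y * coord s y := by
      funext y; exact inner_smul_right _ _ _
    have hfd := (hf.contMDiffAt (O.isOpen.mem_nhds hx)).mdifferentiableAt (n := ∞) (by simp)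
    rw [nabla_apply, nabla_apply, h1, mvfderiv_complex_mul hfd (mdifferentiableAt_coord hs hx)]
    conv_rhs => rw [eq_coord_smul s x]
    rw [smul_smul, smul_smul, ← add_smul]
    congr 1
    ring
  metric O s t hs ht x hx v := by
    have h1 : (fun y => (inner ℂ (s y) (t y) : ℂ)) =
        fun y => (starRingEnd ℂ) (coord s y) * coord t y := by
      funext y
      rw [eq_coord_smul s y, eq_coord_smul t y, inner_unit_smul]
    have hs' := mdifferentiableAt_coord hs hx
    have hsc : MDifferentiableAt 𝓘(ℝ, E) 𝓘(ℝ, ℂ) (fun y => (starRingEnd ℂ) (coord s y)) x :=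
      Complex.conjCLE.toContinuousLinearMap.mdifferentiableAt.comp x hs'
    rw [h1, mvfderiv_complex_mul hsc (mdifferentiableAt_coord ht hx), mvfderiv_conj hs',
      nabla_apply, nabla_apply]
    conv_rhs => rw [eq_coord_smul s x, eq_coord_smul t x]
    rw [inner_unit_smul, inner_unit_smul]
    simp only [coord, map_add, map_mul, Complex.conj_I, Complex.conj_ofReal, map_ofNat]
    ring
  smooth O s hs := by
    obtain ⟨g, hg, h⟩ := exists_circleSmoothOn (contMDiffOn_coord hs.1) fun x hx => by
      have h2 := congrArg norm (eq_coord_smul s x)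
      rw [norm_smul, hs.2 x hx, norm_unit, mul_one] at h2
      exact h2.symm
    exact ((hA.mono hs.1.1).add (SmoothFormOn.dlog hg)).congr fun x hx => connectionForm_eq A h hx

variable [IsManifold 𝓘(ℝ, E) ∞ X] {A : FormField E X 1} (hA : SmoothFormOn A W)

theorem form_unit (x : X) : (connection hA).form (unit E W) x = A x := by
  have h : ∀ y ∈ (⊤ : Opens X), (((0 : X → Additive Circle) y).toMul : ℂ) =
      coord (unit E W) y := fun y _ => (inner_self_of_norm_eq_one (norm_unit y)).symm
  refine (connectionForm_eq A h (Opens.mem_top x)).trans ?_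
  rw [dlog_zero, add_zero]

/-- An arbitrary unitary section has connection form A + dlog g, and d dlog g = 0, so it suffices to
know dA for the standard section. -/
theorem hasCurvature {F : FormField E X 2} (hF : ∀ x ∈ W, F x = extD A x) :
    (connection hA).HasCurvature F := by
  intro O s hs x hx
  obtain ⟨g, hg, h⟩ := (unitarySection_unit.mono hs.1.1).exists_smul hs
  rw [inf_idem] at hg h
  have h1 : ∀ y ∈ O, (connection hA).form s y = (A + dlog g : FormField E X 1) y := fun y hy => by
    rw [(connection hA).form_smul (unitarySection_unit.mono hs.1.1) hg h hy, form_unit]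
    rfl
  rw [hF x (hs.1.1 hx), extD_congr h1 hx, extD_add (hA.mono hs.1.1) (SmoothFormOn.dlog hg) hx,
    extD_dlog hg hx]
  exact (add_zero _).symm

end trivialLine
end

/-! ### Refinements over which all the bundles have unitary sections. -/

section

/-- On a paracompact Hausdorff space there is a refinement, indexed by the points of the space, of a
given open cover, on the double intersections of which a given local property holds. -/
theorem exists_pointwise_refinement {N J : Type*} [TopologicalSpace N] [T2Space N]
    [ParacompactSpace N] (V : J → Opens N) (hV : ∀ y, ∃ j, y ∈ V j)
    (P : J → J → Opens N → Prop) (mono : ∀ j k O O', P j k O → O' ≤ O → P j k O')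
    (bot : ∀ j k, P j k ⊥)
    (loc : ∀ j k y, y ∈ V j → y ∈ V k → ∃ O : Opens N, y ∈ O ∧ P j k O) :
    ∃ (b : N → J) (B : N → Opens N), (∀ y, y ∈ B y) ∧ (∀ y, B y ≤ V (b y)) ∧
      ∀ y y', P (b y) (b y') (B y ⊓ B y') := by
  classical
  obtain ⟨u, hu, huU, huf, huV⟩ := precise_refinement (fun j => (V j : Set N))
    (fun j => (V j).isOpen) (by
      refine eq_univ_of_forall fun y => ?_
      obtain ⟨j, hj⟩ := hV y
      exact mem_iUnion.2 ⟨j, hj⟩)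
  -- Shrink the locally finite refinement: the closures of the v_j stay inside the u_j and are still
  -- locally finite, so each point lies in finitely many of them.
  obtain ⟨v, hvU, hv, hvu⟩ := exists_iUnion_eq_closure_subset hu (fun y => huf.point_finite y) huU
  have hvf : LocallyFinite fun j => closure (v j) := huf.subset hvu
  have hb : ∀ y, ∃ j, y ∈ v j := fun y => mem_iUnion.1 (hvU ▸ mem_univ y)
  choose b hb using hb
  have hO : ∀ y j, ∃ O : Opens N, y ∈ O ∧ (y ∈ closure (v j) → P (b y) j O) := by
    intro y j
    by_cases hy : y ∈ closure (v j)
    · obtain ⟨O, hO, hP⟩ := loc (b y) j y (huV _ (hvu _ (subset_closure (hb y))))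
        (huV _ (hvu _ hy))
      exact ⟨O, hO, fun _ => hP⟩
    · exact ⟨⊤, Opens.mem_top y, fun h => absurd h hy⟩
  choose O hyO hOP using hO
  -- The neighbourhood of y lies in v_{b y}, avoids every closure of v_j that does not contain y,
  -- and lies in the finitely many `O y j` with y in the closure of v_j.
  have hB : ∀ y, ∃ B : Opens N, y ∈ B ∧ (B : Set N) ⊆ v (b y) ∧
      ∀ j, ((B : Set N) ∩ v j).Nonempty → y ∈ closure (v j) ∧ B ≤ O y j := by
    intro y
    have h1 := hvf.iInter_compl_mem_nhds (fun _ => isClosed_closure) y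
    have h2 : (⋂ j ∈ {j | y ∈ closure (v j)}, (O y j : Set N)) ∈ nhds y :=
      (Filter.biInter_mem (hvf.point_finite y)).2 fun j _ => (O y j).isOpen.mem_nhds (hyO y j)
    obtain ⟨s, hs, hso, hys⟩ := mem_nhds_iff.1
      (Filter.inter_mem (Filter.inter_mem h1 h2) ((hv (b y)).mem_nhds (hb y)))
    refine ⟨⟨s, hso⟩, hys, fun x hx => (hs hx).2, ?_⟩
    rintro j ⟨x, hx, hxj⟩
    have hyj : y ∈ closure (v j) := by
      by_contra hn
      exact mem_iInter₂.1 (hs hx).1.1 j hn (subset_closure hxj)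
    exact ⟨hyj, fun x hx => mem_iInter₂.1 (hs hx).1.2 j hyj⟩
  choose B hyB hBv hBP using hB
  refine ⟨b, B, hyB, fun y x hx => huV _ (hvu _ (subset_closure (hBv y hx))), fun y y' => ?_⟩
  rcases eq_bot_or_bot_lt (B y ⊓ B y') with h | h
  · rw [h]; exact bot _ _
  · have hne : ((B y : Set N) ∩ B y').Nonempty := by
      rw [nonempty_iff_ne_empty]
      intro he
      exact h.ne' (Opens.ext he)
    -- If B_y meets B_{y'}, it meets v_{b y'}; then y lies in the closure of that set, and B_y is
    -- inside a set on which the property holds for (b y, b y').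
    obtain ⟨h1, h2⟩ := hBP y (b y') (hne.mono (inter_subset_inter_right _ (hBv y')))
    exact mono _ _ _ _ (hOP y (b y') h1) (inf_le_left.trans h2)

theorem paracompactSpace_of_chartedSpace (E X : Type*) [NormedAddCommGroup E] [NormedSpace ℝ E]
    [FiniteDimensional ℝ E] [TopologicalSpace X] [T2Space X] [SecondCountableTopology X]
    [ChartedSpace E X] : ParacompactSpace X := by
  have := FiniteDimensional.proper ℝ E
  have := ChartedSpace.locallyCompactSpace E X
  infer_instance

variable {EM EN : Type*} [NormedAddCommGroup EM] [NormedSpace ℝ EM]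
  [NormedAddCommGroup EN] [NormedSpace ℝ EN]
  {M N : Type u} [TopologicalSpace M] [ChartedSpace EM M] [TopologicalSpace N] [ChartedSpace EN N]
  {Φ : M → N}

/-- A refinement `c` of the cover of `𝒢`, such that the refined sets lying over a set of the cover
of `𝒢` cover it, with unitary sections of the bundles of `𝒢` over the refined cover. Only the
values `s k l (σ k) (σ l)` and `q h (ρ h)` matter. -/
structure RelativeGerbe.SectionData (𝒢 : RelativeGerbe EM EN Φ) (c : CoverPair Φ) where
  ρ : c.I → 𝒢.cover.I
  σ : c.J → 𝒢.cover.J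
  U_le : ∀ h, c.U h ≤ 𝒢.cover.U (ρ h)
  V_le : ∀ k, c.V k ≤ 𝒢.cover.V (σ k)
  r_eq : ∀ h, σ (c.r h) = 𝒢.cover.r (ρ h)
  exists_U : ∀ i, ∀ x ∈ 𝒢.cover.U i, ∃ h, ρ h = i ∧ x ∈ c.U h
  exists_V : ∀ j, ∀ y ∈ 𝒢.cover.V j, ∃ k, σ k = j ∧ y ∈ c.V k
  s : c.J → c.J → ∀ j j' y, (𝒢.gerbe.L j j').fiber y
  q : c.I → ∀ i x, (𝒢.Q i).fiber x
  unitary_s : ∀ k l,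
    (𝒢.gerbe.L (σ k) (σ l)).UnitarySection (c.V k ⊓ c.V l) (s k l (σ k) (σ l))
  unitary_q : ∀ h, (𝒢.Q (ρ h)).UnitarySection (c.U h) (q h (ρ h))

/-- The pointwise refinement alone sees only the index b(y) chosen at each point, whereas comparing
isomorphic gerbes requires the refined sets over every V_j to cover V_j. So B_y is repeated for
every j and cut down to domains of frames of L_{b(y) j}. The Q_i are indexed by single sets, so on M
local frames and preimages suffice. -/
theorem RelativeGerbe.exists_sectionData [T2Space N] [ParacompactSpace N] (hΦ : Continuous Φ)
    (𝒢 : RelativeGerbe EM EN Φ) : ∃ c : CoverPair Φ, Nonempty (𝒢.SectionData c) := by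
  classical
  obtain ⟨b, B, hyB, hBV, hP⟩ := exists_pointwise_refinement 𝒢.cover.V 𝒢.cover.exists_mem_V
    (fun j k O => ∃ s, (𝒢.gerbe.L j k).UnitarySection O s)
    (fun j k O O' ⟨s, hs⟩ h => ⟨s, hs.mono h⟩)
    (fun j k => ⟨0, HermLineBundle.unitarySection_bot⟩)
    (fun j k y hj hk => by
      obtain ⟨a, ha⟩ := (𝒢.gerbe.L j k).exists_mem_dom y ⟨hj, hk⟩
      exact ⟨_, ha, _, (𝒢.gerbe.L j k).unitarySection_frame a⟩)
  let J' : Type u := Σ (y : N) (j : 𝒢.cover.J), (𝒢.gerbe.L (b y) j).ι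
  let V' : J' → Opens N := fun k => B k.1 ⊓ (𝒢.gerbe.L (b k.1) k.2.1).dom k.2.2
  let I' : Type u := Σ (i : 𝒢.cover.I) (_ : {k : J' // k.2.1 = 𝒢.cover.r i}), (𝒢.Q i).ι
  let U' : I' → Opens M := fun h =>
    (𝒢.Q h.1).dom h.2.2 ⊓ ⟨Φ ⁻¹' V' h.2.1.1, (V' h.2.1.1).isOpen.preimage hΦ⟩
  have hV : ∀ j, ∀ y ∈ 𝒢.cover.V j, ∃ k : J', k.2.1 = j ∧ y ∈ V' k := by
    intro j y hy
    obtain ⟨a, ha⟩ := (𝒢.gerbe.L (b y) j).exists_mem_dom y ⟨hBV y (hyB y), hy⟩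
    exact ⟨⟨y, j, a⟩, rfl, hyB y, ha⟩
  have hU : ∀ i, ∀ x ∈ 𝒢.cover.U i, ∃ h : I', h.1 = i ∧ x ∈ U' h := by
    intro i x hx
    obtain ⟨k, hk, hxk⟩ := hV _ _ (𝒢.cover.mapsTo i x hx)
    obtain ⟨a, ha⟩ := (𝒢.Q i).exists_mem_dom x hx
    exact ⟨⟨i, ⟨k, hk⟩, a⟩, rfl, ha, hxk⟩
  -- The index equations are premises inside the existential, so that s is defined for all j, j' and
  -- no transport between fibres is needed later.
  have hs : ∀ (k l : J') j j', ∃ s, k.2.1 = j → l.2.1 = j' →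
      (𝒢.gerbe.L j j').UnitarySection (V' k ⊓ V' l) s := by
    intro k l j j'
    by_cases hkl : k.2.1 = j ∧ l.2.1 = j'
    · obtain ⟨rfl, rfl⟩ := hkl
      have hk := (𝒢.gerbe.L (b k.1) k.2.1).dom_le k.2.2
      have hl := (𝒢.gerbe.L (b l.1) l.2.1).dom_le l.2.2
      have h1 : V' k ⊓ V' l ≤ 𝒢.cover.V k.2.1 := fun y hy => (hk hy.1.2).2
      have h2 : V' k ⊓ V' l ≤ 𝒢.cover.V l.2.1 := fun y hy => (hl hy.2.2).2
      have h3 : V' k ⊓ V' l ≤ 𝒢.cover.V (b k.1) := fun y hy => (hk hy.1.2).1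
      have h4 : V' k ⊓ V' l ≤ 𝒢.cover.V (b l.1) := fun y hy => (hl hy.2.2).1
      obtain ⟨sbb, hsbb⟩ := hP k.1 l.1
      replace hsbb := hsbb.mono (show V' k ⊓ V' l ≤ _ from fun y hy => ⟨hy.1.1, hy.2.1⟩)
      have hsl := ((𝒢.gerbe.L (b l.1) l.2.1).unitarySection_frame l.2.2).mono
        (show V' k ⊓ V' l ≤ _ from fun y hy => hy.2.2)
      have hsk := ((𝒢.gerbe.L (b k.1) k.2.1).unitarySection_frame k.2.2).mono
        (show V' k ⊓ V' l ≤ _ from fun y hy => hy.1.2)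
      -- With b, b' the chosen indices: sections of L_{bb'} and L_{b'j'} give one of L_{bj'} through
      -- θ_{bb'j'}, and this with the frame of L_{bj} gives one of L_{jj'} through θ_{bjj'}.
      obtain ⟨sbl, hsbl⟩ := exists_unitarySection_of_hasCoord_mid
        ((𝒢.gerbe.parallel_θ (b k.1) (b l.1) l.2.1).mono (le_inf (le_inf h3 h4) h2))
        (le_inf h3 h2) hsl hsbb
      obtain ⟨s, hs⟩ := exists_unitarySection_of_hasCoord_left
        ((𝒢.gerbe.parallel_θ (b k.1) k.2.1 l.2.1).mono (le_inf (le_inf h3 h1) h2))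
        (le_inf h1 h2) hsbl hsk
      exact ⟨s, fun _ _ => hs⟩
    · exact ⟨0, fun h h' => absurd ⟨h, h'⟩ hkl⟩
  have hq : ∀ (h : I') i, ∃ q, h.1 = i → (𝒢.Q i).UnitarySection (U' h) q := by
    intro h i
    by_cases hi : h.1 = i
    · obtain rfl := hi
      exact ⟨_, fun _ => ((𝒢.Q h.1).unitarySection_frame h.2.2).mono inf_le_left⟩
    · exact ⟨0, fun h' => absurd h' hi⟩
  choose s hs using hs
  choose q hq using hq
  let c : CoverPair Φ :=
    { I := I'
      J := J'
      U := U'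
      V := V'
      r := fun h => h.2.1.1
      exists_mem_U := fun x => by
        obtain ⟨i, hi⟩ := 𝒢.cover.exists_mem_U x
        obtain ⟨h, -, hx⟩ := hU i x hi
        exact ⟨h, hx⟩
      exists_mem_V := fun y => by
        obtain ⟨j, hj⟩ := 𝒢.cover.exists_mem_V y
        obtain ⟨k, -, hy⟩ := hV j y hj
        exact ⟨k, hy⟩
      mapsTo := fun h x hx => hx.2 }
  exact ⟨c, ⟨{
    ρ := fun h => h.1
    σ := fun k => k.2.1
    U_le := fun h => inf_le_left.trans ((𝒢.Q h.1).dom_le h.2.2)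
    V_le := fun k y hy => ((𝒢.gerbe.L (b k.1) k.2.1).dom_le k.2.2 hy.2).2
    r_eq := fun h => h.2.1.2
    exists_U := hU
    exists_V := hV
    s := s
    q := q
    unitary_s := fun k l => hs k l _ _ rfl rfl
    unitary_q := fun h => hq h _ rfl }⟩⟩

end

/-! ### Čech differentials and intersections in low degrees. -/

section
variable {J A : Type*} [AddCommGroup A]

theorem Cech.δ_zero_apply (f : Cech J 0 A) (s : Fin 2 → J) : f.δ s = f ![s 1] - f ![s 0] := by
  have h0 : s ∘ Fin.succ = ![s 1] := by ext i; fin_cases i; rfl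
  have h1 : s ∘ (1 : Fin 2).succAbove = ![s 0] := by ext i; fin_cases i; rfl
  simp [Cech.δ, Fin.sum_univ_two, h0, h1, sub_eq_add_neg]

theorem Cech.δ_one_apply (f : Cech J 1 A) (s : Fin 3 → J) :
    f.δ s = f ![s 1, s 2] - f ![s 0, s 2] + f ![s 0, s 1] := by
  have h0 : s ∘ Fin.succ = ![s 1, s 2] := by ext i; fin_cases i <;> rfl
  have h1 : s ∘ (1 : Fin 3).succAbove = ![s 0, s 2] := by ext i; fin_cases i <;> rfl
  have h2 : s ∘ (2 : Fin 3).succAbove = ![s 0, s 1] := by ext i; fin_cases i <;> rfl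
  simp [Cech.δ, Fin.sum_univ_three, h0, h1, h2, sub_eq_add_neg]

theorem Cech.δ_two_apply (f : Cech J 2 A) (s : Fin 4 → J) : f.δ s =
    f ![s 1, s 2, s 3] - f ![s 0, s 2, s 3] + f ![s 0, s 1, s 3] - f ![s 0, s 1, s 2] := by
  have h0 : s ∘ Fin.succ = ![s 1, s 2, s 3] := by ext i; fin_cases i <;> rfl
  have h1 : s ∘ (1 : Fin 4).succAbove = ![s 0, s 2, s 3] := by ext i; fin_cases i <;> rfl
  have h2 : s ∘ (2 : Fin 4).succAbove = ![s 0, s 1, s 3] := by ext i; fin_cases i <;> rfl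
  have h3 : s ∘ (3 : Fin 4).succAbove = ![s 0, s 1, s 2] := by ext i; fin_cases i <;> rfl
  have h : (-1 : ℤ) ^ 3 = -1 := by norm_num
  simp [Cech.δ, Fin.sum_univ_four, h0, h1, h2, h3, sub_eq_add_neg, h]

theorem mem_interOpens {X : Type*} [TopologicalSpace X] {V : J → Opens X} {p : ℕ}
    {s : Fin (p + 1) → J} {x : X} : x ∈ interOpens V s ↔ ∀ k, x ∈ V (s k) := by
  rw [← SetLike.mem_coe, interOpens, Opens.coe_finset_inf]
  simp

theorem interOpens_le {X : Type*} [TopologicalSpace X] {V : J → Opens X} {p : ℕ}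
    {s : Fin (p + 1) → J} (k : Fin (p + 1)) : interOpens V s ≤ V (s k) :=
  fun _ hx => mem_interOpens.1 hx k

theorem mem_interOpens_one {X : Type*} [TopologicalSpace X] {V : J → Opens X} {i : J} {x : X}
    (h : x ∈ V i) : x ∈ interOpens V ![i] := mem_interOpens.2 fun k => by fin_cases k; exact h

theorem mem_interOpens_two {X : Type*} [TopologicalSpace X] {V : J → Opens X} {i j : J} {x : X}
    (h : x ∈ V i) (h' : x ∈ V j) : x ∈ interOpens V ![i, j] :=
  mem_interOpens.2 fun k => by fin_cases k; exacts [h, h']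

theorem mem_interOpens_three {X : Type*} [TopologicalSpace X] {V : J → Opens X} {i j k : J} {x : X}
    (h : x ∈ V i) (h' : x ∈ V j) (h'' : x ∈ V k) : x ∈ interOpens V ![i, j, k] :=
  mem_interOpens.2 fun k => by fin_cases k; exacts [h, h', h'']

end

/-! ### From a relative gerbe with unitary sections to a cocycle. -/

section
variable {EM EN : Type*} [NormedAddCommGroup EM] [NormedSpace ℝ EM]
  [NormedAddCommGroup EN] [NormedSpace ℝ EN]
  {M N : Type u} [TopologicalSpace M] [ChartedSpace EM M] [TopologicalSpace N] [ChartedSpace EN N]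
  {Φ : M → N} {𝒢 : RelativeGerbe EM EN Φ} {c : CoverPair Φ}

namespace RelativeGerbe.SectionData

/-- The cochain `z` is read off from `𝒢` by means of the sections `S`. -/
structure Reads (S : 𝒢.SectionData c) (z : c.Cone2 EM EN) : Prop where
  eq_h : ∀ i : Fin 2 → c.I, ∀ x ∈ interOpens c.U i,
    HasCoord (𝒢.ψ (S.ρ (i 0)) (S.ρ (i 1)) x) (S.q (i 0) (S.ρ (i 0)) x) (S.q (i 1) (S.ρ (i 1)) x)
      (S.s (c.r (i 0)) (c.r (i 1)) (𝒢.cover.r (S.ρ (i 0))) (𝒢.cover.r (S.ρ (i 1))) (Φ x))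
      (z.1.1 i x).toMul
  eq_l : ∀ i : Fin 1 → c.I, ∀ x ∈ interOpens c.U i,
    z.1.2 i x = (𝒢.DQ (S.ρ (i 0))).form (S.q (i 0) (S.ρ (i 0))) x
  eq_t : ∀ j : Fin 3 → c.J, ∀ y ∈ interOpens c.V j,
    HasCoord (𝒢.gerbe.θ (S.σ (j 0)) (S.σ (j 1)) (S.σ (j 2)) y)
      (S.s (j 1) (j 2) (S.σ (j 1)) (S.σ (j 2)) y) (S.s (j 0) (j 2) (S.σ (j 0)) (S.σ (j 2)) y)
      (S.s (j 0) (j 1) (S.σ (j 0)) (S.σ (j 1)) y) (z.2.1 j y).toMul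
  eq_A : ∀ j : Fin 2 → c.J, ∀ y ∈ interOpens c.V j,
    z.2.2.1 j y = (𝒢.gerbe.D (S.σ (j 0)) (S.σ (j 1))).form
      (S.s (j 0) (j 1) (S.σ (j 0)) (S.σ (j 1))) y
  eq_ϖ : ∀ j : Fin 1 → c.J, ∀ y ∈ interOpens c.V j,
    z.2.2.2 j y = 𝒢.gerbe.curving (S.σ (j 0)) y

variable (S : 𝒢.SectionData c)

/-- The indices σ (r h) and r (ρ h) agree only propositionally; this lemma and the similar ones
below replace casts between fibres by a substitution. -/
theorem unitary_s_of_eq {k l : c.J} {j j' : 𝒢.cover.J} (hk : S.σ k = j) (hl : S.σ l = j') :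
    (𝒢.gerbe.L j j').UnitarySection (c.V k ⊓ c.V l) (S.s k l j j') := by
  subst hk hl; exact S.unitary_s k l

theorem Reads.hasCoord_of_eq {S : 𝒢.SectionData c} {z : c.Cone2 EM EN} (hz : S.Reads z)
    (k : Fin 3 → c.J) {j₀ j₁ j₂ : 𝒢.cover.J} (h₀ : S.σ (k 0) = j₀) (h₁ : S.σ (k 1) = j₁)
    (h₂ : S.σ (k 2) = j₂) {y : N} (hy : y ∈ interOpens c.V k) :
    HasCoord (𝒢.gerbe.θ j₀ j₁ j₂ y) (S.s (k 1) (k 2) j₁ j₂ y) (S.s (k 0) (k 2) j₀ j₂ y)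
      (S.s (k 0) (k 1) j₀ j₁ y) (z.2.1 k y).toMul := by
  subst h₀ h₁ h₂; exact hz.eq_t k y hy

theorem Reads.form_of_eq {S : 𝒢.SectionData c} {z : c.Cone2 EM EN} (hz : S.Reads z)
    (k : Fin 2 → c.J) {j₀ j₁ : 𝒢.cover.J} (h₀ : S.σ (k 0) = j₀) (h₁ : S.σ (k 1) = j₁)
    {y : N} (hy : y ∈ interOpens c.V k) :
    z.2.2.1 k y = (𝒢.gerbe.D j₀ j₁).form (S.s (k 0) (k 1) j₀ j₁) y := by
  subst h₀ h₁; exact hz.eq_A k y hy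

/-- The Čech cocycle read off by means of the sections `S`. -/
theorem exists_reads (hΦ : ContMDiff 𝓘(ℝ, EM) 𝓘(ℝ, EN) ∞ Φ) (S : 𝒢.SectionData c) :
    ∃ z : c.Cocycle EM EN, S.Reads z.val := by
  have hsub2 : ∀ {p : ℕ} (k : Fin (p + 1) → c.J) (a b : Fin (p + 1)),
      interOpens c.V k ≤ c.V (k a) ⊓ c.V (k b) := fun k a b =>
    le_inf (interOpens_le a) (interOpens_le b)
  have ht : ∀ k : Fin 3 → c.J, ∃ t : N → Additive Circle,
      CircleSmoothOn EN t (interOpens c.V k) ∧ ∀ y ∈ interOpens c.V k, _ ∧ _ := fun k =>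
    exists_hasCoord ((𝒢.gerbe.parallel_θ (S.σ (k 0)) (S.σ (k 1)) (S.σ (k 2))).mono
      (le_inf (le_inf ((interOpens_le 0).trans (S.V_le _)) ((interOpens_le 1).trans (S.V_le _)))
        ((interOpens_le 2).trans (S.V_le _))))
      ((S.unitary_s (k 1) (k 2)).mono (hsub2 k 1 2))
      ((S.unitary_s (k 0) (k 2)).mono (hsub2 k 0 2))
      ((S.unitary_s (k 0) (k 1)).mono (hsub2 k 0 1))
  have hh : ∀ i : Fin 2 → c.I, ∃ t : M → Additive Circle,
      CircleSmoothOn EM t (interOpens c.U i) ∧ ∀ x ∈ interOpens c.U i, _ ∧ _ := fun i =>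
    exists_hasCoord_pullback hΦ
      ((𝒢.parallel_ψ (S.ρ (i 0)) (S.ρ (i 1))).mono
        (le_inf ((interOpens_le 0).trans (S.U_le _)) ((interOpens_le 1).trans (S.U_le _))))
      ((S.unitary_q (i 0)).mono (interOpens_le 0))
      ((S.unitary_q (i 1)).mono (interOpens_le 1))
      (S.unitary_s_of_eq (S.r_eq (i 0)) (S.r_eq (i 1)))
      fun x hx => ⟨c.mapsTo _ x (interOpens_le 0 hx), c.mapsTo _ x (interOpens_le 1 hx)⟩
  choose t ht ht' using ht
  choose h hh hh' using hh
  let z : c.Cone2 EM EN :=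
    ((h, fun i => (𝒢.DQ (S.ρ (i 0))).form (S.q (i 0) (S.ρ (i 0)))),
      t, fun j => (𝒢.gerbe.D (S.σ (j 0)) (S.σ (j 1))).form
        (S.s (j 0) (j 1) (S.σ (j 0)) (S.σ (j 1))), fun j => 𝒢.gerbe.curving (S.σ (j 0)))
  have hz : S.Reads z :=
    ⟨fun i x hx => (hh' i x hx).1, fun _ _ _ => rfl, fun k y hy => (ht' k y hy).1,
      fun _ _ _ => rfl, fun _ _ _ => rfl⟩
  refine ⟨⟨z, ⟨hh, fun i => (𝒢.DQ _).smooth_form ((S.unitary_q (i 0)).mono (interOpens_le 0)),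
    ht, fun k => (𝒢.gerbe.D _ _).smooth_form ((S.unitary_s (k 0) (k 1)).mono (hsub2 k 0 1)),
    fun k => (𝒢.gerbe.smooth_curving _).mono ((interOpens_le 0).trans (S.V_le _))⟩, ?_, ?_, ?_,
    ?_, ?_⟩, hz⟩
  -- Φ^*t = δh, from δψ = Φ^*θ.
  · intro i x hx
    have hx3 := fun a b => mem_interOpens_two (mem_interOpens.1 hx a) (mem_interOpens.1 hx b)
    have hxr : Φ x ∈ interOpens c.V (c.r ∘ i) :=
      mem_interOpens.2 fun k => c.mapsTo _ x (mem_interOpens.1 hx k)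
    have h1 := 𝒢.δ_ψ (S.ρ (i 0)) (S.ρ (i 1)) (S.ρ (i 2)) x
      ⟨⟨S.U_le _ (interOpens_le 0 hx), S.U_le _ (interOpens_le 1 hx)⟩,
        S.U_le _ (interOpens_le 2 hx)⟩ _ _ _ _ _ _ _ _ _ _
      (hz.eq_h ![i 1, i 2] x (hx3 1 2)) (hz.eq_h ![i 0, i 2] x (hx3 0 2))
      (hz.eq_h ![i 0, i 1] x (hx3 0 1))
      (hz.hasCoord_of_eq (c.r ∘ i) (S.r_eq _) (S.r_eq _) (S.r_eq _) hxr)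
    show z.2.1 (c.r ∘ i) (Φ x) - (Cech.δ z.1.1 i) x = 0
    rw [Cech.δ_one_apply, sub_eq_zero]
    apply Additive.toMul.injective
    apply Circle.coe_injective
    rw [← h1]
    simp [div_eq_mul_inv]
  -- Φ^*A = δl - dlog h, from the parallelism of ψ.
  · intro i x hx
    have hxr : Φ x ∈ interOpens c.V (c.r ∘ i) :=
      mem_interOpens.2 fun k => c.mapsTo _ x (mem_interOpens.1 hx k)
    have h1 := (hh' i x hx).2
    have h2 : (formPullback Φ (z.2.2.1 (c.r ∘ i)) : FormField EM M 1) x = _ :=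
      formPullback_congr (E := EM) (hz.form_of_eq (c.r ∘ i) (S.r_eq (i 0)) (S.r_eq (i 1)) hxr)
    show (formPullback Φ (z.2.2.1 (c.r ∘ i)) : FormField EM M 1) x -
      ((Cech.δ z.1.2 i) x - dlog (h i) x) = 0
    rw [h2, Cech.δ_zero_apply, ← h1]
    show _ - ((𝒢.DQ (S.ρ (i 1))).form (S.q (i 1) (S.ρ (i 1))) x -
      (𝒢.DQ (S.ρ (i 0))).form (S.q (i 0) (S.ρ (i 0))) x - _) = _
    simp only [Function.comp_apply]
    abel
  -- δt = 0, from δθ = 1.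
  · intro k y hy
    have hy3 := fun a b d => mem_interOpens_three (mem_interOpens.1 hy a) (mem_interOpens.1 hy b)
      (mem_interOpens.1 hy d)
    have h1 := 𝒢.gerbe.δ_θ (S.σ (k 0)) (S.σ (k 1)) (S.σ (k 2)) (S.σ (k 3)) y
      ⟨⟨⟨S.V_le _ (interOpens_le 0 hy), S.V_le _ (interOpens_le 1 hy)⟩,
        S.V_le _ (interOpens_le 2 hy)⟩, S.V_le _ (interOpens_le 3 hy)⟩ _ _ _ _ _ _ _ _ _ _
      (hz.eq_t ![k 1, k 2, k 3] y (hy3 1 2 3)) (hz.eq_t ![k 0, k 2, k 3] y (hy3 0 2 3))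
      (hz.eq_t ![k 0, k 1, k 3] y (hy3 0 1 3)) (hz.eq_t ![k 0, k 1, k 2] y (hy3 0 1 2))
    show (Cech.δ z.2.1 k) y = 0
    rw [Cech.δ_two_apply]
    apply Additive.toMul.injective
    apply Circle.coe_injective
    rw [toMul_zero, Circle.coe_one, ← h1]
    simp [div_eq_mul_inv]
  -- δA + dlog t = 0, from the parallelism of θ.
  · intro k y hy
    rw [← (ht' k y hy).2]
    show (Cech.δ z.2.2.1 k) y + dlog (t k) y = _
    rw [Cech.δ_one_apply]
    show (𝒢.gerbe.D (S.σ (k 1)) (S.σ (k 2))).form (S.s (k 1) (k 2) (S.σ (k 1)) (S.σ (k 2))) y -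
      (𝒢.gerbe.D (S.σ (k 0)) (S.σ (k 2))).form (S.s (k 0) (k 2) (S.σ (k 0)) (S.σ (k 2))) y +
      (𝒢.gerbe.D (S.σ (k 0)) (S.σ (k 1))).form (S.s (k 0) (k 1) (S.σ (k 0)) (S.σ (k 1))) y +
      dlog (t k) y = _
    abel
  -- δϖ = dA, the curvature condition for the section `s`.
  · intro k y hy
    show (Cech.δ z.2.2.2 k) y - extD (z.2.2.1 k) y = 0
    rw [Cech.δ_zero_apply, sub_eq_zero]
    exact 𝒢.gerbe.δ_curving (S.σ (k 0)) (S.σ (k 1)) _ _ (S.unitary_s (k 0) (k 1)) y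
      (hsub2 k 0 1 hy)

end RelativeGerbe.SectionData
end

/-! ### Tuples of indices, and gerbe identities in the standard line. -/

section
theorem vec_eta_one {J : Type*} (i : Fin 1 → J) : ![i 0] = i := by
  ext k; fin_cases k; rfl

theorem vec_eta_two {J : Type*} (i : Fin 2 → J) : ![i 0, i 1] = i := by
  ext k; fin_cases k <;> rfl

theorem vec_eta_three {J : Type*} (i : Fin 3 → J) : ![i 0, i 1, i 2] = i := by
  ext k; fin_cases k <;> rfl

theorem comp_vec_one {I J : Type*} (f : I → J) (a : I) : f ∘ ![a] = ![f a] := by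
  ext k; fin_cases k; rfl

theorem comp_vec_two {I J : Type*} (f : I → J) (a b : I) : f ∘ ![a, b] = ![f a, f b] := by
  ext k; fin_cases k <;> rfl

theorem comp_vec_three {I J : Type*} (f : I → J) (a b c : I) :
    f ∘ ![a, b, c] = ![f a, f b, f c] := by
  ext k; fin_cases k <;> rfl

section
variable {t₁ t₂ t₃ t₄ : Circle} {a b c d e f : EuclideanSpace ℂ PUnit.{u + 1}} {z₁ z₂ z₃ z₄ : ℂ}

theorem exists_circle_smul_lineUnit {a : EuclideanSpace ℂ PUnit.{u + 1}} (ha : ‖a‖ = 1) :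
    ∃ z : Circle, a = (z : ℂ) • lineUnit :=
  exists_circle_smul_of_finrank_eq_one (by simp) norm_lineUnit ha

theorem hasCoord_lineUnit (z : ℂ) :
    HasCoord (z • (lineUnit.{u} ⊗ₜ[ℂ] (dualVec lineUnit.{u} ⊗ₜ[ℂ] lineUnit.{u})))
      lineUnit lineUnit lineUnit z := ⟨norm_lineUnit, norm_lineUnit, norm_lineUnit, rfl⟩

/-- The gerbe condition is tested on arbitrary unit vectors. Each is a `Circle` multiple of
`lineUnit`, and in the alternating product every such factor occurs once with each sign. -/
theorem HasCoord.lineUnit_cocycle (h : t₁ * t₂⁻¹ * t₃ * t₄⁻¹ = 1)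
    (h₁ : HasCoord ((t₁ : ℂ) • (lineUnit ⊗ₜ[ℂ] (dualVec lineUnit ⊗ₜ[ℂ] lineUnit))) a b c z₁)
    (h₂ : HasCoord ((t₂ : ℂ) • (lineUnit ⊗ₜ[ℂ] (dualVec lineUnit ⊗ₜ[ℂ] lineUnit))) a d e z₂)
    (h₃ : HasCoord ((t₃ : ℂ) • (lineUnit ⊗ₜ[ℂ] (dualVec lineUnit ⊗ₜ[ℂ] lineUnit))) b d f z₃)
    (h₄ : HasCoord ((t₄ : ℂ) • (lineUnit ⊗ₜ[ℂ] (dualVec lineUnit ⊗ₜ[ℂ] lineUnit))) c e f z₄) :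
    z₁ * z₂⁻¹ * z₃ * z₄⁻¹ = 1 := by
  obtain ⟨α, rfl⟩ := exists_circle_smul_lineUnit h₁.1
  obtain ⟨β, rfl⟩ := exists_circle_smul_lineUnit h₁.2.1
  obtain ⟨γ, rfl⟩ := exists_circle_smul_lineUnit h₁.2.2.1
  obtain ⟨δ, rfl⟩ := exists_circle_smul_lineUnit h₂.2.1
  obtain ⟨ε, rfl⟩ := exists_circle_smul_lineUnit h₂.2.2.1
  obtain ⟨ζ, rfl⟩ := exists_circle_smul_lineUnit h₃.2.2.1
  rw [← ((hasCoord_lineUnit _).smul α β γ).unique h₁, ← ((hasCoord_lineUnit _).smul α δ ε).unique h₂,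
    ← ((hasCoord_lineUnit _).smul β δ ζ).unique h₃, ← ((hasCoord_lineUnit _).smul γ ε ζ).unique h₄]
  have h5 := congrArg (fun a : Circle => (a : ℂ)) h
  simp only [Circle.coe_mul, Circle.coe_inv, Circle.coe_one] at h5 ⊢
  rw [← h5]
  have := Circle.coe_ne_zero
  field_simp

theorem HasCoord.lineUnit_coboundary (h : t₄ = t₁ * t₂⁻¹ * t₃)
    (h₁ : HasCoord ((t₁ : ℂ) • (lineUnit ⊗ₜ[ℂ] (dualVec lineUnit ⊗ₜ[ℂ] lineUnit))) b c d z₁)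
    (h₂ : HasCoord ((t₂ : ℂ) • (lineUnit ⊗ₜ[ℂ] (dualVec lineUnit ⊗ₜ[ℂ] lineUnit))) a c e z₂)
    (h₃ : HasCoord ((t₃ : ℂ) • (lineUnit ⊗ₜ[ℂ] (dualVec lineUnit ⊗ₜ[ℂ] lineUnit))) a b f z₃)
    (h₄ : HasCoord ((t₄ : ℂ) • (lineUnit ⊗ₜ[ℂ] (dualVec lineUnit ⊗ₜ[ℂ] lineUnit))) d e f z₄) :
    z₁ * z₂⁻¹ * z₃ = z₄ := by
  obtain ⟨α, rfl⟩ := exists_circle_smul_lineUnit h₃.1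
  obtain ⟨β, rfl⟩ := exists_circle_smul_lineUnit h₁.1
  obtain ⟨γ, rfl⟩ := exists_circle_smul_lineUnit h₁.2.1
  obtain ⟨δ, rfl⟩ := exists_circle_smul_lineUnit h₁.2.2.1
  obtain ⟨ε, rfl⟩ := exists_circle_smul_lineUnit h₂.2.2.1
  obtain ⟨ζ, rfl⟩ := exists_circle_smul_lineUnit h₃.2.2.1
  rw [← ((hasCoord_lineUnit _).smul β γ δ).unique h₁, ← ((hasCoord_lineUnit _).smul α γ ε).unique h₂,
    ← ((hasCoord_lineUnit _).smul α β ζ).unique h₃, ← ((hasCoord_lineUnit _).smul δ ε ζ).unique h₄, h]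
  simp only [Circle.coe_mul, Circle.coe_inv]
  have := Circle.coe_ne_zero
  field_simp

end

theorem HermLineBundle.UnitarySection.exists_circle_smul {E : Type*} [NormedAddCommGroup E]
    [NormedSpace ℝ E] {X : Type u} [TopologicalSpace X] [ChartedSpace E X] {W O : Opens X}
    {L : HermLineBundle E W} {s : ∀ x, L.fiber x} (hs : L.UnitarySection O s) {x : X} (hx : x ∈ O)
    {v : L.fiber x} (hv : ‖v‖ = 1) : ∃ z : Circle, v = (z : ℂ) • s x :=
  exists_circle_smul_of_finrank_eq_one (L.finrank_eq_one x (hs.1.1 hx)) (hs.2 x hx) hv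

end

/-! ### From a cocycle to a relative gerbe of trivial bundles. -/

section
variable {EM EN : Type*} [NormedAddCommGroup EM] [NormedSpace ℝ EM]
  [NormedAddCommGroup EN] [NormedSpace ℝ EN]
  {M N : Type u} [TopologicalSpace M] [ChartedSpace EM M] [TopologicalSpace N] [ChartedSpace EN N]
  {Φ : M → N}

namespace CoverPair

variable {c : CoverPair Φ}

namespace Cocycle

variable (z : c.Cocycle EM EN)

theorem closed_h (i j k : c.I) {x : M} (hi : x ∈ c.U i) (hj : x ∈ c.U j) (hk : x ∈ c.U k) :
    z.val.2.1 ![c.r i, c.r j, c.r k] (Φ x) =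
      z.val.1.1 ![j, k] x - z.val.1.1 ![i, k] x + z.val.1.1 ![i, j] x := by
  have h := z.closed.1 ![i, j, k] x (mem_interOpens_three hi hj hk)
  have h' : z.val.2.1 (c.r ∘ ![i, j, k]) (Φ x) - (Cech.δ z.val.1.1 ![i, j, k]) x = 0 := h
  rw [comp_vec_three, Cech.δ_one_apply, sub_eq_zero] at h'
  exact h'

theorem closed_l (i j : c.I) {x : M} (hi : x ∈ c.U i) (hj : x ∈ c.U j) :
    (formPullback Φ (z.val.2.2.1 ![c.r i, c.r j]) : FormField EM M 1) x =
      z.val.1.2 ![j] x - z.val.1.2 ![i] x - dlog (z.val.1.1 ![i, j]) x := by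
  have h := z.closed.2.1 ![i, j] x (mem_interOpens_two hi hj)
  have h' : (formPullback Φ (z.val.2.2.1 (c.r ∘ ![i, j])) : FormField EM M 1) x -
    ((Cech.δ z.val.1.2 ![i, j]) x - dlog (z.val.1.1 ![i, j]) x) = 0 := h
  rw [comp_vec_two, Cech.δ_zero_apply, sub_eq_zero] at h'
  exact h'

theorem closed_t (i j k l : c.J) {y : N} (hi : y ∈ c.V i) (hj : y ∈ c.V j) (hk : y ∈ c.V k)
    (hl : y ∈ c.V l) :
    z.val.2.1 ![j, k, l] y - z.val.2.1 ![i, k, l] y + z.val.2.1 ![i, j, l] y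
      - z.val.2.1 ![i, j, k] y = 0 := by
  have h := z.closed.2.2.1 ![i, j, k, l] y
    (mem_interOpens.2 fun k => by fin_cases k; exacts [hi, hj, hk, hl])
  have h' : (Cech.δ z.val.2.1 ![i, j, k, l]) y = 0 := h
  rw [Cech.δ_two_apply] at h'
  exact h'

theorem closed_A (i j k : c.J) {y : N} (hi : y ∈ c.V i) (hj : y ∈ c.V j) (hk : y ∈ c.V k) :
    z.val.2.2.1 ![j, k] y - z.val.2.2.1 ![i, k] y + z.val.2.2.1 ![i, j] y
      + dlog (z.val.2.1 ![i, j, k]) y = 0 := by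
  have h := z.closed.2.2.2.1 ![i, j, k] y (mem_interOpens_three hi hj hk)
  have h' : (Cech.δ z.val.2.2.1 ![i, j, k]) y + dlog (z.val.2.1 ![i, j, k]) y = 0 := h
  rw [Cech.δ_one_apply] at h'
  exact h'

theorem closed_ϖ (i j : c.J) {y : N} (hi : y ∈ c.V i) (hj : y ∈ c.V j) :
    z.val.2.2.2 ![j] y - z.val.2.2.2 ![i] y = extD (z.val.2.2.1 ![i, j]) y := by
  have h := z.closed.2.2.2.2 ![i, j] y (mem_interOpens_two hi hj)
  have h' : (Cech.δ z.val.2.2.2 ![i, j]) y - extD (z.val.2.2.1 ![i, j]) y = 0 := h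
  rw [Cech.δ_zero_apply, sub_eq_zero] at h'
  exact h'

end Cocycle

/-- The equations expressing that two cochains of degree `2` of the cone differ by the coboundary
of `β`. -/
structure Cobounds (c : CoverPair Φ) (a b : c.Cone2 EM EN) (β : c.Cone1 EN) : Prop where
  eq_h : ∀ (i j : c.I) (x : M), x ∈ c.U i → x ∈ c.U j → b.1.1 ![i, j] x - a.1.1 ![i, j] x =
    β.2.1 ![c.r i, c.r j] (Φ x) - (β.1 ![j] x - β.1 ![i] x)
  eq_l : ∀ (i : c.I) (x : M), x ∈ c.U i → b.1.2 ![i] x - a.1.2 ![i] x =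
    (formPullback Φ (β.2.2 ![c.r i]) : FormField EM M 1) x - dlog (β.1 ![i]) x
  eq_t : ∀ (i j k : c.J) (y : N), y ∈ c.V i → y ∈ c.V j → y ∈ c.V k →
    b.2.1 ![i, j, k] y - a.2.1 ![i, j, k] y =
      β.2.1 ![j, k] y - β.2.1 ![i, k] y + β.2.1 ![i, j] y
  eq_A : ∀ (i j : c.J) (y : N), y ∈ c.V i → y ∈ c.V j →
    b.2.2.1 ![i, j] y - a.2.2.1 ![i, j] y = β.2.2 ![j] y - β.2.2 ![i] y - dlog (β.2.1 ![i, j]) y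
  eq_ϖ : ∀ (i : c.J) (y : N), y ∈ c.V i →
    b.2.2.2 ![i] y - a.2.2.2 ![i] y = extD (β.2.2 ![i]) y

theorem isZero2_iff_cobounds {a b : c.Cone2 EM EN} {β : c.Cone1 EN} :
    c.IsZero2 (b - a - c.coneD1 EM β) ↔ c.Cobounds a b β := by
  -- The components of the difference unfold definitionally; recording them allows rewriting at
  -- explicit tuples.
  have e1 : ∀ i x, (b - a - c.coneD1 EM β).1.1 i x = b.1.1 i x - a.1.1 i x -
      (β.2.1 (c.r ∘ i) (Φ x) - (Cech.δ β.1 i) x) := fun _ _ => rfl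
  have e2 : ∀ i x, (b - a - c.coneD1 EM β).1.2 i x = b.1.2 i x - a.1.2 i x -
      ((formPullback Φ (β.2.2 (c.r ∘ i)) : FormField EM M 1) x - dlog (β.1 i) x) := fun _ _ => rfl
  have e3 : ∀ i x, (b - a - c.coneD1 EM β).2.1 i x = b.2.1 i x - a.2.1 i x -
      (Cech.δ β.2.1 i) x := fun _ _ => rfl
  have e4 : ∀ i x, (b - a - c.coneD1 EM β).2.2.1 i x = b.2.2.1 i x - a.2.2.1 i x -
      ((Cech.δ β.2.2 i) x - dlog (β.2.1 i) x) := fun _ _ => rfl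
  have e5 : ∀ i x, (b - a - c.coneD1 EM β).2.2.2 i x = b.2.2.2 i x - a.2.2.2 i x -
      extD (β.2.2 i) x := fun _ _ => rfl
  constructor
  · rintro ⟨h1, h2, h3, h4, h5⟩
    refine ⟨fun i j x hi hj => ?_, fun i x hi => ?_, fun i j k y hi hj hk => ?_,
      fun i j y hi hj => ?_, fun i y hi => ?_⟩
    · have h := h1 ![i, j] x (mem_interOpens_two hi hj)
      rw [e1, comp_vec_two, Cech.δ_zero_apply, sub_eq_zero] at h
      exact h
    · have h := h2 ![i] x (mem_interOpens_one hi)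
      rw [e2, comp_vec_one, sub_eq_zero] at h
      exact h
    · have h := h3 ![i, j, k] y (mem_interOpens_three hi hj hk)
      rw [e3, Cech.δ_one_apply, sub_eq_zero] at h
      exact h
    · have h := h4 ![i, j] y (mem_interOpens_two hi hj)
      rw [e4, Cech.δ_zero_apply, sub_eq_zero] at h
      exact h
    · have h := h5 ![i] y (mem_interOpens_one hi)
      rw [e5, sub_eq_zero] at h
      exact h
  · rintro ⟨h1, h2, h3, h4, h5⟩
    refine ⟨fun i x hx => ?_, fun i x hx => ?_, fun i y hy => ?_, fun i y hy => ?_,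
      fun i y hy => ?_⟩
    · have h := h1 (i 0) (i 1) x (mem_interOpens.1 hx 0) (mem_interOpens.1 hx 1)
      rw [e1, Cech.δ_zero_apply, ← vec_eta_two i, comp_vec_two, sub_eq_zero]
      exact h
    · have h := h2 (i 0) x (mem_interOpens.1 hx 0)
      rw [e2, ← vec_eta_one i, comp_vec_one, sub_eq_zero]
      exact h
    · have h := h3 (i 0) (i 1) (i 2) y (mem_interOpens.1 hy 0) (mem_interOpens.1 hy 1)
        (mem_interOpens.1 hy 2)
      rw [e3, Cech.δ_one_apply, ← vec_eta_three i, sub_eq_zero]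
      exact h
    · have h := h4 (i 0) (i 1) y (mem_interOpens.1 hy 0) (mem_interOpens.1 hy 1)
      rw [e4, Cech.δ_zero_apply, ← vec_eta_two i, sub_eq_zero]
      exact h
    · have h := h5 (i 0) y (mem_interOpens.1 hy 0)
      rw [e5, ← vec_eta_one i, sub_eq_zero]
      exact h

/-- The relative gerbe with connection consisting of trivial line bundles given by a cocycle. -/
noncomputable def Cocycle.toGerbe [IsManifold 𝓘(ℝ, EM) ∞ M] [IsManifold 𝓘(ℝ, EN) ∞ N]
    (z : c.Cocycle EM EN) : RelativeGerbe EM EN Φ where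
  cover := c
  gerbe :=
    { L := fun j k => trivialLine EN (c.V j ⊓ c.V k)
      D := fun j k => trivialLine.connection ((z.smooth.2.2.2.1 ![j, k]).mono
        fun _ hy => mem_interOpens_two hy.1 hy.2)
      θ := fun j k l y => ((z.val.2.1 ![j, k, l] y).toMul : ℂ) •
        (trivialLine.unit EN (c.V k ⊓ c.V l) y ⊗ₜ[ℂ]
          (dualVec (trivialLine.unit EN (c.V j ⊓ c.V l) y) ⊗ₜ[ℂ]
            trivialLine.unit EN (c.V j ⊓ c.V k) y))
      curving := fun j => z.val.2.2.2 ![j]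
      -- The standard sections have connection forms A, so this is δA + dlog t = 0; the remaining
      -- axioms are the other components of `z.closed`.
      parallel_θ := fun j k l => by
        refine FramedLine.isParallelUnitary_of_frame (isFrame_tensor₃ _ _ _
          (trivialLine.unitarySection_unit.mono fun y hy => ⟨hy.1.2, hy.2⟩)
          (trivialLine.unitarySection_unit.mono fun y hy => ⟨hy.1.1, hy.2⟩)
          (trivialLine.unitarySection_unit.mono inf_le_left))
          ((z.smooth.2.2.1 ![j, k, l]).mono fun _ hy => mem_interOpens_three hy.1.1 hy.1.2 hy.2)
          fun y hy => ⟨rfl, ?_⟩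
        rw [Pi.add_apply, Pi.add_apply, Pi.neg_apply, trivialLine.form_unit,
          trivialLine.form_unit, trivialLine.form_unit, ← z.closed_A j k l hy.1.1 hy.1.2 hy.2]
        abel
      δ_θ := fun j k l m y hy sjk sjl sjm skl skm slm zklm zjlm zjkm zjkl h1 h2 h3 h4 => by
        obtain ⟨⟨⟨hj, hk⟩, hl⟩, hm⟩ := hy
        refine HasCoord.lineUnit_cocycle ?_ h1 h2 h3 h4
        have h5 := congrArg (fun a : Additive Circle => a.toMul) (z.closed_t j k l m hj hk hl hm)
        simpa only [toMul_sub, toMul_add, toMul_zero, div_eq_mul_inv] using h5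
      smooth_curving := fun j => (z.smooth.2.2.2.2 ![j]).mono fun _ hy => mem_interOpens_one hy
      δ_curving := fun j k => trivialLine.hasCurvature _ fun y hy =>
        z.closed_ϖ j k hy.1 hy.2 }
  Q i := trivialLine EM (c.U i)
  DQ i := trivialLine.connection ((z.smooth.2.1 ![i]).mono fun _ hx => mem_interOpens_one hx)
  ψ i k x := ((z.val.1.1 ![i, k] x).toMul : ℂ) •
    (trivialLine.unit EM (c.U i) x ⊗ₜ[ℂ] (dualVec (trivialLine.unit EM (c.U k) x) ⊗ₜ[ℂ]
      trivialLine.unit EN (c.V (c.r i) ⊓ c.V (c.r k)) (Φ x)))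
  parallel_ψ i k := by
    refine FramedLine.isParallelUnitary_of_frame (isFrame_tensor_pullback _ _ _
      (trivialLine.unitarySection_unit.mono inf_le_left)
      (trivialLine.unitarySection_unit.mono inf_le_right)
      trivialLine.unitarySection_unit fun x hx => ⟨c.mapsTo i x hx.1, c.mapsTo k x hx.2⟩)
      ((z.smooth.1 ![i, k]).mono fun _ hx => mem_interOpens_two hx.1 hx.2) fun x hx => ⟨rfl, ?_⟩
    rw [Pi.add_apply, Pi.add_apply, Pi.neg_apply, trivialLine.form_unit,
      trivialLine.form_unit, formPullback_congr (trivialLine.form_unit _ _),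
      z.closed_l i k hx.1 hx.2]
    abel
  δ_ψ i k l x hx qi qk ql sik sil skl wkl wil wik w h1 h2 h3 h4 := by
    refine HasCoord.lineUnit_coboundary ?_ h1 h2 h3 h4
    have h5 := congrArg (fun a : Additive Circle => a.toMul)
      (z.closed_h i k l hx.1.1 hx.1.2 hx.2)
    simpa only [toMul_sub, toMul_add, div_eq_mul_inv] using h5

variable [IsManifold 𝓘(ℝ, EM) ∞ M] [IsManifold 𝓘(ℝ, EN) ∞ N]

/-- The standard sections of the trivial line bundles of `z.toGerbe`. -/
noncomputable def Cocycle.sectionData (z : c.Cocycle EM EN) : z.toGerbe.SectionData c where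
  ρ := id
  σ := id
  U_le _ := le_rfl
  V_le _ := le_rfl
  r_eq _ := rfl
  exists_U i _ hx := ⟨i, rfl, hx⟩
  exists_V j _ hy := ⟨j, rfl, hy⟩
  s _ _ j k := trivialLine.unit EN (c.V j ⊓ c.V k)
  q _ i := trivialLine.unit EM (c.U i)
  unitary_s _ _ := trivialLine.unitarySection_unit
  unitary_q _ := trivialLine.unitarySection_unit

theorem Cocycle.reads_sectionData (z : c.Cocycle EM EN) : z.sectionData.Reads z.val where
  eq_h i x _ := by
    -- `toGerbe` evaluates the cocycle at explicit tuples, so i is first written as one.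
    rw [← vec_eta_two i]
    exact ⟨trivialLine.norm_unit (W := c.U (i 0)) x, trivialLine.norm_unit (W := c.U (i 1)) x,
      trivialLine.norm_unit (W := c.V (c.r (i 0)) ⊓ c.V (c.r (i 1))) (Φ x), rfl⟩
  eq_l i x _ := by
    rw [← vec_eta_one i]
    exact (trivialLine.form_unit (W := c.U (i 0)) ((z.smooth.2.1 ![i 0]).mono
      fun _ hx => mem_interOpens_one hx) x).symm
  eq_t j y _ := by
    rw [← vec_eta_three j]
    exact ⟨trivialLine.norm_unit (W := c.V (j 1) ⊓ c.V (j 2)) y,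
      trivialLine.norm_unit (W := c.V (j 0) ⊓ c.V (j 2)) y,
      trivialLine.norm_unit (W := c.V (j 0) ⊓ c.V (j 1)) y, rfl⟩
  eq_A j y _ := by
    rw [← vec_eta_two j]
    exact (trivialLine.form_unit (W := c.V (j 0) ⊓ c.V (j 1)) ((z.smooth.2.2.2.1 ![j 0, j 1]).mono
      fun _ hy => mem_interOpens_two hy.1 hy.2) y).symm
  eq_ϖ j y _ := by
    rw [← vec_eta_one j]
    rfl

end CoverPair
end

/-! ### Coboundary identities in `Circle`: the factors of the unit vectors cancel. -/

theorem circle_coboundary_χ {t' t x₁ x₂ x₃ a₁ a₂ a₃ a₄ a₅ a₆ a₇ a₈ a₉ : Circle}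
    (h : t' / t = x₁ / x₂ * x₃) :
    (x₁ : ℂ) * (a₃⁻¹ * a₆ * a₈⁻¹ * a₉ : Circle) * (x₂ * (a₂⁻¹ * a₅ * a₇⁻¹ * a₉ : Circle))⁻¹ *
      (x₃ * (a₁⁻¹ * a₄ * a₇⁻¹ * a₈ : Circle)) =
    t' * (a₃⁻¹ * a₂ * a₁⁻¹ : Circle) * (t * (a₆⁻¹ * a₅ * a₄⁻¹ : Circle))⁻¹ := by
  rw [div_eq_iff_eq_mul] at h
  subst h
  simp only [Circle.coe_mul, Circle.coe_inv, Circle.coe_div]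
  have := Circle.coe_ne_zero
  field_simp

theorem circle_coboundary_η {w' w x b₁ b₂ a₁ a₂ a₃ a₄ a₅ a₆ a₇ a₈ : Circle}
    (h : w' / w = x / (b₂ / b₁)) :
    (w' : ℂ) * (a₁⁻¹ * a₂ * a₅⁻¹ : Circle) * (w * (a₃⁻¹ * a₄ * a₆⁻¹ : Circle))⁻¹ =
    x * (a₅⁻¹ * a₆ * a₇⁻¹ * a₈ : Circle) * (b₁ * (a₁⁻¹ * a₃ * a₇ : Circle)) *
      (b₂ * (a₂⁻¹ * a₄ * a₈ : Circle))⁻¹ := by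
  rw [div_eq_iff_eq_mul] at h
  subst h
  simp only [Circle.coe_mul, Circle.coe_inv, Circle.coe_div]
  have := Circle.coe_ne_zero
  field_simp

/-! ### Cohomologous cocycles give isomorphic relative gerbes. -/

section
variable {EM EN : Type*} [NormedAddCommGroup EM] [NormedSpace ℝ EM]
  [NormedAddCommGroup EN] [NormedSpace ℝ EN]
  {M N : Type u} [TopologicalSpace M] [ChartedSpace EM M] [TopologicalSpace N] [ChartedSpace EN N]
  {Φ : M → N} {𝒢 𝒢' : RelativeGerbe EM EN Φ} {c c' : CoverPair Φ}

namespace CommonRefinement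

variable (R : CommonRefinement c c')

theorem mem_left_V {p : ℕ} {k : Fin (p + 1) → R.J} {y : N} (hy : ∀ a, y ∈ R.W (k a)) :
    y ∈ interOpens c.V ((fun k : R.J => k.1.1) ∘ k) :=
  mem_interOpens.2 fun a => (R.W_le _ (hy a)).1

theorem mem_right_V {p : ℕ} {k : Fin (p + 1) → R.J} {y : N} (hy : ∀ a, y ∈ R.W (k a)) :
    y ∈ interOpens c'.V ((fun k : R.J => k.1.2) ∘ k) :=
  mem_interOpens.2 fun a => (R.W_le _ (hy a)).2

theorem mem_left_U {p : ℕ} {k : Fin (p + 1) → R.I} {y : M} (hy : ∀ a, y ∈ R.O (k a)) :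
    y ∈ interOpens c.U ((fun k : R.I => k.1.1) ∘ k) :=
  mem_interOpens.2 fun a => (R.O_le _ (hy a)).1

theorem mem_right_U {p : ℕ} {k : Fin (p + 1) → R.I} {y : M} (hy : ∀ a, y ∈ R.O (k a)) :
    y ∈ interOpens c'.U ((fun k : R.I => k.1.2) ∘ k) :=
  mem_interOpens.2 fun a => (R.O_le _ (hy a)).2

end CommonRefinement

namespace RelativeGerbe.SectionData

theorem unitary_q_of_eq (S : 𝒢.SectionData c) {h : c.I} {i : 𝒢.cover.I} (hi : S.ρ h = i) :
    (𝒢.Q i).UnitarySection (c.U h) (S.q h i) := by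
  subst hi; exact S.unitary_q h

theorem Reads.hasCoord_ψ_of_eq {S : 𝒢.SectionData c} {z : c.Cone2 EM EN} (hz : S.Reads z)
    (k : Fin 2 → c.I) {i₀ i₁ : 𝒢.cover.I} (h₀ : S.ρ (k 0) = i₀) (h₁ : S.ρ (k 1) = i₁) {x : M}
    (hx : x ∈ interOpens c.U k) :
    HasCoord (𝒢.ψ i₀ i₁ x) (S.q (k 0) i₀ x) (S.q (k 1) i₁ x)
      (S.s (c.r (k 0)) (c.r (k 1)) (𝒢.cover.r i₀) (𝒢.cover.r i₁) (Φ x)) (z.1.1 k x).toMul := by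
  subst h₀ h₁; exact hz.eq_h k x hx

theorem Reads.form_q_of_eq {S : 𝒢.SectionData c} {z : c.Cone2 EM EN} (hz : S.Reads z)
    (k : Fin 1 → c.I) {i₀ : 𝒢.cover.I} (h₀ : S.ρ (k 0) = i₀) {x : M}
    (hx : x ∈ interOpens c.U k) : z.1.2 k x = (𝒢.DQ i₀).form (S.q (k 0) i₀) x := by
  subst h₀; exact hz.eq_l k x hx

theorem Reads.curving_of_eq {S : 𝒢.SectionData c} {z : c.Cone2 EM EN} (hz : S.Reads z)
    (k : Fin 1 → c.J) {j₀ : 𝒢.cover.J} (h₀ : S.σ (k 0) = j₀) {y : N}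
    (hy : y ∈ interOpens c.V k) : z.2.2.2 k y = 𝒢.gerbe.curving j₀ y := by
  subst h₀; exact hz.eq_ϖ k y hy

/-- A common refinement of refinements of two covers as a common refinement of these covers. -/
abbrev commonRefinement (S : 𝒢.SectionData c) (S' : 𝒢'.SectionData c') (R : CommonRefinement c c') :
    CommonRefinement 𝒢.cover 𝒢'.cover where
  K j j' := {k : R.J // S.σ k.1.1 = j ∧ S'.σ k.1.2 = j'}
  H i i' := {h : R.I // S.ρ h.1.1 = i ∧ S'.ρ h.1.2 = i'}
  m _ _ h := ⟨R.r h.1, (S.r_eq _).trans (congrArg _ h.2.1), (S'.r_eq _).trans (congrArg _ h.2.2)⟩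
  W k := R.W k.2.1
  O h := R.O h.2.1
  W_le k := (R.W_le k.2.1).trans (inf_le_inf
    ((S.V_le _).trans_eq (congrArg _ k.2.2.1)) ((S'.V_le _).trans_eq (congrArg _ k.2.2.2)))
  O_le h := (R.O_le h.2.1).trans (inf_le_inf
    ((S.U_le _).trans_eq (congrArg _ h.2.2.1)) ((S'.U_le _).trans_eq (congrArg _ h.2.2.2)))
  exists_mem_W y := by
    obtain ⟨k, hk⟩ := R.exists_mem_W y
    exact ⟨⟨(_, _), k, rfl, rfl⟩, hk⟩
  exists_mem_O x := by
    obtain ⟨h, hh⟩ := R.exists_mem_O x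
    exact ⟨⟨(_, _), h, rfl, rfl⟩, hh⟩
  mapsTo h := R.mapsTo h.2.1

variable [IsManifold 𝓘(ℝ, EN) ∞ N]

/-- Relative gerbes from which cohomologous cocycles are read off are isomorphic. -/
theorem nonempty_isomorphism {S : 𝒢.SectionData c} {S' : 𝒢'.SectionData c'}
    {z : c.Cocycle EM EN} {z' : c'.Cocycle EM EN} (hz : S.Reads z.val) (hz' : S'.Reads z'.val)
    (hzz' : SameDeligneClass EM EN Φ ⟨c, z⟩ ⟨c', z'⟩) : Nonempty (𝒢.Isomorphism 𝒢') := by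
  obtain ⟨R, β, hβ, h0⟩ := hzz'
  dsimp only at R β hβ h0
  have hβ0 := CoverPair.isZero2_iff_cobounds.1 h0
  have unit_s : ∀ k l : (S.commonRefinement S' R).J,
      (𝒢.gerbe.L k.1.1 l.1.1).UnitarySection (R.W k.2.1 ⊓ R.W l.2.1)
        (S.s k.2.1.1.1 l.2.1.1.1 k.1.1 l.1.1) := fun k l =>
    (S.unitary_s_of_eq k.2.2.1 l.2.2.1).mono
      (inf_le_inf ((R.W_le _).trans inf_le_left) ((R.W_le _).trans inf_le_left))
  have unit_s' : ∀ k l : (S.commonRefinement S' R).J,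
      (𝒢'.gerbe.L k.1.2 l.1.2).UnitarySection (R.W k.2.1 ⊓ R.W l.2.1)
        (S'.s k.2.1.1.2 l.2.1.1.2 k.1.2 l.1.2) := fun k l =>
    (S'.unitary_s_of_eq k.2.2.2 l.2.2.2).mono
      (inf_le_inf ((R.W_le _).trans inf_le_right) ((R.W_le _).trans inf_le_right))
  have unit_q : ∀ h : (S.commonRefinement S' R).I,
      (𝒢.Q h.1.1).UnitarySection (R.O h.2.1) (S.q h.2.1.1.1 h.1.1) := fun h =>
    (S.unitary_q_of_eq h.2.2.1).mono ((R.O_le _).trans inf_le_left)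
  have unit_q' : ∀ h : (S.commonRefinement S' R).I,
      (𝒢'.Q h.1.2).UnitarySection (R.O h.2.1) (S'.q h.2.1.1.2 h.1.2) := fun h =>
    (S'.unitary_q_of_eq h.2.2.2).mono ((R.O_le _).trans inf_le_right)
  have hB : ∀ k : R.J, SmoothFormOn (β.2.2 ![k]) (R.W k) := fun k =>
    (hβ.2.2 ![k]).mono fun _ hy => mem_interOpens_one hy
  -- F_k is the trivial line with the form component of β as connection form; χ and η have the two
  -- circle components of β as coordinates. The five equations in `hβ0` are then the five conditions
  -- on an isomorphism.
  let χ : ∀ (k l : (S.commonRefinement S' R).J) (y : N), _ := fun k l y =>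
    ((β.2.1 ![k.2.1, l.2.1] y).toMul : ℂ) •
      (S'.s k.2.1.1.2 l.2.1.1.2 k.1.2 l.1.2 y ⊗ₜ[ℂ]
        (dualVec (S.s k.2.1.1.1 l.2.1.1.1 k.1.1 l.1.1 y) ⊗ₜ[ℂ]
          (trivialLine.unit EN (R.W k.2.1) y ⊗ₜ[ℂ]
            dualVec (trivialLine.unit EN (R.W l.2.1) y))))
  let η : ∀ (h : (S.commonRefinement S' R).I) (x : M), _ := fun h x =>
    ((β.1 ![h.2.1] x).toMul : ℂ) •
      (S'.q h.2.1.1.2 h.1.2 x ⊗ₜ[ℂ] (dualVec (S.q h.2.1.1.1 h.1.1 x) ⊗ₜ[ℂ]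
        dualVec (trivialLine.unit EN (R.W (R.r h.2.1)) (Φ x))))
  have hχ : ∀ k l, ∀ y ∈ R.W k.2.1 ⊓ R.W l.2.1, HasCoord₄ (χ k l y)
      (S'.s k.2.1.1.2 l.2.1.1.2 k.1.2 l.1.2 y) (S.s k.2.1.1.1 l.2.1.1.1 k.1.1 l.1.1 y)
      (trivialLine.unit EN (R.W k.2.1) y) (trivialLine.unit EN (R.W l.2.1) y)
      (β.2.1 ![k.2.1, l.2.1] y).toMul := fun k l y hy =>
    ⟨(unit_s' k l).2 y hy, (unit_s k l).2 y hy, trivialLine.norm_unit y, trivialLine.norm_unit y,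
      rfl⟩
  have hη : ∀ h, ∀ x ∈ R.O h.2.1, HasCoord' (η h x) (S'.q h.2.1.1.2 h.1.2 x)
      (S.q h.2.1.1.1 h.1.1 x) (trivialLine.unit EN (R.W (R.r h.2.1)) (Φ x))
      (β.1 ![h.2.1] x).toMul := fun h x hx =>
    ⟨(unit_q' h).2 x hx, (unit_q h).2 x hx, trivialLine.norm_unit (Φ x), rfl⟩
  refine ⟨{
    R := S.commonRefinement S' R
    F := fun k => trivialLine EN (R.W k.2.1)
    DF := fun k => trivialLine.connection (hB k.2.1)
    χ := χ
    parallel_χ := ?_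
    δ_χ := ?_
    curvature_F := ?_
    η := η
    parallel_η := ?_
    δ_η := ?_ }⟩
  · intro k l
    refine FramedLine.isParallelUnitary_of_frame (isFrame_tensor₄ _ _ _ _ (unit_s' k l)
      (unit_s k l) (trivialLine.unitarySection_unit.mono inf_le_left)
      (trivialLine.unitarySection_unit.mono inf_le_right))
      ((hβ.2.1 ![k.2.1, l.2.1]).mono fun _ hy => mem_interOpens_two hy.1 hy.2)
      fun y hy => ⟨rfl, ?_⟩
    have hy2 : ∀ a, y ∈ R.W (![k.2.1, l.2.1] a) := fun a => by
      fin_cases a; exacts [hy.1, hy.2]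
    have h1 : z'.val.2.2.1 ((fun k : R.J => k.1.2) ∘ ![k.2.1, l.2.1]) y -
        z.val.2.2.1 ((fun k : R.J => k.1.1) ∘ ![k.2.1, l.2.1]) y =
        β.2.2 ![l.2.1] y - β.2.2 ![k.2.1] y - dlog (β.2.1 ![k.2.1, l.2.1]) y :=
      hβ0.eq_A k.2.1 l.2.1 y hy.1 hy.2
    rw [hz'.form_of_eq _ k.2.2.2 l.2.2.2 (R.mem_right_V hy2),
      hz.form_of_eq _ k.2.2.1 l.2.2.1 (R.mem_left_V hy2), ← trivialLine.form_unit (hB k.2.1),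
      ← trivialLine.form_unit (hB l.2.1), eq_sub_iff_add_eq, ← sub_eq_zero] at h1
    refine Eq.trans ?_ h1
    simp only [Pi.add_apply, Pi.neg_apply]
    show _ = (𝒢'.gerbe.D k.1.2 l.1.2).form (S'.s k.2.1.1.2 l.2.1.1.2 k.1.2 l.1.2) y -
      (𝒢.gerbe.D k.1.1 l.1.1).form (S.s k.2.1.1.1 l.2.1.1.1 k.1.1 l.1.1) y + _ - _
    abel
  · intro k l m y hy s'kl s'km s'lm skl skm slm fk fl fm clm ckm ckl t' t h1 h2 h3 h4 h5
    obtain ⟨⟨hk, hl⟩, hm⟩ := hy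
    have hy3 : ∀ a, y ∈ R.W (![k.2.1, l.2.1, m.2.1] a) := fun a => by
      fin_cases a; exacts [hk, hl, hm]
    have e4 := hz'.hasCoord_of_eq _ k.2.2.2 l.2.2.2 m.2.2.2 (R.mem_right_V hy3)
    have e5 := hz.hasCoord_of_eq _ k.2.2.1 l.2.2.1 m.2.2.1 (R.mem_left_V hy3)
    -- The test vectors are multiples of the chosen sections, which turns their coordinates into
    -- values of β and the cocycles times the factors a₁, …, a₉.
    obtain ⟨a₁, rfl⟩ := (unit_s' k l).exists_circle_smul ⟨hk, hl⟩ h3.1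
    obtain ⟨a₂, rfl⟩ := (unit_s' k m).exists_circle_smul ⟨hk, hm⟩ h2.1
    obtain ⟨a₃, rfl⟩ := (unit_s' l m).exists_circle_smul ⟨hl, hm⟩ h1.1
    obtain ⟨a₄, rfl⟩ := (unit_s k l).exists_circle_smul ⟨hk, hl⟩ h3.2.1
    obtain ⟨a₅, rfl⟩ := (unit_s k m).exists_circle_smul ⟨hk, hm⟩ h2.2.1
    obtain ⟨a₆, rfl⟩ := (unit_s l m).exists_circle_smul ⟨hl, hm⟩ h1.2.1
    obtain ⟨a₇, rfl⟩ := (trivialLine.unitarySection_unit (E := EN)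
      (W := R.W k.2.1)).exists_circle_smul hk h3.2.2.1
    obtain ⟨a₈, rfl⟩ := (trivialLine.unitarySection_unit (E := EN)
      (W := R.W l.2.1)).exists_circle_smul hl h1.2.2.1
    obtain ⟨a₉, rfl⟩ := (trivialLine.unitarySection_unit (E := EN)
      (W := R.W m.2.1)).exists_circle_smul hm h1.2.2.2.1
    rw [← ((hχ l m y ⟨hl, hm⟩).smul a₃ a₆ a₈ a₉).unique h1,
      ← ((hχ k m y ⟨hk, hm⟩).smul a₂ a₅ a₇ a₉).unique h2,
      ← ((hχ k l y ⟨hk, hl⟩).smul a₁ a₄ a₇ a₈).unique h3,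
      ← (e4.smul a₃ a₂ a₁).unique h4, ← (e5.smul a₆ a₅ a₄).unique h5]
    exact circle_coboundary_χ (congrArg Additive.toMul (hβ0.eq_t k.2.1 l.2.1 m.2.1 y hk hl hm))
  · intro k
    refine trivialLine.hasCurvature _ fun y hy => ?_
    have hy1 : ∀ a, y ∈ R.W (![k.2.1] a) := fun a => by fin_cases a; exact hy
    have h1 : z'.val.2.2.2 ((fun k : R.J => k.1.2) ∘ ![k.2.1]) y -
        z.val.2.2.2 ((fun k : R.J => k.1.1) ∘ ![k.2.1]) y = extD (β.2.2 ![k.2.1]) y :=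
      hβ0.eq_ϖ k.2.1 y hy
    rwa [hz'.curving_of_eq _ k.2.2.2 (R.mem_right_V hy1),
      hz.curving_of_eq _ k.2.2.1 (R.mem_left_V hy1)] at h1
  · intro h
    refine FramedLine.isParallelUnitary_of_frame (isFrame_tensor_dual_pullback _ _ _
      (unit_q' h) (unit_q h) trivialLine.unitarySection_unit fun x hx => R.mapsTo h.2.1 x hx)
      ((hβ.1 ![h.2.1]).mono fun _ hx => mem_interOpens_one hx) fun x hx => ⟨rfl, ?_⟩
    have hx1 : ∀ a, x ∈ R.O (![h.2.1] a) := fun a => by fin_cases a; exact hx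
    have h1 : z'.val.1.2 ((fun k : R.I => k.1.2) ∘ ![h.2.1]) x -
        z.val.1.2 ((fun k : R.I => k.1.1) ∘ ![h.2.1]) x =
        (formPullback Φ (β.2.2 ![R.r h.2.1]) : FormField EM M 1) x - dlog (β.1 ![h.2.1]) x :=
      hβ0.eq_l h.2.1 x hx
    rw [hz'.form_q_of_eq _ h.2.2.2 (R.mem_right_U hx1),
      hz.form_q_of_eq _ h.2.2.1 (R.mem_left_U hx1), eq_sub_iff_add_eq, ← sub_eq_zero,
      ← formPullback_congr (trivialLine.form_unit (hB (R.r h.2.1)) (Φ x))] at h1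
    refine Eq.trans ?_ h1
    simp only [Pi.add_apply, Pi.neg_apply]
    show _ = (𝒢'.DQ h.1.2).form (S'.q h.2.1.1.2 h.1.2) x -
      (𝒢.DQ h.1.1).form (S.q h.2.1.1.1 h.1.1) x + _ - _
    abel
  · intro g h x hx q'g q'h qg qh s' s fg fh w' w t ag ah h1 h2 h3 h4 h5
    obtain ⟨hg, hh⟩ := hx
    have hg' := R.mapsTo g.2.1 x hg
    have hh' := R.mapsTo h.2.1 x hh
    have hx2 : ∀ a, x ∈ R.O (![g.2.1, h.2.1] a) := fun a => by
      fin_cases a; exacts [hg, hh]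
    have e1 := hz'.hasCoord_ψ_of_eq _ g.2.2.2 h.2.2.2 (R.mem_right_U hx2)
    have e2 := hz.hasCoord_ψ_of_eq _ g.2.2.1 h.2.2.1 (R.mem_left_U hx2)
    obtain ⟨a₁, rfl⟩ := (unit_q' g).exists_circle_smul hg h1.1
    obtain ⟨a₂, rfl⟩ := (unit_q' h).exists_circle_smul hh h1.2.1
    obtain ⟨a₃, rfl⟩ := (unit_q g).exists_circle_smul hg h2.1
    obtain ⟨a₄, rfl⟩ := (unit_q h).exists_circle_smul hh h2.2.1
    obtain ⟨a₅, rfl⟩ := (unit_s' ((S.commonRefinement S' R).r g)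
      ((S.commonRefinement S' R).r h)).exists_circle_smul ⟨hg', hh'⟩ h1.2.2.1
    obtain ⟨a₆, rfl⟩ := (unit_s ((S.commonRefinement S' R).r g)
      ((S.commonRefinement S' R).r h)).exists_circle_smul ⟨hg', hh'⟩ h2.2.2.1
    obtain ⟨a₇, rfl⟩ := (trivialLine.unitarySection_unit (E := EN)
      (W := R.W (R.r g.2.1))).exists_circle_smul hg' h4.2.2.1
    obtain ⟨a₈, rfl⟩ := (trivialLine.unitarySection_unit (E := EN)
      (W := R.W (R.r h.2.1))).exists_circle_smul hh' h5.2.2.1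
    rw [← (e1.smul a₁ a₂ a₅).unique h1, ← (e2.smul a₃ a₄ a₆).unique h2,
      ← ((hχ _ _ _ ⟨hg', hh'⟩).smul a₅ a₆ a₇ a₈).unique h3,
      ← ((hη g x hg).smul a₁ a₃ a₇).unique h4, ← ((hη h x hh).smul a₂ a₄ a₈).unique h5]
    exact circle_coboundary_η (congrArg Additive.toMul (hβ0.eq_h g.2.1 h.2.1 x hg hh))

end RelativeGerbe.SectionData
end

/-! ### Isomorphic relative gerbes give cohomologous cocycles. -/

section
variable {EM EN : Type*} [NormedAddCommGroup EM] [NormedSpace ℝ EM]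
  [NormedAddCommGroup EN] [NormedSpace ℝ EN]
  {M N : Type u} [TopologicalSpace M] [ChartedSpace EM M] [TopologicalSpace N] [ChartedSpace EN N]
  {Φ : M → N} {𝒢 𝒢' : RelativeGerbe EM EN Φ} {c c' : CoverPair Φ}

namespace RelativeGerbe.SectionData

/-- The common refinement of two refinements of the covers of isomorphic relative gerbes, on which
the line bundles of the isomorphism have unitary frames. -/
abbrev isomorphismRefinement (hΦ : Continuous Φ) (S : 𝒢.SectionData c) (S' : 𝒢'.SectionData c')
    (𝓘 : 𝒢.Isomorphism 𝒢') : CommonRefinement c c' where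
  K k k' := {p : Σ κ : 𝓘.R.J, (𝓘.F κ).ι // S.σ k = p.1.1.1 ∧ S'.σ k' = p.1.1.2}
  H h h' := {p : Σ g : 𝓘.R.I, (𝓘.F (𝓘.R.r g)).ι // S.ρ h = p.1.1.1 ∧ S'.ρ h' = p.1.1.2}
  m _ _ p := ⟨⟨𝓘.R.r p.1.1, p.1.2⟩, (S.r_eq _).trans (congrArg _ p.2.1),
    (S'.r_eq _).trans (congrArg _ p.2.2)⟩
  W k := c.V k.1.1 ⊓ c'.V k.1.2 ⊓ (𝓘.F k.2.1.1).dom k.2.1.2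
  O h := c.U h.1.1 ⊓ c'.U h.1.2 ⊓ 𝓘.R.O h.2.1.1 ⊓
    ⟨Φ ⁻¹' (𝓘.F (𝓘.R.r h.2.1.1)).dom h.2.1.2, (Opens.isOpen _).preimage hΦ⟩
  W_le _ := inf_le_left
  O_le _ := inf_le_left.trans inf_le_left
  exists_mem_W y := by
    obtain ⟨κ, hκ⟩ := 𝓘.R.exists_mem_W y
    -- The refined index must lie over the very index of 𝒢 that κ prescribes; this is what
    -- `exists_V` was made for.
    obtain ⟨k, hk, hyk⟩ := S.exists_V _ y (𝓘.R.W_le κ hκ).1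
    obtain ⟨k', hk', hyk'⟩ := S'.exists_V _ y (𝓘.R.W_le κ hκ).2
    obtain ⟨a, ha⟩ := (𝓘.F κ).exists_mem_dom y hκ
    exact ⟨⟨(k, k'), ⟨κ, a⟩, hk, hk'⟩, ⟨hyk, hyk'⟩, ha⟩
  exists_mem_O x := by
    obtain ⟨g, hg⟩ := 𝓘.R.exists_mem_O x
    obtain ⟨h, hh, hxh⟩ := S.exists_U _ x (𝓘.R.O_le g hg).1
    obtain ⟨h', hh', hxh'⟩ := S'.exists_U _ x (𝓘.R.O_le g hg).2
    obtain ⟨a, ha⟩ := (𝓘.F (𝓘.R.r g)).exists_mem_dom (Φ x) (𝓘.R.mapsTo g x hg)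
    exact ⟨⟨(h, h'), ⟨g, a⟩, hh, hh'⟩, ⟨⟨hxh, hxh'⟩, hg⟩, ha⟩
  mapsTo h x hx := ⟨⟨c.mapsTo _ x hx.1.1.1, c'.mapsTo _ x hx.1.1.2⟩, hx.2⟩

/-- The cocycles read off from isomorphic relative gerbes are cohomologous. -/
theorem sameDeligneClass (hΦ : ContMDiff 𝓘(ℝ, EM) 𝓘(ℝ, EN) ∞ Φ)
    {S : 𝒢.SectionData c} {S' : 𝒢'.SectionData c'}
    {z : c.Cocycle EM EN} {z' : c'.Cocycle EM EN} (hz : S.Reads z.val) (hz' : S'.Reads z'.val)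
    (𝓘 : 𝒢.Isomorphism 𝒢') : SameDeligneClass EM EN Φ ⟨c, z⟩ ⟨c', z'⟩ := by
  set R := S.isomorphismRefinement hΦ.continuous S' 𝓘
  have hW : ∀ k : R.J, R.W k ≤ 𝓘.R.W k.2.1.1 := fun k =>
    inf_le_right.trans ((𝓘.F k.2.1.1).dom_le k.2.1.2)
  have hO : ∀ h : R.I, R.O h ≤ 𝓘.R.O h.2.1.1 := fun h => inf_le_left.trans inf_le_right
  have unit_s : ∀ k l : R.J,
      (𝒢.gerbe.L k.2.1.1.1.1 l.2.1.1.1.1).UnitarySection (R.W k ⊓ R.W l)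
        (S.s k.1.1 l.1.1 k.2.1.1.1.1 l.2.1.1.1.1) := fun k l =>
    (S.unitary_s_of_eq k.2.2.1 l.2.2.1).mono
      (inf_le_inf ((R.W_le _).trans inf_le_left) ((R.W_le _).trans inf_le_left))
  have unit_s' : ∀ k l : R.J,
      (𝒢'.gerbe.L k.2.1.1.1.2 l.2.1.1.1.2).UnitarySection (R.W k ⊓ R.W l)
        (S'.s k.1.2 l.1.2 k.2.1.1.1.2 l.2.1.1.1.2) := fun k l =>
    (S'.unitary_s_of_eq k.2.2.2 l.2.2.2).mono
      (inf_le_inf ((R.W_le _).trans inf_le_right) ((R.W_le _).trans inf_le_right))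
  have unit_q : ∀ h : R.I,
      (𝒢.Q h.2.1.1.1.1).UnitarySection (R.O h) (S.q h.1.1 h.2.1.1.1.1) := fun h =>
    (S.unitary_q_of_eq h.2.2.1).mono ((R.O_le _).trans inf_le_left)
  have unit_q' : ∀ h : R.I,
      (𝒢'.Q h.2.1.1.1.2).UnitarySection (R.O h) (S'.q h.1.2 h.2.1.1.1.2) := fun h =>
    (S'.unitary_q_of_eq h.2.2.2).mono ((R.O_le _).trans inf_le_right)
  have unit_f : ∀ k : R.J, (𝓘.F k.2.1.1).UnitarySection (R.W k) ((𝓘.F k.2.1.1).frame k.2.1.2) :=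
    fun k => ((𝓘.F k.2.1.1).unitarySection_frame k.2.1.2).mono inf_le_right
  have hχ : ∀ k l : R.J, ∃ t : N → Additive Circle, CircleSmoothOn EN t (R.W k ⊓ R.W l) ∧
      ∀ y ∈ R.W k ⊓ R.W l, _ ∧ _ := fun k l =>
    exists_hasCoord₄ ((𝓘.parallel_χ k.2.1.1 l.2.1.1).mono (inf_le_inf (hW k) (hW l)))
      (unit_s' k l) (unit_s k l) ((unit_f k).mono inf_le_left) ((unit_f l).mono inf_le_right)
  have hη : ∀ h : R.I, ∃ t : M → Additive Circle, CircleSmoothOn EM t (R.O h) ∧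
      ∀ x ∈ R.O h, _ ∧ _ := fun h =>
    exists_hasCoord'_pullback hΦ ((𝓘.parallel_η h.2.1.1).mono (hO h)) (unit_q' h) (unit_q h)
      (unit_f (R.r h)) (R.mapsTo h)
  choose t ht ht' using hχ
  choose b hb hb' using hη
  -- The cobounding cochain: coordinates b of η and t of χ, and the connection forms of the frames
  -- of F.
  let β : R.toCoverPair.Cone1 EN := (fun h => b (h 0), fun k => t (k 0) (k 1),
    fun k => (𝓘.DF (k 0).2.1.1).form ((𝓘.F (k 0).2.1.1).frame (k 0).2.1.2))
  refine ⟨R, β, ⟨fun h => (hb (h 0)).mono (interOpens_le 0),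
    fun k => (ht (k 0) (k 1)).mono (le_inf (interOpens_le 0) (interOpens_le 1)),
    fun k => (𝓘.DF _).smooth_form ((unit_f (k 0)).mono (interOpens_le 0))⟩,
    CoverPair.isZero2_iff_cobounds.2 ⟨?_, ?_, ?_, ?_, ?_⟩⟩
  · intro g h x hg hh
    have hx2 : ∀ a, x ∈ R.O (![g, h] a) := fun a => by
      fin_cases a; exacts [hg, hh]
    have hr := R.mapsTo g x hg
    have hr' := R.mapsTo h x hh
    have h1 := 𝓘.δ_η g.2.1.1 h.2.1.1 x ⟨hO g hg, hO h hh⟩ _ _ _ _ _ _ _ _ _ _ _ _ _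
      (hz'.hasCoord_ψ_of_eq _ g.2.2.2 h.2.2.2 (R.mem_right_U hx2))
      (hz.hasCoord_ψ_of_eq _ g.2.2.1 h.2.2.1 (R.mem_left_U hx2))
      (ht' (R.r g) (R.r h) (Φ x) ⟨hr, hr'⟩).1 (hb' g x hg).1 (hb' h x hh).1
    apply Additive.toMul.injective
    apply Circle.coe_injective
    simp only [toMul_sub, Circle.coe_div]
    refine Eq.trans ?_ (h1.trans ?_)
    · rw [div_eq_mul_inv]
      rfl
    · show _ = ((t (R.r g) (R.r h) (Φ x)).toMul : ℂ) / ((b h x).toMul / (b g x).toMul)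
      have := Circle.coe_ne_zero
      field_simp
  · intro h x hh
    have hx1 : ∀ a, x ∈ R.O (![h] a) := fun a => by fin_cases a; exact hh
    have h1 := (hb' h x hh).2
    show z'.val.1.2 ((fun k : R.I => k.1.2) ∘ ![h]) x -
      z.val.1.2 ((fun k : R.I => k.1.1) ∘ ![h]) x = _
    rw [hz'.form_q_of_eq _ h.2.2.2 (R.mem_right_U hx1),
      hz.form_q_of_eq _ h.2.2.1 (R.mem_left_U hx1), eq_sub_iff_add_eq, ← sub_eq_zero]
    refine Eq.trans ?_ h1
    show (𝒢'.DQ h.2.1.1.1.2).form (S'.q h.1.2 h.2.1.1.1.2) x -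
      (𝒢.DQ h.2.1.1.1.1).form (S.q h.1.1 h.2.1.1.1.1) x + dlog (b h) x -
      (formPullback Φ ((𝓘.DF (R.r h).2.1.1).form ((𝓘.F (R.r h).2.1.1).frame (R.r h).2.1.2)) :
        FormField EM M 1) x = _
    abel
  · intro k l m y hk hl hm
    have hy3 : ∀ a, y ∈ R.W (![k, l, m] a) := fun a => by
      fin_cases a; exacts [hk, hl, hm]
    have h1 := 𝓘.δ_χ k.2.1.1 l.2.1.1 m.2.1.1 y ⟨⟨hW k hk, hW l hl⟩, hW m hm⟩
      _ _ _ _ _ _ _ _ _ _ _ _ _ _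
      (ht' l m y ⟨hl, hm⟩).1 (ht' k m y ⟨hk, hm⟩).1 (ht' k l y ⟨hk, hl⟩).1
      (hz'.hasCoord_of_eq _ k.2.2.2 l.2.2.2 m.2.2.2 (R.mem_right_V hy3))
      (hz.hasCoord_of_eq _ k.2.2.1 l.2.2.1 m.2.2.1 (R.mem_left_V hy3))
    apply Additive.toMul.injective
    apply Circle.coe_injective
    simp only [toMul_sub, toMul_add, Circle.coe_div, Circle.coe_mul]
    refine Eq.trans ?_ (h1.symm.trans ?_)
    · rw [div_eq_mul_inv]
      rfl
    · rw [div_eq_mul_inv]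
      rfl
  · intro k l y hk hl
    have hy2 : ∀ a, y ∈ R.W (![k, l] a) := fun a => by
      fin_cases a; exacts [hk, hl]
    have h1 := (ht' k l y ⟨hk, hl⟩).2
    show z'.val.2.2.1 ((fun k : R.J => k.1.2) ∘ ![k, l]) y -
        z.val.2.2.1 ((fun k : R.J => k.1.1) ∘ ![k, l]) y = _
    rw [hz'.form_of_eq _ k.2.2.2 l.2.2.2 (R.mem_right_V hy2),
      hz.form_of_eq _ k.2.2.1 l.2.2.1 (R.mem_left_V hy2), eq_sub_iff_add_eq, ← sub_eq_zero]
    refine Eq.trans ?_ h1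
    show (𝒢'.gerbe.D k.2.1.1.1.2 l.2.1.1.1.2).form (S'.s k.1.2 l.1.2 k.2.1.1.1.2 l.2.1.1.1.2) y -
      (𝒢.gerbe.D k.2.1.1.1.1 l.2.1.1.1.1).form (S.s k.1.1 l.1.1 k.2.1.1.1.1 l.2.1.1.1.1) y +
      dlog (t k l) y - ((𝓘.DF l.2.1.1).form ((𝓘.F l.2.1.1).frame l.2.1.2) y -
        (𝓘.DF k.2.1.1).form ((𝓘.F k.2.1.1).frame k.2.1.2) y) = _
    abel
  · intro k y hk
    have hy1 : ∀ a, y ∈ R.W (![k] a) := fun a => by fin_cases a; exact hk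
    show z'.val.2.2.2 ((fun k : R.J => k.1.2) ∘ ![k]) y -
        z.val.2.2.2 ((fun k : R.J => k.1.1) ∘ ![k]) y = _
    rw [hz'.curving_of_eq _ k.2.2.2 (R.mem_right_V hy1),
      hz.curving_of_eq _ k.2.2.1 (R.mem_left_V hy1)]
    exact 𝓘.curvature_F k.2.1.1 _ _ (unit_f k) y hk

end RelativeGerbe.SectionData

/-- The diagonal common refinement of a cover pair with itself. -/
abbrev CommonRefinement.diagonal (c : CoverPair Φ) : CommonRefinement c c where
  K j j' := ULift (PLift (j = j'))
  H i i' := ULift (PLift (i = i'))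
  m _ _ h := ⟨⟨congrArg c.r h.down.down⟩⟩
  W k := c.V k.1.1
  O h := c.U h.1.1
  W_le k := le_inf le_rfl (by rw [k.2.down.down])
  O_le h := le_inf le_rfl (by rw [h.2.down.down])
  exists_mem_W y := by
    obtain ⟨j, hj⟩ := c.exists_mem_V y
    exact ⟨⟨(j, j), ⟨⟨rfl⟩⟩⟩, hj⟩
  exists_mem_O x := by
    obtain ⟨i, hi⟩ := c.exists_mem_U x
    exact ⟨⟨(i, i), ⟨⟨rfl⟩⟩⟩, hi⟩
  mapsTo h := c.mapsTo h.1.1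

theorem SameDeligneClass.refl (a : Σ c : CoverPair Φ, c.Cocycle EM EN) :
    SameDeligneClass EM EN Φ a a := by
  obtain ⟨c, z⟩ := a
  have hJ : (fun k : (CommonRefinement.diagonal c).J => k.1.2) = fun k => k.1.1 :=
    funext fun k => k.2.down.down.symm
  have hI : (fun h : (CommonRefinement.diagonal c).I => h.1.2) = fun h => h.1.1 :=
    funext fun h => h.2.down.down.symm
  -- The zero cochain cobounds, since dlog and d of zero vanish and both restrictions to the
  -- diagonal coincide.
  refine ⟨CommonRefinement.diagonal c, (0, 0, 0), ⟨fun _ => circleSmoothOn_const 0 _,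
    fun _ => circleSmoothOn_const 0 _, fun _ => smoothFormOn_zero _⟩, ?_⟩
  rw [CoverPair.isZero2_iff_cobounds, hJ, hI]
  refine ⟨fun i j x _ _ => ?_, fun i x _ => ?_, fun i j k y _ _ _ => ?_, fun i j y _ _ => ?_,
    fun i y _ => ?_⟩
  · simp
  · rw [sub_self]
    exact (sub_eq_zero.2 (dlog_zero x).symm).symm
  · simp
  · rw [sub_self]
    show 0 = (0 : FormField EN N 1) y - (0 : FormField EN N 1) y - dlog 0 y
    rw [dlog_zero, sub_zero, sub_self]
  · rw [sub_self]
    exact (extD_zero y).symm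

end

/-! ### The bijection. -/

section
variable {EM EN : Type*} [NormedAddCommGroup EM] [NormedSpace ℝ EM]
  [NormedAddCommGroup EN] [NormedSpace ℝ EN]
  {M N : Type u} [TopologicalSpace M] [ChartedSpace EM M] [TopologicalSpace N] [ChartedSpace EN N]
  {Φ : M → N} {𝒢 : RelativeGerbe EM EN Φ} {c c' : CoverPair Φ}

namespace RelativeGerbe

/-- Unitary sections over the cover of `𝒢` itself. -/
def SectionData.ofUnitarySections (s : ∀ j k y, (𝒢.gerbe.L j k).fiber y)
    (q : ∀ i x, (𝒢.Q i).fiber x)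
    (hs : ∀ j k, (𝒢.gerbe.L j k).UnitarySection (𝒢.cover.V j ⊓ 𝒢.cover.V k) (s j k))
    (hq : ∀ i, (𝒢.Q i).UnitarySection (𝒢.cover.U i) (q i)) : 𝒢.SectionData 𝒢.cover where
  ρ := id
  σ := id
  U_le _ := le_rfl
  V_le _ := le_rfl
  r_eq _ := rfl
  exists_U i _ hx := ⟨i, rfl, hx⟩
  exists_V j _ hy := ⟨j, rfl, hy⟩
  s _ _ := s
  q _ := q
  unitary_s := hs
  unitary_q := hq

theorem SectionData.reads_ofUnitarySections_iff {s : ∀ j k y, (𝒢.gerbe.L j k).fiber y}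
    {q : ∀ i x, (𝒢.Q i).fiber x}
    {hs : ∀ j k, (𝒢.gerbe.L j k).UnitarySection (𝒢.cover.V j ⊓ 𝒢.cover.V k) (s j k)}
    {hq : ∀ i, (𝒢.Q i).UnitarySection (𝒢.cover.U i) (q i)} {z : 𝒢.cover.Cone2 EM EN} :
    (ofUnitarySections s q hs hq).Reads z ↔ 𝒢.IsReadOff s q z :=
  ⟨fun h => ⟨h.eq_h, h.eq_l, h.eq_t, h.eq_A, h.eq_ϖ⟩,
    fun h => ⟨h.eq_h, h.eq_l, h.eq_t, h.eq_A, h.eq_ϖ⟩⟩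

/-- A cocycle can be read off from every relative gerbe with connection, on some refinement. -/
theorem exists_reads [T2Space N] [ParacompactSpace N] (hΦ : ContMDiff 𝓘(ℝ, EM) 𝓘(ℝ, EN) ∞ Φ)
    (𝒢 : RelativeGerbe EM EN Φ) :
    ∃ (a : Σ c : CoverPair Φ, c.Cocycle EM EN) (S : 𝒢.SectionData a.1), S.Reads a.2.val := by
  obtain ⟨c, ⟨S⟩⟩ := 𝒢.exists_sectionData hΦ.continuous
  obtain ⟨z, hz⟩ := S.exists_reads hΦ
  exact ⟨⟨c, z⟩, S, hz⟩

variable [IsManifold 𝓘(ℝ, EN) ∞ N]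

/-- Reading z twice makes 𝒢 isomorphic to itself; this isomorphism is then read with `S` on one side
and `S'` on the other. -/
theorem SectionData.Reads.sameDeligneClass (hΦ : ContMDiff 𝓘(ℝ, EM) 𝓘(ℝ, EN) ∞ Φ)
    {S : 𝒢.SectionData c} {S' : 𝒢.SectionData c'} {z : c.Cocycle EM EN} {z' : c'.Cocycle EM EN}
    (hz : S.Reads z.val) (hz' : S'.Reads z'.val) : SameDeligneClass EM EN Φ ⟨c, z⟩ ⟨c', z'⟩ := by
  obtain ⟨𝓘⟩ := nonempty_isomorphism hz hz (SameDeligneClass.refl ⟨c, z⟩)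
  exact SectionData.sameDeligneClass hΦ hz hz' 𝓘

/-- The same cocycle z is read off from z.toGerbe and from 𝒢, and z is cohomologous to itself. -/
theorem SectionData.Reads.mk_toGerbe [IsManifold 𝓘(ℝ, EM) ∞ M] {S : 𝒢.SectionData c} {z : c.Cocycle EM EN}
    (hz : S.Reads z.val) :
    (Quot.mk _ z.toGerbe : RelativeGerbeClass EM EN Φ) = Quot.mk _ 𝒢 :=
  Quot.sound (nonempty_isomorphism z.reads_sectionData hz (SameDeligneClass.refl ⟨c, z⟩))

end RelativeGerbe

/-- The bijection between isomorphism classes of relative gerbes with connection and relative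
Deligne cohomology. -/
noncomputable def relativeGerbeClassEquiv [IsManifold 𝓘(ℝ, EM) ∞ M] [IsManifold 𝓘(ℝ, EN) ∞ N]
    [T2Space N] [ParacompactSpace N] (hΦ : ContMDiff 𝓘(ℝ, EM) 𝓘(ℝ, EN) ∞ Φ) :
    RelativeGerbeClass EM EN Φ ≃ RelativeDeligneH2 EM EN Φ where
  -- Only related pairs have to be checked, so neither relation needs to be shown symmetric or
  -- transitive.
  toFun := Quot.lift (fun 𝒢 => Quot.mk _ (𝒢.exists_reads hΦ).choose) fun 𝒢 𝒢' ⟨𝓘⟩ =>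
    Quot.sound (RelativeGerbe.SectionData.sameDeligneClass hΦ (𝒢.exists_reads hΦ).choose_spec.choose_spec
      (𝒢'.exists_reads hΦ).choose_spec.choose_spec 𝓘)
  invFun := Quot.lift (fun a => Quot.mk _ a.2.toGerbe) fun a b h =>
    Quot.sound (RelativeGerbe.SectionData.nonempty_isomorphism a.2.reads_sectionData
      b.2.reads_sectionData h)
  left_inv := by
    rintro ⟨𝒢⟩
    exact (𝒢.exists_reads hΦ).choose_spec.choose_spec.mk_toGerbe
  right_inv := by
    rintro ⟨a⟩
    exact Quot.sound ((a.2.toGerbe.exists_reads hΦ).choose_spec.choose_spec.sameDeligneClass hΦ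
      a.2.reads_sectionData)

theorem relativeGerbeClassEquiv_mk [IsManifold 𝓘(ℝ, EM) ∞ M] [IsManifold 𝓘(ℝ, EN) ∞ N]
    [T2Space N] [ParacompactSpace N] (hΦ : ContMDiff 𝓘(ℝ, EM) 𝓘(ℝ, EN) ∞ Φ)
    {S : 𝒢.SectionData c} {z : c.Cocycle EM EN} (hz : S.Reads z.val) :
    relativeGerbeClassEquiv hΦ (Quot.mk _ 𝒢) = Quot.mk _ ⟨c, z⟩ :=
  Quot.sound ((𝒢.exists_reads hΦ).choose_spec.choose_spec.sameDeligneClass hΦ hz)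

end

/-! ### Existence and uniqueness of the bijection. -/

theorem mainTheorem3
    {EM EN : Type*} [NormedAddCommGroup EM] [NormedSpace ℝ EM] [FiniteDimensional ℝ EM]
    [NormedAddCommGroup EN] [NormedSpace ℝ EN] [FiniteDimensional ℝ EN]
    {M N : Type u}
    [TopologicalSpace M] [T2Space M] [SecondCountableTopology M]
    [ChartedSpace EM M] [IsManifold 𝓘(ℝ, EM) ∞ M]
    [TopologicalSpace N] [T2Space N] [SecondCountableTopology N]
    [ChartedSpace EN N] [IsManifold 𝓘(ℝ, EN) ∞ N]
    (Φ : M → N) (hΦ : ContMDiff 𝓘(ℝ, EM) 𝓘(ℝ, EN) ∞ Φ) :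
    ∃! e : RelativeGerbeClass EM EN Φ ≃ RelativeDeligneH2 EM EN Φ,
      ∀ (𝒢 : RelativeGerbe EM EN Φ)
        (s : ∀ j k y, (𝒢.gerbe.L j k).fiber y) (q : ∀ i x, (𝒢.Q i).fiber x),
        (∀ j k, (𝒢.gerbe.L j k).UnitarySection (𝒢.cover.V j ⊓ 𝒢.cover.V k) (s j k)) →
        (∀ i, (𝒢.Q i).UnitarySection (𝒢.cover.U i) (q i)) →
        ∃ z : 𝒢.cover.Cocycle EM EN, 𝒢.IsReadOff s q z.val ∧
          e (Quot.mk _ 𝒢) = Quot.mk _ ⟨𝒢.cover, z⟩ := by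

  have := paracompactSpace_of_chartedSpace EN N
  refine ⟨relativeGerbeClassEquiv hΦ, fun 𝒢 s q hs hq => ?_, fun e he => Equiv.ext ?_⟩
  · obtain ⟨z, hz⟩ := (RelativeGerbe.SectionData.ofUnitarySections s q hs hq).exists_reads hΦ
    exact ⟨z, RelativeGerbe.SectionData.reads_ofUnitarySections_iff.1 hz, relativeGerbeClassEquiv_mk hΦ hz⟩
  · rintro ⟨𝒢⟩
    obtain ⟨⟨c, z⟩, S, hz⟩ := 𝒢.exists_reads hΦ
    -- The class of 𝒢 is that of z.toGerbe, which has unitary sections over its own covers. The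
    -- property of e yields a cocycle w read off there with e of the class equal to that of w, and
    -- `relativeGerbeClassEquiv` takes the same value.
    obtain ⟨w, hw, hew⟩ := he z.toGerbe (fun j k => z.sectionData.s j k j k)
      (fun i => z.sectionData.q i i) z.sectionData.unitary_s z.sectionData.unitary_q
    refine (congrArg e hz.mk_toGerbe).symm.trans (hew.trans ?_)
    rw [← relativeGerbeClassEquiv_mk hΦ (RelativeGerbe.SectionData.reads_ofUnitarySections_iff.2 hw),
      hz.mk_toGerbe]
    exacts [z.sectionData.unitary_s, z.sectionData.unitary_q]
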